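/- Let $\Sigma$ be a compact connected Riemann surface and $0<\beta<1$. Put $dd^c=2i\partial\bar\partial$ (so $dd^cu=(u_{xx}+u_{yy})\,dx\wedge dy$ in a holomorphic coordinate $x+iy$). A $C^\beta$ Kähler form is a positive real $(1,1)$-form with $\beta$-Hölder coefficients. For a $C^\beta$ Kähler form $\omega$ with volume $\nu_\omega=\int_\Sigma\omega$, a normalized Green's function of $\omega$ is a function $G_\omega(P,Q)$, $P\neq Q$, such that for every $Q\in\Sigma$ the function $G_\omega(\cdot,Q)$ is continuous on $\Sigma\setminus\{Q\}$, integrable, and satisfies $$dd^cG_\omega(\cdot,Q)=[Q]-\frac1{\nu_\omega}\,\omega\ \text{ in the sense of distributions},\qquad \int_\Sigma G_\omega(\cdot,Q)\,\omega=0 .$$ (0) Every $C^\beta$ Kähler form $\omega$ on $\Sigma$ has exactly one normalized Green's function $G_\omega$. (1) Let $\omega_0$ be a $C^\beta$ Kähler form, $\Lambda>1$, and $$\mathcal K_\Lambda=\{\omega=\omega_0+dd^c\lambda\;:\;\lambda\in C^{2,\beta}(\Sigma),\ \Lambda^{-1}\omega_0\le\omega\le\Lambda\omega_0\}.$$ There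 is a constant $K=K(\omega_0,\beta,\Lambda)>0$ such that $\sup_{P\ne Q}G_\omega(P,Q)\le K$ for all $\omega\in\mathcal K_\Lambda$. (2) Let $\omega_0$ and $\omega_i=\omega_0+dd^c\lambda_i$, $\lambda_i\in C^{2,\beta}(\Sigma)$, $i\in\mathbb N$, be $C^\beta$ Kähler forms with $\omega_i\to\omega_0$ in $C^\beta$, and let $Q_i\to Q$ in $\Sigma$. Then $G_{\omega_0}(\cdot,Q)$ is of class $C^{2,\beta}$ locally on $\Sigma\setminus\{Q\}$, and $G_{\omega_i}(\cdot,Q_i)\to G_{\omega_0}(\cdot,Q)$ in $C^{2,\beta}$ on every compact subset of $\Sigma\setminus\{Q\}$. (3) Let $\omega_i$, $\omega_\infty$ be $C^\beta$ Kähler forms (of possibly different volumes) with $\omega_i\to\omega_\infty$ in $C^\beta$, let $n_1,\dots,n_d$ be positive integers, and let $p_{j,i}\to p_{j,\infty}$ as $i\to\infty$ for $j=1,\dots,d$, where the points need not be distinct. Put $G_i=\sum_jn_jG_{\omega_i}(\cdot,p_{j,i})$ and $G_\infty=\sum_jn_jG_{\omega_\infty}(\cdot,p_{j,\infty})$. Then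 there is $K'>0$, independent of $i$, such that $G_i\le K'$ on $\Sigma\setminus\{p_{1,i},\dots,p_{d,i}\}$ for all $i$; and $G_\infty$ is of class $C^{2,\beta}$ locally on $\Sigma\setminus\{p_{1,\infty},\dots,p_{d,\infty}\}$, with $G_i\to G_\infty$ in $C^{2,\beta}$ on every compact subset of it. -/

import Mathlib

open Filter Topology MeasureTheory
open scoped NNReal

noncomputable section

/-! ### Hölder spaces on planar domains -/

/-- `f` is of class `C^{k,β}` locally on the open set `U ⊆ ℂ`: it is `C^k` (in the real sense) on
`U`, and on every compact subset of `U` its `k`-th derivative is `β`-Hölder. -/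
def IsHolderPlane (k : ℕ) (β : ℝ≥0) (f : ℂ → ℝ) (U : Set ℂ) : Prop :=
  ContDiffOn ℝ k f U ∧
    ∀ K : Set ℂ, IsCompact K → K ⊆ U → ∃ C : ℝ≥0, HolderOnWith C β (iteratedFDeriv ℝ k f) K

/-- `f` is `C^k` near `K`, all its derivatives of order `≤ k` are bounded by `ε` on `K`, and the
`k`-th derivative has `β`-Hölder seminorm at most `ε` on `K`. -/
def HolderNormLE (k : ℕ) (β ε : ℝ≥0) (f : ℂ → ℝ) (K : Set ℂ) : Prop :=
  (∀ z ∈ K, ContDiffAt ℝ k f z) ∧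
    (∀ m ≤ k, ∀ z ∈ K, ‖iteratedFDeriv ℝ m f z‖ ≤ ε) ∧
    HolderOnWith ε β (iteratedFDeriv ℝ k f) K

/-- `f i → g` in `C^{k,β}` on compact subsets of the open set `U ⊆ ℂ`, the limit `g` being itself
of class `C^{k,β}` locally on `U`. -/
def TendstoHolderPlane (k : ℕ) (β : ℝ≥0) (f : ℕ → ℂ → ℝ) (g : ℂ → ℝ) (U : Set ℂ) : Prop :=
  IsHolderPlane k β g U ∧
    ∀ K : Set ℂ, IsCompact K → K ⊆ U → ∀ ε : ℝ≥0, 0 < ε →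
      ∀ᶠ i in atTop, HolderNormLE k β ε (fun z => f i z - g z) K

/-! ### Functions and forms on Riemann surfaces

A Riemann surface is a space charted on `ℂ` whose transition maps are complex differentiable,
i.e. `IsManifold (modelWithCornersSelf ℂ ℂ) 1 X`. -/

section

variable {X : Type*} [TopologicalSpace X] [ChartedSpace ℂ X]

/-- `u` is of class `C^{k,β}` locally on the open set `U ⊆ X` (globally for `U = univ`). -/
def IsHolderFun (k : ℕ) (β : ℝ≥0) (u : X → ℝ) (U : Set X) : Prop :=
  ∀ e ∈ atlas ℂ X, IsHolderPlane k β (u ∘ e.symm) (e.target ∩ e.symm ⁻¹' U)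

/-- `u i → v` in `C^{k,β}` on compact subsets of the open set `U ⊆ X`. -/
def TendstoHolderFun (k : ℕ) (β : ℝ≥0) (u : ℕ → X → ℝ) (v : X → ℝ) (U : Set X) : Prop :=
  ∀ e ∈ atlas ℂ X,
    TendstoHolderPlane k β (fun i => u i ∘ e.symm) (v ∘ e.symm) (e.target ∩ e.symm ⁻¹' U)

variable (X) in
/-- A real `2`-form (equivalently, a real `(1,1)`-form) on a Riemann surface. In a chart
`e = x + i y` it is `coeff e · dx ∧ dy = coeff e · (i/2) dz ∧ dz̄`; under a holomorphic change of
coordinates `τ` the coefficient is multiplied by `|τ'|²`. -/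
structure RealTwoForm where
  /-- the coefficient in a chart, as a function on the image of the chart -/
  coeff : OpenPartialHomeomorph X ℂ → ℂ → ℝ
  /-- the transformation rule -/
  coeff_change : ∀ e ∈ atlas ℂ X, ∀ e' ∈ atlas ℂ X, ∀ z ∈ e.target, e.symm z ∈ e'.source →
    coeff e z = coeff e' (e' (e.symm z)) * ‖deriv (fun w => e' (e.symm w)) z‖ ^ 2

/-- A Kähler form of class `C^β`: a positive real `(1,1)`-form with locally `β`-Hölder
coefficients. -/
def IsKahlerForm (β : ℝ≥0) (η : RealTwoForm X) : Prop :=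
  ∀ e ∈ atlas ℂ X, (∀ z ∈ e.target, 0 < η.coeff e z) ∧ IsHolderPlane 0 β (η.coeff e) e.target

/-- `η i → θ` in `C^β`. -/
def TendstoHolderForm (β : ℝ≥0) (η : ℕ → RealTwoForm X) (θ : RealTwoForm X) : Prop :=
  ∀ e ∈ atlas ℂ X, TendstoHolderPlane 0 β (fun i => (η i).coeff e) (θ.coeff e) e.target

/-- `η = θ + dd^c u` for a twice differentiable function `u`. Since
`dd^c = 2 i ∂ ∂̄`, in a chart `dd^c u = (∂²u/∂x² + ∂²u/∂y²) dx ∧ dy`. -/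
def EqAddDdc (η θ : RealTwoForm X) (u : X → ℝ) : Prop :=
  ∀ e ∈ atlas ℂ X, ∀ z ∈ e.target,
    η.coeff e z = θ.coeff e z + Laplacian.laplacian (u ∘ e.symm) z

/-- `c θ ≤ η` pointwise. -/
def FormSMulLE (c : ℝ) (θ η : RealTwoForm X) : Prop :=
  ∀ e ∈ atlas ℂ X, ∀ z ∈ e.target, c * θ.coeff e z ≤ η.coeff e z

/-- `η ≤ c θ` pointwise. -/
def FormLESMul (η : RealTwoForm X) (c : ℝ) (θ : RealTwoForm X) : Prop :=
  ∀ e ∈ atlas ℂ X, ∀ z ∈ e.target, η.coeff e z ≤ c * θ.coeff e z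

/-- `η` is in the class of `θ`: it is `θ + dd^c u` with `u` of class `C^{2,β}`. -/
def InKahlerClass (β : ℝ≥0) (η θ : RealTwoForm X) : Prop :=
  ∃ u : X → ℝ, IsHolderFun 2 β u Set.univ ∧ EqAddDdc η θ u

/-- The forms `θ + dd^c u`, with `u` of class `C^{2,β}`, that lie between `Λ⁻¹ θ` and `Λ θ`. -/
def kahlerFormsBetween (β : ℝ≥0) (θ : RealTwoForm X) (Λ : ℝ) : Set (RealTwoForm X) :=
  {η | InKahlerClass β η θ ∧ FormSMulLE Λ⁻¹ θ η ∧ FormLESMul η Λ θ}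

variable [MeasurableSpace X]

/-- The measure `A ↦ ∫_A η` of a positive form `η`. Its restriction to the domain of a chart `e` is
`coeff e · dx dy`, and it is the supremum of these restrictions, as the domains cover `X`. -/
def RealTwoForm.measure (η : RealTwoForm X) : Measure X :=
  ⨆ e ∈ atlas ℂ X,
    (((volume : Measure ℂ).restrict e.target).withDensity
      (fun z => ENNReal.ofReal (η.coeff e z))).map e.symm

/-- The total volume `∫_X η`. -/
def RealTwoForm.vol (η : RealTwoForm X) : ℝ := η.measure.real Set.univ

/-- `g` is the normalized Green's function of `η` with pole `Q`:
`dd^c g = [Q] - η / vol η` in the sense of distributions and `∫ g η = 0`, where `g` is integrable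
and continuous away from `Q`. Only the values of `g` away from `Q` matter (at `Q` the Green's
function is `-∞`). The distributional equation is tested, in every chart, against the smooth
functions with compact support in the image of the chart. -/
structure IsGreenFunctionAt (η : RealTwoForm X) (Q : X) (g : X → ℝ) : Prop where
  continuousOn : ContinuousOn g {Q}ᶜ
  integrable : Integrable g η.measure
  integral_eq_zero : ∫ P, g P ∂η.measure = 0
  ddc_eq : ∀ e ∈ atlas ℂ X, ∀ ψ : ℂ → ℝ, ContDiff ℝ (⊤ : ℕ∞) ψ → HasCompactSupport ψ →
    tsupport ψ ⊆ e.target →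
    ∫ z in e.target, g (e.symm z) * Laplacian.laplacian ψ z =
      e.source.indicator (fun P => ψ (e P)) Q
        - 1 / η.vol * ∫ z in e.target, ψ z * η.coeff e z

/-- `G P Q = G_η(P, Q)` is the normalized Green's function of `η`. -/
def IsGreenFunction (η : RealTwoForm X) (G : X → X → ℝ) : Prop :=
  ∀ Q, IsGreenFunctionAt η Q (fun P => G P Q)

end

end

noncomputable section
open scoped Pointwise ENNReal
set_option linter.unusedSectionVars false

/-! Everything rests on the weak Poisson equation dd^c w = c[Q] + f η and on a local formula for its
solutions. In a coordinate disk a cut-off logarithm E satisfies ΔE = δ₀ + S with S smooth. Hence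
every integrable solution is, almost everywhere near a given point, w(x) = c k(x, Q) + ∫ f k(x, ·) η
- ∫ w s(x, ·) η. The kernel k is logarithmic, nonpositive, and continuous in x as an element of L²;
the kernel s is bounded (`IsPosForm.exists_isLocalParametrix`).

Existence is Hilbert space theory. By the formula, the L² norm of w is controlled by that of its
Laplacian f up to finitely many functionals, so the Laplacian has closed range in L². The orthogonal
complement of the range consists of weakly harmonic functions, which are constant by Weyl's lemma
and the maximum modulus principle (`IsPosForm.ae_eq_const_of_isWeakSolution_zero`). This yields a
bounded solution operator A on functions of mean zero. If φ has mean zero and Laplacian F, the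
formula becomes φ(Q) = ⟨F, k_Q⟩ - ⟨A F, s_Q⟩. So the Green's function with pole Q is the mean-zero
part of k_Q - A* s_Q, and it depends continuously on Q in L² (`IsPosForm.exists_continuous_green`).
The formula also makes it continuous off Q, and two Green's functions differ by a constant, which
the normalization kills.

To compare forms, write η = ρ θ, with volumes V and V₀, and let g be the L² Green's functions of θ.
The Green's function of η is g(Q) - A(ρ/V - 1/V₀) plus a constant determined by the normalization.
This gives an L¹ estimate in terms of sup |ρ - 1| / V and of the displacement of the pole
(`IsPosForm.exists_integral_abs_green_sub_le`). The uniform upper bound follows: in the local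
formula the singular term c k is nonpositive and may be dropped, and the other terms are bounded by
the L² norm of f and the L¹ norm of w (`IsPosForm.exists_ae_le_of_isWeakSolution`).

For convergence, the difference of two Green's functions solves, away from the poles, a Poisson
equation whose right-hand side is small in C^β, and the difference itself is small in L¹. The
interior Schauder estimate `exists_holderBound_of_weak_solution` turns this into smallness in
C^{2,β}. That estimate comes from the planar representation formula and a dyadic decomposition of
the logarithmic kernel. Divisors are handled by finite sums. -/

/-! ### Green's second identity in the plane -/

open Laplacian in
lemma laplacian_eq_fderiv_fderiv {u : ℂ → ℝ} {z : ℂ} (hu : ContDiffAt ℝ 2 u z) :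
    laplacian u z = fderiv ℝ (fun y => fderiv ℝ u y 1) z 1
      + fderiv ℝ (fun y => fderiv ℝ u y Complex.I) z Complex.I := by
  have hd : DifferentiableAt ℝ (fderiv ℝ u) z :=
    (hu.fderiv_right (m := 1) (by norm_num)).differentiableAt (by norm_num)
  have key : ∀ v : ℂ, fderiv ℝ (fun y => fderiv ℝ u y v) z v = fderiv ℝ (fderiv ℝ u) z v v := by
    intro v
    rw [fderiv_clm_apply hd (differentiableAt_const v)]
    simp
  rw [InnerProductSpace.laplacian_eq_iteratedFDeriv_complexPlane]
  simp only [iteratedFDeriv_two_apply, key]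
  simp

lemma continuous_mul_of_tsupport_subset {u φ : ℂ → ℝ} {U : Set ℂ} (hU : IsOpen U)
    (hu : ContinuousOn u U) (hφ : Continuous φ) (hs : tsupport φ ⊆ U) :
    Continuous fun z => u z * φ z := by
  rw [continuous_iff_continuousAt]
  intro z
  by_cases hz : z ∈ tsupport φ
  · exact (hu.continuousAt (hU.mem_nhds (hs hz))).mul hφ.continuousAt
  · have : (fun z => u z * φ z) =ᶠ[𝓝 z] fun _ => 0 := by
      filter_upwards [(isClosed_tsupport φ).isOpen_compl.mem_nhds hz] with y hy
      rw [image_eq_zero_of_notMem_tsupport hy, mul_zero]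
    exact continuousAt_const.congr this.symm

lemma integrable_mul_of_tsupport_subset {u φ : ℂ → ℝ} {U : Set ℂ} (hU : IsOpen U)
    (hu : ContinuousOn u U) (hφ : Continuous φ) (hc : HasCompactSupport φ) (hs : tsupport φ ⊆ U) :
    Integrable fun z => u z * φ z :=
  (continuous_mul_of_tsupport_subset hU hu hφ hs).integrable_of_hasCompactSupport hc.mul_left

lemma integral_mul_fderiv_eq_neg {u ψ : ℂ → ℝ} {U : Set ℂ} (hU : IsOpen U)
    (hu : ContDiffOn ℝ 1 u U) (hψ : ContDiff ℝ 1 ψ) (hc : HasCompactSupport ψ)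
    (hs : tsupport ψ ⊆ U) (v : ℂ) :
    ∫ z, u z * fderiv ℝ ψ z v = - ∫ z, fderiv ℝ u z v * ψ z := by
  have hdu : ContinuousOn (fun z => fderiv ℝ u z v) U :=
    (hu.continuousOn_fderiv_of_isOpen hU le_rfl).clm_apply continuousOn_const
  have hsub : tsupport (fun z => fderiv ℝ ψ z v) ⊆ tsupport ψ := tsupport_fderiv_apply_subset ℝ v
  refine integral_mul_fderiv_eq_neg_fderiv_mul_of_integrable ?_ ?_ ?_ ?_ ?_
  · exact integrable_mul_of_tsupport_subset hU hdu hψ.continuous hc hs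
  · exact integrable_mul_of_tsupport_subset hU hu.continuousOn
      ((hψ.continuous_fderiv (by norm_num)).clm_apply continuous_const) (hc.fderiv_apply ℝ v)
      (hsub.trans hs)
  · exact integrable_mul_of_tsupport_subset hU hu.continuousOn hψ.continuous hc hs
  · intro x hx
    exact (hu.contDiffAt (hU.mem_nhds (hs hx))).differentiableAt (by norm_num)
  · intro x _
    exact (hψ.differentiable (by norm_num)) x

lemma laplacian_tsupport_subset (ψ : ℂ → ℝ) : tsupport (Laplacian.laplacian ψ) ⊆ tsupport ψ := by
  refine closure_minimal (fun z hz => ?_) (isClosed_tsupport ψ)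
  by_contra h
  refine hz ?_
  have : ψ =ᶠ[𝓝 z] fun _ => (0 : ℝ) := by
    filter_upwards [(isClosed_tsupport ψ).isOpen_compl.mem_nhds h] with y hy
    exact image_eq_zero_of_notMem_tsupport hy
  rw [InnerProductSpace.laplacian_congr_nhds this |>.eq_of_nhds]
  simp

lemma hasCompactSupport_laplacian {ψ : ℂ → ℝ} (h : HasCompactSupport ψ) :
    HasCompactSupport (Laplacian.laplacian ψ) :=
  h.mono' ((subset_tsupport _).trans (laplacian_tsupport_subset ψ))

lemma contDiffOn_laplacian {n : ℕ∞} {u : ℂ → ℝ} {U : Set ℂ} (hU : IsOpen U)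
    (hu : ContDiffOn ℝ (n + 2 : ℕ∞) u U) : ContDiffOn ℝ n (Laplacian.laplacian u) U := by
  have h1 : ContDiffOn ℝ n (iteratedFDeriv ℝ 2 u) U := by
    intro z hz
    refine ((hu.contDiffAt (hU.mem_nhds hz)).iteratedFDeriv_right (i := 2) (m := n) ?_).contDiffWithinAt
    norm_cast
  rw [InnerProductSpace.laplacian_eq_iteratedFDeriv_complexPlane]
  have h2 : ∀ m : Fin 2 → ℂ, ContDiffOn ℝ n (fun z => iteratedFDeriv ℝ 2 u z m) U := fun m =>
    (ContinuousMultilinearMap.apply ℝ (fun _ : Fin 2 => ℂ) ℝ m).contDiff.comp_contDiffOn h1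
  exact (h2 _).add (h2 _)

lemma continuousOn_laplacian {u : ℂ → ℝ} {U : Set ℂ} (hU : IsOpen U)
    (hu : ContDiffOn ℝ 2 u U) : ContinuousOn (Laplacian.laplacian u) U :=
  (contDiffOn_laplacian (n := 0) hU (by simpa using hu)).continuousOn

lemma continuous_laplacian {u : ℂ → ℝ} (hu : ContDiff ℝ 2 u) :
    Continuous (Laplacian.laplacian u) :=
  continuousOn_univ.1 (continuousOn_laplacian isOpen_univ hu.contDiffOn)

/-- Green's second identity against a compactly supported function. -/
theorem integral_mul_laplacian {u ψ : ℂ → ℝ} {U : Set ℂ} (hU : IsOpen U)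
    (hu : ContDiffOn ℝ 2 u U) (hψ : ContDiff ℝ 2 ψ) (hc : HasCompactSupport ψ)
    (hs : tsupport ψ ⊆ U) :
    ∫ z, u z * Laplacian.laplacian ψ z = ∫ z, Laplacian.laplacian u z * ψ z := by
  have hψ1 : ∀ v : ℂ, ContDiff ℝ 1 (fun z => fderiv ℝ ψ z v) := fun v =>
    (hψ.fderiv_right (by norm_num)).clm_apply contDiff_const
  have hu1 : ∀ v : ℂ, ContDiffOn ℝ 1 (fun z => fderiv ℝ u z v) U := fun v =>
    (hu.fderiv_of_isOpen hU (by norm_num)).clm_apply contDiffOn_const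
  have hsub : ∀ v, tsupport (fun z => fderiv ℝ ψ z v) ⊆ U := fun v =>
    (tsupport_fderiv_apply_subset ℝ v).trans hs
  have hcv : ∀ v, HasCompactSupport (fun z => fderiv ℝ ψ z v) := fun v => hc.fderiv_apply ℝ v
  have key : ∀ v : ℂ, ∫ z, u z * fderiv ℝ (fun y => fderiv ℝ ψ y v) z v
      = ∫ z, fderiv ℝ (fun y => fderiv ℝ u y v) z v * ψ z := by
    intro v
    rw [integral_mul_fderiv_eq_neg hU (hu.of_le (by norm_num)) (hψ1 v) (hcv v) (hsub v) v,
      integral_mul_fderiv_eq_neg hU (hu1 v) (hψ.of_le (by norm_num)) hc hs v, neg_neg]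
  have i1 : ∀ v, Integrable fun z => u z * fderiv ℝ (fun y => fderiv ℝ ψ y v) z v := fun v =>
    integrable_mul_of_tsupport_subset hU hu.continuousOn
      (((hψ1 v).continuous_fderiv (by norm_num)).clm_apply continuous_const) ((hcv v).fderiv_apply ℝ v)
      ((tsupport_fderiv_apply_subset ℝ v).trans (hsub v))
  have i2 : ∀ v, Integrable fun z => fderiv ℝ (fun y => fderiv ℝ u y v) z v * ψ z := fun v =>
    integrable_mul_of_tsupport_subset hU
      (((hu1 v).continuousOn_fderiv_of_isOpen hU le_rfl).clm_apply continuousOn_const)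
      hψ.continuous hc hs
  calc ∫ z, u z * Laplacian.laplacian ψ z
      = ∫ z, (u z * fderiv ℝ (fun y => fderiv ℝ ψ y 1) z 1
        + u z * fderiv ℝ (fun y => fderiv ℝ ψ y Complex.I) z Complex.I) := by
        congr 1; ext z; rw [laplacian_eq_fderiv_fderiv hψ.contDiffAt, mul_add]
    _ = ∫ z, (fderiv ℝ (fun y => fderiv ℝ u y 1) z 1 * ψ z
        + fderiv ℝ (fun y => fderiv ℝ u y Complex.I) z Complex.I * ψ z) := by
        rw [integral_add (i1 _) (i1 _), integral_add (i2 _) (i2 _), key, key]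
    _ = ∫ z, Laplacian.laplacian u z * ψ z := by
        congr 1; ext z
        by_cases hz : z ∈ tsupport ψ
        · rw [laplacian_eq_fderiv_fderiv (hu.contDiffAt (hU.mem_nhds (hs hz))), add_mul]
        · simp [image_eq_zero_of_notMem_tsupport hz]

/-! ### The fundamental solution -/

/-- This smooth regularization of log ‖z‖ has as Laplacian a positive bump of scale √ε and of mass
independent of ε, that is, an approximate multiple of the Dirac mass. -/
lemma laplacian_half_log_normSq_add {ε : ℝ} (hε : 0 < ε) (z : ℂ) :
    Laplacian.laplacian (fun z : ℂ => 1 / 2 * Real.log (‖z‖ ^ 2 + ε)) z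
      = 2 * ε / (‖z‖ ^ 2 + ε) ^ 2 := by
  have hpos : ∀ y : ℂ, 0 < ‖y‖ ^ 2 + ε := fun y => by positivity
  have h0 : ∀ y : ℂ, HasFDerivAt (fun z : ℂ => ‖z‖ ^ 2 + ε) (2 • (innerSL ℝ y)) y := fun y => by
    exact (hasStrictFDerivAt_norm_sq y).hasFDerivAt.add_const ε
  have h1 : ∀ y : ℂ, HasFDerivAt (fun z : ℂ => 1 / 2 * Real.log (‖z‖ ^ 2 + ε))
      ((‖y‖ ^ 2 + ε)⁻¹ • (innerSL ℝ y)) y := fun y => by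
    have := ((h0 y).log (hpos y).ne').const_mul (1 / 2 : ℝ)
    refine this.congr_fderiv ?_
    rw [smul_smul, ← Nat.cast_smul_eq_nsmul ℝ, smul_smul]
    congr 1
    push_cast
    ring
  have hcd : ContDiff ℝ 2 (fun z : ℂ => 1 / 2 * Real.log (‖z‖ ^ 2 + ε)) := by
    refine contDiff_const.mul (ContDiff.log ?_ fun y => (hpos y).ne')
    exact (contDiff_norm_sq ℝ).add contDiff_const
  rw [laplacian_eq_fderiv_fderiv hcd.contDiffAt]
  have h2 : ∀ v : ℂ, fderiv ℝ (fun y => fderiv ℝ (fun z : ℂ => 1 / 2 * Real.log (‖z‖ ^ 2 + ε)) y v) z v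
      = (‖z‖ ^ 2 + ε)⁻¹ * ‖v‖ ^ 2 - 2 * (inner ℝ z v) ^ 2 / (‖z‖ ^ 2 + ε) ^ 2 := by
    intro v
    have e1 : (fun y => fderiv ℝ (fun z : ℂ => 1 / 2 * Real.log (‖z‖ ^ 2 + ε)) y v)
        = fun y => (‖y‖ ^ 2 + ε)⁻¹ * inner ℝ y v := by
      ext y; rw [(h1 y).fderiv]; simp
    have e2 : HasFDerivAt (fun y : ℂ => inner ℝ y v) ((innerSL ℝ).flip v : ℂ →L[ℝ] ℝ) z :=
      ((innerSL ℝ).flip v : ℂ →L[ℝ] ℝ).hasFDerivAt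
    have e3 : HasFDerivAt (fun y : ℂ => (‖y‖ ^ 2 + ε)⁻¹)
        (-((‖z‖ ^ 2 + ε) ^ 2)⁻¹ • (2 • (innerSL ℝ z))) z :=
      (hasDerivAt_inv (hpos z).ne').comp_hasFDerivAt z (h0 z)
    have e4 := e3.mul e2
    rw [e1, show (fun y : ℂ => (‖y‖ ^ 2 + ε)⁻¹ * inner ℝ y v) = (fun y : ℂ => (‖y‖ ^ 2 + ε)⁻¹) * (fun y => inner ℝ y v) from rfl, e4.fderiv]
    have e5 : (innerSL ℝ).flip v v = ‖v‖ ^ 2 := by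
      rw [ContinuousLinearMap.flip_apply, innerSL_apply_apply, real_inner_self_eq_norm_sq]
    simp only [add_apply, smul_apply, e5,
      innerSL_apply_apply, smul_eq_mul, nsmul_eq_mul]
    push_cast
    ring
  rw [h2, h2]
  have h3 : inner ℝ z (1 : ℂ) ^ 2 + inner ℝ z Complex.I ^ 2 = ‖z‖ ^ 2 := by
    rw [Complex.sq_norm, Complex.normSq_apply]
    simp [Complex.inner]
    ring
  have := (hpos z).ne'
  have h4 : inner ℝ z Complex.I ^ 2 = ‖z‖ ^ 2 - inner ℝ z (1 : ℂ) ^ 2 := by linarith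
  rw [h4]
  simp only [norm_one, Complex.norm_I]
  field_simp
  ring

lemma integrable_two_div_sq : Integrable fun z : ℂ => 2 / (‖z‖ ^ 2 + 1) ^ 2 := by
  have h := integrable_rpow_neg_one_add_norm_sq (E := ℂ) (μ := volume) (r := 4) (by
    rw [Complex.finrank_real_complex]; norm_num)
  refine (h.const_mul 2).congr (Eventually.of_forall fun z => ?_)
  have hp : (0 : ℝ) ≤ 1 + ‖z‖ ^ 2 := by positivity
  simp only
  rw [show (-4 / 2 : ℝ) = -(2 : ℕ) by norm_num, Real.rpow_neg hp, Real.rpow_natCast,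
    add_comm, div_eq_mul_inv]

/-- The total mass of the Laplacian of `log ‖z‖`, that is `2π`. -/
def laplacianLogMass : ℝ := ∫ z : ℂ, 2 / (‖z‖ ^ 2 + 1) ^ 2

lemma laplacianLogMass_pos : 0 < laplacianLogMass := by
  refine (integral_pos_iff_support_of_nonneg (fun z => by positivity) integrable_two_div_sq).2 ?_
  have : Function.support (fun z : ℂ => 2 / (‖z‖ ^ 2 + 1) ^ 2) = Set.univ := by
    ext z
    have : (2 / (‖z‖ ^ 2 + 1) ^ 2 : ℝ) ≠ 0 := by positivity
    simpa using this
  rw [this]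
  simp

/-- The exponent 1/2 is chosen so that the square of the logarithm is bounded by a multiple of
‖z‖⁻¹, which is integrable near the origin of the plane. -/
lemma abs_log_le_rpow {t : ℝ} (ht : 0 < t) (h1 : t ≤ 1) : |Real.log t| ≤ 2 * t ^ (-(1 / 2) : ℝ) := by
  have h := Real.abs_log_mul_self_rpow_lt t (1 / 2) ht h1 (by norm_num)
  rw [abs_mul, abs_of_pos (Real.rpow_pos_of_pos ht _)] at h
  rw [Real.rpow_neg ht.le, ← div_eq_mul_inv, le_div_iff₀ (Real.rpow_pos_of_pos ht _)]
  linarith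

lemma measurable_log_norm : Measurable fun z : ℂ => Real.log ‖z‖ :=
  Real.measurable_log.comp measurable_norm

lemma integrableOn_log_norm_sq : IntegrableOn (fun z : ℂ => Real.log ‖z‖ ^ 2) (Metric.ball 0 1) := by
  refine integrableOn_ball_of_norm_le_rpow (C := 4) (α := 1) (by simp) (by simp)
    ?_ (measurable_log_norm.pow_const 2).aestronglyMeasurable
  filter_upwards [ae_restrict_mem measurableSet_ball,
    ae_restrict_of_ae (Measure.ae_ne volume (0 : ℂ))] with z hz hz0
  have hz1 : ‖z‖ ≤ 1 := by simpa using (Metric.mem_ball.1 hz).le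
  have hpos : 0 < ‖z‖ := norm_pos_iff.2 hz0
  have := abs_log_le_rpow hpos hz1
  rw [Real.norm_eq_abs, abs_pow]
  calc |Real.log ‖z‖| ^ 2 ≤ (2 * ‖z‖ ^ (-(1 / 2) : ℝ)) ^ 2 := by gcongr
    _ = 4 * ‖z‖ ^ (-1 : ℝ) := by
      rw [mul_pow, ← Real.rpow_natCast (‖z‖ ^ (-(1 / 2) : ℝ)), ← Real.rpow_mul hpos.le]; norm_num

lemma integrableOn_log_norm : IntegrableOn (fun z : ℂ => Real.log ‖z‖) (Metric.ball 0 1) := by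
  refine Integrable.mono' (integrableOn_log_norm_sq.add
    (integrableOn_const (C := (1 : ℝ)) measure_ball_lt_top.ne))
    measurable_log_norm.aestronglyMeasurable (Eventually.of_forall fun z => ?_)
  simp only [Real.norm_eq_abs, Pi.add_apply]
  nlinarith [abs_nonneg (Real.log ‖z‖), sq_abs (Real.log ‖z‖), sq_nonneg (|Real.log ‖z‖| - 1)]

lemma locallyIntegrable_log_norm : LocallyIntegrable fun z : ℂ => Real.log ‖z‖ := by
  intro z
  by_cases hz : z = 0
  · exact ⟨Metric.ball 0 1, by rw [hz]; exact Metric.ball_mem_nhds _ one_pos, integrableOn_log_norm⟩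
  · have hc : ContinuousOn (fun z : ℂ => Real.log ‖z‖) {0}ᶜ := fun w hw =>
      (continuous_norm.continuousAt.log (norm_ne_zero_iff.2 hw)).continuousWithinAt
    have := hc.locallyIntegrableOn (μ := volume) isOpen_compl_singleton.measurableSet z hz
    rwa [IntegrableAtFilter, isOpen_compl_singleton.nhdsWithin_eq hz] at this

/-- `log ‖z‖` is a fundamental solution of the Laplacian, up to a positive factor. -/
theorem integral_log_norm_mul_laplacian {ψ : ℂ → ℝ} (hψ : ContDiff ℝ 2 ψ)
    (hc : HasCompactSupport ψ) :
    ∫ z, Real.log ‖z‖ * Laplacian.laplacian ψ z = laplacianLogMass * ψ 0 := by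
  -- The logarithm is replaced by the regularization 1/2 log(‖z‖² + δ²); the Laplacian is moved onto
  -- it, and δ → 0 on both sides.
  set δ : ℕ → ℝ := fun n => 1 / ((n : ℝ) + 1) with hδ
  have hδpos : ∀ n, 0 < δ n := fun n => by positivity
  have hδ1 : ∀ n, δ n ≤ 1 := fun n => by
    rw [hδ]; simp only; rw [div_le_one (by positivity)]; linarith [n.cast_nonneg (α := ℝ)]
  have hδ0 : Tendsto δ atTop (𝓝 0) := tendsto_one_div_add_atTop_nhds_zero_nat
  have hcΔ := hasCompactSupport_laplacian hc
  have hΔ := continuous_laplacian hψ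
  obtain ⟨R, hR1, hR⟩ : ∃ R : ℝ, 1 ≤ R ∧ ∀ z, Laplacian.laplacian ψ z ≠ 0 → ‖z‖ ≤ R := by
    obtain ⟨R, hR⟩ := hcΔ.isBounded.exists_norm_le
    exact ⟨max R 1, le_max_right _ _, fun z hz => (hR z (subset_tsupport _ hz)).trans (le_max_left _ _)⟩
  have h1 : Tendsto (fun n => ∫ z, 1 / 2 * Real.log (‖z‖ ^ 2 + δ n ^ 2) * Laplacian.laplacian ψ z)
      atTop (𝓝 (∫ z, Real.log ‖z‖ * Laplacian.laplacian ψ z)) := by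
    refine tendsto_integral_of_dominated_convergence
      (fun z => (|Real.log ‖z‖| + Real.log (R ^ 2 + 1)) * |Laplacian.laplacian ψ z|) ?_ ?_ ?_ ?_
    · intro n
      refine Continuous.aestronglyMeasurable ?_
      refine (continuous_const.mul (Continuous.log (by fun_prop) fun z => ?_)).mul hΔ
      have := hδpos n
      positivity
    · have : LocallyIntegrable fun z : ℂ => |Real.log ‖z‖| + Real.log (R ^ 2 + 1) :=
        LocallyIntegrable.add (fun z => (locallyIntegrable_log_norm z).norm)
          (locallyIntegrable_const _)
      refine (this.integrable_smul_right_of_hasCompactSupport (g := fun z => |Laplacian.laplacian ψ z|)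
        hΔ.abs hcΔ.norm)
    · intro n
      filter_upwards [Measure.ae_ne volume (0 : ℂ)] with z hz
      rw [norm_mul, Real.norm_eq_abs, Real.norm_eq_abs]
      by_cases h0 : Laplacian.laplacian ψ z = 0
      · simp [h0]
      refine mul_le_mul_of_nonneg_right ?_ (abs_nonneg _)
      have hzp : 0 < ‖z‖ := norm_pos_iff.2 hz
      have hzR := hR z h0
      -- On the support of Δψ the regularized logarithm lies between log ‖z‖ and the constant 1/2
      -- log(R² + 1), since δ n ≤ 1; this gives the integrable majorant.
      have l1 : 2 * Real.log ‖z‖ ≤ Real.log (‖z‖ ^ 2 + δ n ^ 2) := by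
        rw [← Real.log_rpow hzp]
        refine Real.log_le_log (by positivity) ?_
        rw [Real.rpow_two]; nlinarith [hδpos n]
      have l2 : Real.log (‖z‖ ^ 2 + δ n ^ 2) ≤ Real.log (R ^ 2 + 1) := by
        refine Real.log_le_log (by positivity) ?_
        have := hδ1 n; have := hδpos n
        gcongr
        nlinarith
      have l3 : 0 ≤ Real.log (R ^ 2 + 1) := Real.log_nonneg (by nlinarith)
      rw [abs_le]
      constructor
      · linarith [neg_abs_le (Real.log ‖z‖)]
      · linarith [abs_nonneg (Real.log ‖z‖)]
    · filter_upwards [Measure.ae_ne volume (0 : ℂ)] with z hz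
      have hzp : 0 < ‖z‖ := norm_pos_iff.2 hz
      refine Tendsto.mul_const _ ?_
      have : Tendsto (fun n => 1 / 2 * Real.log (‖z‖ ^ 2 + δ n ^ 2)) atTop
          (𝓝 (1 / 2 * Real.log (‖z‖ ^ 2 + 0 ^ 2))) :=
        (((hδ0.pow 2).const_add _).log (by positivity)).const_mul _
      convert this using 2
      rw [zero_pow two_ne_zero, add_zero, Real.log_pow]; push_cast; ring
  have h2 : ∀ n, ∫ z, 1 / 2 * Real.log (‖z‖ ^ 2 + δ n ^ 2) * Laplacian.laplacian ψ z
      = ∫ z : ℂ, 2 / (‖z‖ ^ 2 + 1) ^ 2 * ψ (δ n • z) := by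
    intro n
    have hp := hδpos n
    have hcd : ContDiff ℝ 2 (fun z : ℂ => 1 / 2 * Real.log (‖z‖ ^ 2 + δ n ^ 2)) := by
      refine contDiff_const.mul (ContDiff.log ?_ fun y => by positivity)
      exact (contDiff_norm_sq ℝ).add contDiff_const
    rw [integral_mul_laplacian isOpen_univ hcd.contDiffOn hψ hc (Set.subset_univ _)]
    -- Dilation by δ n turns the Laplacian of the regularization into a fixed profile, and all
    -- dependence on n passes to ψ (δ n • z). The factor δ n ^ 2 is the Jacobian of the dilation.
    have e1 : (fun z : ℂ => 2 / (‖z‖ ^ 2 + 1) ^ 2 * ψ (δ n • z)) = fun z : ℂ => (fun y : ℂ =>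
        δ n ^ 2 * (2 * δ n ^ 2 / (‖y‖ ^ 2 + δ n ^ 2) ^ 2 * ψ y)) (δ n • z) := by
      ext z
      simp only [norm_smul, Real.norm_eq_abs, abs_of_pos hp]
      field_simp
    rw [e1, Measure.integral_comp_smul volume (fun y : ℂ =>
        δ n ^ 2 * (2 * δ n ^ 2 / (‖y‖ ^ 2 + δ n ^ 2) ^ 2 * ψ y)), Complex.finrank_real_complex, integral_const_mul, smul_eq_mul,
      abs_of_pos (by positivity), ← mul_assoc, inv_mul_cancel₀ (by positivity), one_mul]
    congr 1
    ext z
    rw [laplacian_half_log_normSq_add (by positivity)]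
  have h3 : Tendsto (fun n => ∫ z : ℂ, 2 / (‖z‖ ^ 2 + 1) ^ 2 * ψ (δ n • z)) atTop
      (𝓝 (∫ z : ℂ, 2 / (‖z‖ ^ 2 + 1) ^ 2 * ψ 0)) := by
    obtain ⟨M, hM⟩ := hc.exists_bound_of_continuous hψ.continuous
    refine tendsto_integral_of_dominated_convergence (fun z => 2 / (‖z‖ ^ 2 + 1) ^ 2 * M) ?_ ?_ ?_ ?_
    · intro n
      refine integrable_two_div_sq.aestronglyMeasurable.mul ?_
      exact (hψ.continuous.comp (continuous_const_smul _)).aestronglyMeasurable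
    · exact integrable_two_div_sq.mul_const M
    · intro n
      refine Eventually.of_forall fun z => ?_
      rw [norm_mul, Real.norm_of_nonneg (by positivity)]
      gcongr
      exact hM _
    · refine Eventually.of_forall fun z => Tendsto.const_mul _ ?_
      have : Tendsto (fun n => δ n • z) atTop (𝓝 0) := by simpa using hδ0.smul_const z
      exact (hψ.continuous.tendsto 0).comp this
  simp only [h2] at h1
  rw [tendsto_nhds_unique h1 h3, integral_mul_const]
  rfl

/-! ### The localized fundamental solution -/

variable (χ : ContDiffBump (0 : ℂ))

/-- The fundamental solution of the Laplacian multiplied by a cutoff function. -/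
def cutoffLog (z : ℂ) : ℝ := laplacianLogMass⁻¹ * (χ z * Real.log ‖z‖)

/-- The regular part of the Laplacian of `cutoffLog`. -/
def cutoffLogError : ℂ → ℝ :=
  Laplacian.laplacian fun z : ℂ => laplacianLogMass⁻¹ * ((χ z - 1) * Real.log ‖z‖)

lemma contDiffAt_log_norm {z : ℂ} (hz : z ≠ 0) {n : ℕ∞} :
    ContDiffAt ℝ n (fun z : ℂ => Real.log ‖z‖) z :=
  (contDiffAt_norm ℝ hz).log (norm_ne_zero_iff.2 hz)

lemma contDiff_cutoffLog_sub_log {n : ℕ∞} :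
    ContDiff ℝ n fun z : ℂ => laplacianLogMass⁻¹ * ((χ z - 1) * Real.log ‖z‖) := by
  refine contDiff_const.mul (contDiff_iff_contDiffAt.2 fun z => ?_)
  by_cases hz : z = 0
  · have : (fun z : ℂ => (χ z - 1) * Real.log ‖z‖) =ᶠ[𝓝 z] fun _ => 0 := by
      rw [hz]
      filter_upwards [χ.eventuallyEq_one] with y hy
      rw [hy]; simp
    exact contDiffAt_const.congr_of_eventuallyEq this
  · exact (χ.contDiffAt.sub contDiffAt_const).mul (contDiffAt_log_norm hz)

lemma contDiff_cutoffLogError {n : ℕ∞} : ContDiff ℝ n (cutoffLogError χ) :=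
  contDiffOn_univ.1 (contDiffOn_laplacian isOpen_univ (contDiff_cutoffLog_sub_log χ).contDiffOn)

lemma cutoffLog_eq_zero {z : ℂ} (hz : χ.rOut ≤ ‖z‖) : cutoffLog χ z = 0 := by
  rw [cutoffLog, χ.zero_of_le_dist (by simpa using hz)]; simp

/-- Beyond the support of χ the function under the Laplacian is a multiple of log ‖z‖, which is
harmonic there. -/
lemma cutoffLogError_eq_zero {z : ℂ} (hz : χ.rOut < ‖z‖) : cutoffLogError χ z = 0 := by
  have hz0 : z ≠ 0 := norm_pos_iff.1 (χ.rOut_pos.trans hz)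
  have h1 : (fun z : ℂ => laplacianLogMass⁻¹ * ((χ z - 1) * Real.log ‖z‖)) =ᶠ[𝓝 z]
      (-laplacianLogMass⁻¹) • fun z : ℂ => Real.log ‖z‖ := by
    filter_upwards [(isOpen_lt continuous_const continuous_norm).mem_nhds hz] with y hy
    rw [χ.zero_of_le_dist (by simpa using (le_of_lt hy))]
    simp
  rw [cutoffLogError, (InnerProductSpace.laplacian_congr_nhds h1).eq_of_nhds,
    InnerProductSpace.laplacian_smul _ (contDiffAt_log_norm (n := 2) hz0)]
  have : InnerProductSpace.HarmonicAt (fun z : ℂ => Real.log ‖z‖) z :=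
    AnalyticAt.harmonicAt_log_norm (f := fun z => z) analyticAt_id hz0
  rw [this.2.eq_of_nhds]
  simp

lemma hasCompactSupport_cutoffLogError : HasCompactSupport (cutoffLogError χ) :=
  HasCompactSupport.intro (isCompact_closedBall 0 χ.rOut) fun z hz =>
    cutoffLogError_eq_zero χ (by simpa using hz)

lemma measurable_cutoffLog : Measurable (cutoffLog χ) :=
  (χ.continuous.measurable.mul measurable_log_norm).const_mul _

lemma cutoffLog_neg (z : ℂ) : cutoffLog χ (-z) = cutoffLog χ z := by
  rw [cutoffLog, cutoffLog, χ.neg, norm_neg]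

lemma integrable_cutoffLog_sq (h : χ.rOut ≤ 1) : Integrable fun z => cutoffLog χ z ^ 2 := by
  have h1 : IntegrableOn (fun z => cutoffLog χ z ^ 2) (Metric.ball 0 1) := by
    refine Integrable.mono' (integrableOn_log_norm_sq.const_mul (laplacianLogMass⁻¹ ^ 2))
      ((measurable_cutoffLog χ).pow_const 2).aestronglyMeasurable (Eventually.of_forall fun z => ?_)
    rw [Real.norm_of_nonneg (sq_nonneg _), cutoffLog, mul_pow, mul_pow]
    refine mul_le_mul_of_nonneg_left ?_ (sq_nonneg _)
    refine mul_le_of_le_one_left (sq_nonneg _) ?_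
    exact pow_le_one₀ χ.nonneg χ.le_one
  refine (integrableOn_iff_integrable_of_support_subset fun z hz => ?_).1 h1
  by_contra h2
  refine hz ?_
  simp only [Metric.mem_ball, dist_zero_right, not_lt] at h2
  simp [cutoffLog_eq_zero χ (h.trans h2)]

lemma memLp_cutoffLog (h : χ.rOut ≤ 1) : MemLp (cutoffLog χ) 2 volume :=
  (memLp_two_iff_integrable_sq (measurable_cutoffLog χ).aestronglyMeasurable).2
    (integrable_cutoffLog_sq χ h)

lemma integrable_cutoffLog : Integrable (cutoffLog χ) := by
  have := (locallyIntegrable_log_norm).integrable_smul_left_of_hasCompactSupport χ.continuous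
    χ.hasCompactSupport
  exact this.const_mul _

/-- This sign is the source of the uniform upper bound for Green's functions: the singular term can
be dropped from any upper estimate. -/
lemma cutoffLog_nonpos (h : χ.rOut ≤ 1) (z : ℂ) : cutoffLog χ z ≤ 0 := by
  by_cases hz : χ.rOut ≤ ‖z‖
  · rw [cutoffLog_eq_zero χ hz]
  · refine mul_nonpos_of_nonneg_of_nonpos (inv_nonneg.2 laplacianLogMass_pos.le) ?_
    refine mul_nonpos_of_nonneg_of_nonpos χ.nonneg ?_
    exact Real.log_nonpos (norm_nonneg _) ((not_le.1 hz).le.trans h)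

lemma continuousAt_cutoffLog {z : ℂ} (hz : z ≠ 0) : ContinuousAt (cutoffLog χ) z :=
  continuousAt_const.mul (χ.continuous.continuousAt.mul
    (continuous_norm.continuousAt.log (norm_ne_zero_iff.2 hz)))

/-- The kernel splits as a normalized log ‖z‖ plus a term containing χ - 1. The first part produces
ψ 0. The second is smooth, because χ - 1 vanishes near the singularity, so its Laplacian can be
taken classically. -/
theorem integral_cutoffLog_mul_laplacian {ψ : ℂ → ℝ} (hψ : ContDiff ℝ 2 ψ)
    (hc : HasCompactSupport ψ) :
    ∫ z, cutoffLog χ z * Laplacian.laplacian ψ z = ψ 0 + ∫ z, cutoffLogError χ z * ψ z := by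
  have h1 := integral_log_norm_mul_laplacian hψ hc
  have h2 := integral_mul_laplacian isOpen_univ (contDiff_cutoffLog_sub_log χ (n := 2)).contDiffOn hψ hc
    (Set.subset_univ _)
  have hΔ := continuous_laplacian hψ
  have hcΔ := hasCompactSupport_laplacian hc
  have i1 : Integrable fun z => Real.log ‖z‖ * Laplacian.laplacian ψ z :=
    locallyIntegrable_log_norm.integrable_smul_right_of_hasCompactSupport hΔ hcΔ
  have i2 : Integrable fun z : ℂ => laplacianLogMass⁻¹ * ((χ z - 1) * Real.log ‖z‖)
      * Laplacian.laplacian ψ z :=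
    integrable_mul_of_tsupport_subset isOpen_univ
      (contDiff_cutoffLog_sub_log χ (n := 0)).continuous.continuousOn hΔ hcΔ (Set.subset_univ _)
  calc ∫ z, cutoffLog χ z * Laplacian.laplacian ψ z
      = ∫ z, (laplacianLogMass⁻¹ * (Real.log ‖z‖ * Laplacian.laplacian ψ z)
        + laplacianLogMass⁻¹ * ((χ z - 1) * Real.log ‖z‖) * Laplacian.laplacian ψ z) := by
        congr 1; ext z; rw [cutoffLog]; ring
    _ = _ := by
        rw [integral_add (i1.const_mul _) i2, integral_const_mul, h1, h2, ← mul_assoc,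
          inv_mul_cancel₀ laplacianLogMass_pos.ne', one_mul]
        rfl

/-! ### Convolution with test functions -/

theorem contDiff_integral_smul_comp_sub {F : Type*} [NormedAddCommGroup F] [NormedSpace ℝ F]
    {g : ℂ → ℝ} (hg : LocallyIntegrable g) {Φ : ℂ → F} {n : ℕ∞} (hΦ : ContDiff ℝ n Φ)
    (hc : HasCompactSupport Φ) :
    ContDiff ℝ n fun z => ∫ w, g w • Φ (z - w) :=
  hc.contDiff_convolution_right (ContinuousLinearMap.lsmul ℝ ℝ) hg hΦ

theorem integrable_smul_comp_sub {F : Type*} [NormedAddCommGroup F] [NormedSpace ℝ F]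
    {g : ℂ → ℝ} (hg : LocallyIntegrable g) {Φ : ℂ → F} (hΦ : Continuous Φ)
    (hc : HasCompactSupport Φ) (z : ℂ) : Integrable fun w => g w • Φ (z - w) :=
  hc.convolutionExists_right (ContinuousLinearMap.lsmul ℝ ℝ) hg hΦ z

/-- Induction on the order. The target space is arbitrary because each step replaces Φ by its
derivative, with values in a space of linear maps. -/
theorem iteratedFDeriv_integral_smul_comp_sub {F : Type*} [NormedAddCommGroup F] [NormedSpace ℝ F]
    [CompleteSpace F] {g : ℂ → ℝ} (hg : LocallyIntegrable g) (n : ℕ) {Φ : ℂ → F}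
    (hΦ : ContDiff ℝ (⊤ : ℕ∞) Φ) (hc : HasCompactSupport Φ) (z : ℂ) :
    iteratedFDeriv ℝ n (fun z => ∫ w, g w • Φ (z - w)) z
      = ∫ w, g w • iteratedFDeriv ℝ n Φ (z - w) := by
  induction n generalizing F z with
  | zero =>
    simp only [iteratedFDeriv_zero_eq_comp, Function.comp]
    simp only [← LinearIsometryEquiv.map_smul]
    exact ((continuousMultilinearCurryFin0 ℝ ℂ F).symm.toContinuousLinearEquiv.integral_comp_comm
      (μ := volume) (fun w => g w • Φ (z - w))).symm
  | succ n ih =>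
    have h1 : fderiv ℝ (fun z => ∫ w, g w • Φ (z - w))
        = fun z => ∫ w, g w • fderiv ℝ Φ (z - w) := by
      ext1 y
      exact (hc.hasFDerivAt_convolution_right (ContinuousLinearMap.lsmul ℝ ℝ) hg
        (hΦ.of_le (by norm_cast)) y).fderiv
    have h2 : ContDiff ℝ (⊤ : ℕ∞) (fderiv ℝ Φ) := hΦ.fderiv_right (by norm_cast)
    simp only [iteratedFDeriv_succ_eq_comp_right, Function.comp]
    rw [h1, ih h2 (hc.fderiv ℝ)]
    simp only [← LinearIsometryEquiv.map_smul]
    exact ((continuousMultilinearCurryRightEquiv' ℝ n ℂ F).symm.toContinuousLinearEquiv.integral_comp_comm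
      (μ := volume) (fun w => g w • iteratedFDeriv ℝ n (fderiv ℝ Φ) (z - w))).symm

theorem laplacian_integral_mul_comp_sub {g : ℂ → ℝ} (hg : LocallyIntegrable g) {Φ : ℂ → ℝ}
    (hΦ : ContDiff ℝ (⊤ : ℕ∞) Φ) (hc : HasCompactSupport Φ) (z : ℂ) :
    Laplacian.laplacian (fun z => ∫ w, g w * Φ (z - w)) z
      = ∫ w, g w * Laplacian.laplacian Φ (z - w) := by
  have hcd : ContDiff ℝ (⊤ : ℕ∞) (iteratedFDeriv ℝ 2 Φ) := hΦ.iteratedFDeriv_right (by norm_cast)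
  have hi := integrable_smul_comp_sub hg hcd.continuous (hc.iteratedFDeriv 2) z
  have key := iteratedFDeriv_integral_smul_comp_sub hg 2 hΦ hc z
  simp only [smul_eq_mul] at key
  rw [InnerProductSpace.laplacian_eq_iteratedFDeriv_complexPlane,
    InnerProductSpace.laplacian_eq_iteratedFDeriv_complexPlane]
  simp only [key]
  have e : ∀ m : Fin 2 → ℂ, (∫ w, g w • iteratedFDeriv ℝ 2 Φ (z - w)) m
      = ∫ w, g w * iteratedFDeriv ℝ 2 Φ (z - w) m := fun m =>
    ((ContinuousMultilinearMap.apply ℝ (fun _ : Fin 2 => ℂ) ℝ m).integral_comp_comm hi).symm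
  have ei : ∀ m : Fin 2 → ℂ, Integrable fun w => g w * iteratedFDeriv ℝ 2 Φ (z - w) m := fun m =>
    (ContinuousMultilinearMap.apply ℝ (fun _ : Fin 2 => ℂ) ℝ m).integrable_comp hi
  rw [e, e, ← integral_add (ei _) (ei _)]
  congr 1; ext w; ring

lemma laplacian_comp_const_sub {ψ : ℂ → ℝ} (hψ : ContDiff ℝ 2 ψ) (w t : ℂ) :
    Laplacian.laplacian (fun t => ψ (w - t)) t = Laplacian.laplacian ψ (w - t) := by
  have h1 : iteratedFDeriv ℝ 2 (fun t => ψ (w - t)) t = iteratedFDeriv ℝ 2 ψ (w - t) := by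
    have h2 : ContDiff ℝ 2 (fun s => ψ (w + s)) := hψ.comp (contDiff_const.add contDiff_id)
    have h3 := congrFun (iteratedFDeriv_comp_const_smul (i := 2) (-1 : ℝ) h2) t
    simp only [neg_smul, one_smul, ← sub_eq_add_neg] at h3
    rw [h3, iteratedFDeriv_comp_add_left]
    simp [sub_eq_add_neg]
  rw [InnerProductSpace.laplacian_eq_iteratedFDeriv_complexPlane,
    InnerProductSpace.laplacian_eq_iteratedFDeriv_complexPlane]
  simp only [h1]

/-! ### Representation formula for the planar Poisson equation -/

/-- The correlation `z ↦ ∫ k (w - z) f w dw`. -/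
def correlation (k f : ℂ → ℝ) (z : ℂ) : ℝ := ∫ w, k (w - z) * f w

lemma integrable_correlation_integrand {k f : ℂ → ℝ} (hk : Integrable k) (hf : Integrable f)
    {ψ : ℂ → ℝ} (hψ : Continuous ψ) (hc : HasCompactSupport ψ) :
    Integrable (fun p : ℂ × ℂ => ψ p.1 * (k (p.2 - p.1) * f p.2)) (volume.prod volume) := by
  have h1 : Integrable (fun p : ℂ × ℂ => f p.2 * (fun t => k (-t)) (p.1 - p.2))
      (volume.prod volume) :=
    hf.convolution_integrand (ContinuousLinearMap.mul ℝ ℝ) hk.comp_neg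
  obtain ⟨M, hM⟩ := hc.exists_bound_of_continuous hψ
  refine (h1.bdd_mul (c := M) (f := fun p : ℂ × ℂ => ψ p.1)
    (hψ.comp continuous_fst).aestronglyMeasurable (Eventually.of_forall fun p => hM p.1)).congr
    (Eventually.of_forall fun p => ?_)
  simp only [neg_sub]
  ring

lemma integrable_correlation {k f : ℂ → ℝ} (hk : Integrable k) (hf : Integrable f) :
    Integrable (correlation k f) := by
  have h1 : Integrable (fun p : ℂ × ℂ => f p.2 * (fun t => k (-t)) (p.1 - p.2))
      (volume.prod volume) :=
    hf.convolution_integrand (ContinuousLinearMap.mul ℝ ℝ) hk.comp_neg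
  refine h1.integral_prod_left.congr (Eventually.of_forall fun z => ?_)
  simp only [correlation, neg_sub]
  congr 1; ext w; ring

/-- Fubini after the substitution t = w - z: averaging the test function against k is dual to
forming the correlation of k with f. -/
lemma integral_mul_integral_mul_comp_sub {k f : ℂ → ℝ} (hk : Integrable k) (hf : Integrable f)
    {ψ : ℂ → ℝ} (hψ : Continuous ψ) (hc : HasCompactSupport ψ) :
    ∫ w, f w * ∫ t, k t * ψ (w - t) = ∫ z, ψ z * correlation k f z := by
  have hi := integrable_correlation_integrand hk hf hψ hc
  calc ∫ w, f w * ∫ t, k t * ψ (w - t)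
      = ∫ w, ∫ z, ψ z * (k (w - z) * f w) := by
        congr 1; ext w
        rw [← integral_sub_left_eq_self _ volume w, ← integral_const_mul]
        congr 1; ext z
        rw [sub_sub_cancel]; ring
    _ = ∫ z, ∫ w, ψ z * (k (w - z) * f w) :=
        (integral_integral_swap (f := fun z w => ψ z * (k (w - z) * f w)) hi).symm
    _ = ∫ z, ψ z * correlation k f z := by
        congr 1; ext z; rw [integral_const_mul, correlation]

variable (χ : ContDiffBump (0 : ℂ))

lemma integrable_cutoffLogError : Integrable (cutoffLogError χ) :=
  (contDiff_cutoffLogError χ (n := 0)).continuous.integrable_of_hasCompactSupport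
    (hasCompactSupport_cutoffLogError χ)

/-- Representation formula for solutions of the Poisson equation in the sense of distributions. -/
theorem ae_eq_cutoffLog_representation {U V : Set ℂ} (hV : IsOpen V)
    (hVU : ∀ z ∈ V, Metric.closedBall z χ.rOut ⊆ U) {v f : ℂ → ℝ} (hv : Integrable v)
    (hf : Integrable f) {c : ℝ} {q : ℂ}
    (h : ∀ ψ : ℂ → ℝ, ContDiff ℝ (⊤ : ℕ∞) ψ → HasCompactSupport ψ → tsupport ψ ⊆ U →
      ∫ z, v z * Laplacian.laplacian ψ z = c * ψ q + ∫ z, f z * ψ z) :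
    ∀ᵐ z, z ∈ V → v z = c * cutoffLog χ (z - q) + correlation (cutoffLog χ) f z
      - correlation (cutoffLogError χ) v z := by
  have hE := integrable_cutoffLog χ
  have hS := integrable_cutoffLogError χ
  have i1 := integrable_correlation hE hf
  have i2 := integrable_correlation hS hv
  have i3 : Integrable fun z => c * cutoffLog χ (z - q) := (hE.comp_sub_right q).const_mul c
  have key : ∀ᵐ z, z ∈ V → v z - (c * cutoffLog χ (z - q) + correlation (cutoffLog χ) f z
      - correlation (cutoffLogError χ) v z) = 0 := by
    refine IsOpen.ae_eq_zero_of_integral_contDiff_smul_eq_zero hV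
      ((hv.sub ((i3.add i1).sub i2)).locallyIntegrable.locallyIntegrableOn V) ?_
    intro ψ hψ hc hs
    have hψ2 : ContDiff ℝ 2 ψ := hψ.of_le (by norm_cast)
    -- The equation is tested against the potential Ψ of ψ. It is supported within `χ.rOut` of the
    -- support of ψ, hence inside U, and ΔΨ is ψ plus a smooth convolution. Fubini then moves the
    -- kernels back onto v and f.
    set Ψ : ℂ → ℝ := fun w => ∫ t, cutoffLog χ t * ψ (w - t) with hΨ
    have hΨs : ContDiff ℝ (⊤ : ℕ∞) Ψ := contDiff_integral_smul_comp_sub hE.locallyIntegrable hψ hc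
    have hΨK : Function.support Ψ ⊆ tsupport ψ + Metric.closedBall 0 χ.rOut := by
      intro w hw
      by_contra hcon
      refine hw ?_
      have : ∀ t, cutoffLog χ t * ψ (w - t) = 0 := by
        intro t
        by_cases ht : χ.rOut ≤ ‖t‖
        · rw [cutoffLog_eq_zero χ ht, zero_mul]
        · refine mul_eq_zero_of_right _ (image_eq_zero_of_notMem_tsupport fun h1 => ?_)
          exact hcon ⟨w - t, h1, t, by simpa using (not_le.1 ht).le, by ring⟩
      simp only [hΨ, this, integral_zero]
    have hK : IsCompact (tsupport ψ + Metric.closedBall (0 : ℂ) χ.rOut) :=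
      IsCompact.add hc (isCompact_closedBall _ _)
    have hΨc : HasCompactSupport Ψ := HasCompactSupport.of_support_subset_isCompact hK hΨK
    have hΨU : tsupport Ψ ⊆ U := by
      refine (closure_minimal hΨK hK.isClosed).trans ?_
      rintro _ ⟨a, ha, b, hb, rfl⟩
      refine hVU a (hs ha) ?_
      simpa using hb
    have hΔ : ∀ w, Laplacian.laplacian Ψ w = ψ w + ∫ t, cutoffLogError χ t * ψ (w - t) := by
      intro w
      rw [hΨ, laplacian_integral_mul_comp_sub hE.locallyIntegrable hψ hc]
      have hψw : ContDiff ℝ 2 fun t => ψ (w - t) := hψ2.comp (contDiff_const.sub contDiff_id)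
      have hcw : HasCompactSupport fun t => ψ (w - t) :=
        hc.comp_homeomorph (Homeomorph.subLeft w)
      have := integral_cutoffLog_mul_laplacian χ hψw hcw
      simp only [laplacian_comp_const_sub hψ2, sub_zero] at this
      exact this
    have heq := h Ψ hΨs hΨc hΨU
    have hψi : Integrable fun z => v z * ψ z := by
      obtain ⟨M, hM⟩ := hc.exists_bound_of_continuous hψ.continuous
      exact hv.mul_bdd (c := M) hψ.continuous.aestronglyMeasurable (Eventually.of_forall hM)
    have bdd : ∀ {u : ℂ → ℝ}, Integrable u → Integrable fun z => ψ z * u z := by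
      intro u hu
      obtain ⟨M, hM⟩ := hc.exists_bound_of_continuous hψ.continuous
      exact hu.bdd_mul hψ.continuous.aestronglyMeasurable (Eventually.of_forall hM)
    have hvi : Integrable fun w => v w * ∫ t, cutoffLogError χ t * ψ (w - t) := by
      have hcont : ContDiff ℝ (0 : ℕ∞) fun w => ∫ t, cutoffLogError χ t * ψ (w - t) :=
        contDiff_integral_smul_comp_sub hS.locallyIntegrable (hψ.of_le (by simp)) hc
      obtain ⟨M, hM⟩ := hc.exists_bound_of_continuous hψ.continuous
      refine hv.mul_bdd (c := ∫ t, ‖cutoffLogError χ t‖ * M) hcont.continuous.aestronglyMeasurable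
        (Eventually.of_forall fun w => ?_)
      refine norm_integral_le_of_norm_le (hS.norm.mul_const M) (Eventually.of_forall fun t => ?_)
      rw [norm_mul]
      exact mul_le_mul_of_nonneg_left (hM _) (norm_nonneg _)
    have hq : Ψ q = ∫ z, ψ z * cutoffLog χ (z - q) := by
      simp only [hΨ]
      rw [← integral_sub_left_eq_self _ volume q]
      congr 1; ext z
      rw [sub_sub_cancel, mul_comm, ← cutoffLog_neg χ (q - z), neg_sub]
    simp only [hΔ, mul_add] at heq
    rw [integral_add hψi hvi, integral_mul_integral_mul_comp_sub hS hv hψ.continuous hc,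
      integral_mul_integral_mul_comp_sub hE hf hψ.continuous hc, hq] at heq
    have e1 : ∀ z, ψ z • (v z - (c * cutoffLog χ (z - q) + correlation (cutoffLog χ) f z
        - correlation (cutoffLogError χ) v z)) = ((v z * ψ z + ψ z * correlation (cutoffLogError χ) v z)
        - c * (ψ z * cutoffLog χ (z - q))) - ψ z * correlation (cutoffLog χ) f z := fun z => by
      rw [smul_eq_mul]; ring
    simp only [e1]
    have j1 := (bdd (hE.comp_sub_right q)).const_mul c
    rw [integral_sub, integral_sub, integral_add hψi (bdd i2), integral_const_mul]
    · linarith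
    · exact hψi.add (bdd i2)
    · exact j1
    · exact (hψi.add (bdd i2)).sub j1
    · exact bdd i1
  filter_upwards [key] with z hz hzV
  linarith [hz hzV]

/-! ### Global Hölder bounds -/

/-- `u` is `C²` on the plane, its derivatives of order at most two are bounded by `C`, and its
second derivative is `β`-Hölder with constant `C`. -/
structure HolderBound (β C : ℝ) (u : ℂ → ℝ) : Prop where
  contDiff : ContDiff ℝ 2 u
  norm_le : ∀ m ≤ 2, ∀ z, ‖iteratedFDeriv ℝ m u z‖ ≤ C
  dist_le : ∀ z z', ‖iteratedFDeriv ℝ 2 u z - iteratedFDeriv ℝ 2 u z'‖ ≤ C * ‖z - z'‖ ^ β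

lemma HolderBound.add {β C C' : ℝ} {u u' : ℂ → ℝ} (h : HolderBound β C u)
    (h' : HolderBound β C' u') : HolderBound β (C + C') (fun z => u z + u' z) := by
  have e : ∀ m ≤ 2, ∀ z, iteratedFDeriv ℝ m (fun z => u z + u' z) z
      = iteratedFDeriv ℝ m u z + iteratedFDeriv ℝ m u' z := fun m hm z =>
    fun_iteratedFDeriv_add_apply (h.contDiff.of_le (by exact_mod_cast hm)).contDiffAt
      (h'.contDiff.of_le (by exact_mod_cast hm)).contDiffAt
  refine ⟨h.contDiff.add h'.contDiff, fun m hm z => ?_, fun z z' => ?_⟩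
  · rw [e m hm]
    exact (norm_add_le _ _).trans (add_le_add (h.norm_le m hm z) (h'.norm_le m hm z))
  · rw [e 2 le_rfl, e 2 le_rfl, add_sub_add_comm, add_mul]
    exact (norm_add_le _ _).trans (add_le_add (h.dist_le z z') (h'.dist_le z z'))

lemma HolderBound.neg {β C : ℝ} {u : ℂ → ℝ} (h : HolderBound β C u) :
    HolderBound β C (fun z => -u z) := by
  have e : ∀ m, ∀ z, iteratedFDeriv ℝ m (fun z => -u z) z = -iteratedFDeriv ℝ m u z := fun m z =>
    iteratedFDeriv_neg_apply
  refine ⟨h.contDiff.neg, fun m hm z => ?_, fun z z' => ?_⟩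
  · rw [e, norm_neg]; exact h.norm_le m hm z
  · rw [e, e, ← neg_sub', norm_neg]; exact h.dist_le z z'

lemma norm_integral_le_of_forall_notMem_closedBall {F : Type*} [NormedAddCommGroup F]
    [NormedSpace ℝ F] {f : ℂ → F} {z : ℂ} {ρ C : ℝ} (hρ : 0 ≤ ρ)
    (h0 : ∀ w, w ∉ Metric.closedBall z ρ → f w = 0) (hC : ∀ w ∈ Metric.closedBall z ρ, ‖f w‖ ≤ C) :
    ‖∫ w, f w‖ ≤ C * (volume.real (Metric.closedBall (0 : ℂ) 1) * ρ ^ 2) := by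
  rw [← setIntegral_eq_integral_of_forall_compl_eq_zero h0]
  refine (norm_setIntegral_le_of_norm_le_const measure_closedBall_lt_top hC).trans_eq ?_
  rw [Measure.addHaar_real_closedBall' volume z hρ, Complex.finrank_real_complex]
  ring

lemma exists_bound_iteratedFDeriv {φ : ℂ → ℝ} (hφ : ContDiff ℝ (⊤ : ℕ∞) φ)
    (hc : HasCompactSupport φ) :
    ∃ B : ℝ, 0 ≤ B ∧ (∀ m ≤ 2, ∀ z, ‖iteratedFDeriv ℝ m φ z‖ ≤ B) ∧
      ∀ z z', ‖iteratedFDeriv ℝ 2 φ z - iteratedFDeriv ℝ 2 φ z'‖ ≤ B * ‖z - z'‖ := by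
  have hb : ∀ m : ℕ, ∃ B, ∀ z, ‖iteratedFDeriv ℝ m φ z‖ ≤ B := fun m =>
    (hc.iteratedFDeriv m).exists_bound_of_continuous
      (hφ.continuous_iteratedFDeriv (by exact_mod_cast le_top))
  choose B hB using hb
  have hcd : ContDiff ℝ 1 (iteratedFDeriv ℝ 2 φ) := hφ.iteratedFDeriv_right (by norm_cast)
  obtain ⟨L, hL⟩ := ContDiff.lipschitzWith_of_hasCompactSupport (hc.iteratedFDeriv 2) hcd one_ne_zero
  have hB0 : ∀ m, 0 ≤ B m := fun m => (norm_nonneg _).trans (hB m 0)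
  refine ⟨B 0 + B 1 + B 2 + L, ?_, ?_, ?_⟩
  · have := hB0 0; have := hB0 1; have := hB0 2; positivity
  · intro m hm z
    have h0 := hB0 0; have h1 := hB0 1; have h2 := hB0 2; have := L.2
    refine (hB m z).trans ?_
    interval_cases m <;> simp only [NNReal.val_eq_coe] at this <;> linarith
  · intro z z'
    refine (lipschitzWith_iff_norm_sub_le.1 hL z z').trans ?_
    have h0 := hB0 0; have h1 := hB0 1; have h2 := hB0 2
    gcongr
    linarith

/-- Convolution of an integrable function with a test function. -/
theorem exists_holderBound_integral_mul_comp_sub {β : ℝ} (hβ0 : 0 < β) (hβ1 : β < 1) {φ : ℂ → ℝ}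
    (hφ : ContDiff ℝ (⊤ : ℕ∞) φ) (hc : HasCompactSupport φ) :
    ∃ C : ℝ, 0 ≤ C ∧ ∀ v : ℂ → ℝ, Integrable v →
      HolderBound β (C * ∫ w, |v w|) fun z => ∫ w, v w * φ (z - w) := by
  obtain ⟨B, hB0, hB, hL⟩ := exists_bound_iteratedFDeriv hφ hc
  -- The factor 2 serves points at distance at least 1, where the difference of two second
  -- derivatives is bounded crudely. At distance at most 1 the Lipschitz bound is enough, because t
  -- ≤ t ^ β for t ≤ 1.
  refine ⟨2 * B, by positivity, fun v hv => ?_⟩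
  have hI : 0 ≤ ∫ w, |v w| := integral_nonneg fun w => abs_nonneg _
  have e := fun m => iteratedFDeriv_integral_smul_comp_sub hv.locallyIntegrable m hφ hc
  simp only [smul_eq_mul] at e
  have hint : ∀ m z, Integrable fun w => v w • iteratedFDeriv ℝ m φ (z - w) := fun m z =>
    integrable_smul_comp_sub hv.locallyIntegrable
      (hφ.continuous_iteratedFDeriv (by exact_mod_cast le_top)) (hc.iteratedFDeriv m) z
  refine ⟨(contDiff_integral_smul_comp_sub (n := 2) hv.locallyIntegrable
    (hφ.of_le (by norm_cast)) hc), fun m hm z => ?_, fun z z' => ?_⟩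
  · rw [e]
    calc _ ≤ ∫ w, |v w| * (2 * B) := by
          refine norm_integral_le_of_norm_le (hv.abs.mul_const _) (Eventually.of_forall fun w => ?_)
          rw [norm_smul, Real.norm_eq_abs]
          gcongr
          linarith [hB m hm (z - w)]
      _ = _ := by rw [integral_mul_const, mul_comm]
  · rw [e, e, ← integral_sub (hint 2 z) (hint 2 z')]
    calc _ ≤ ∫ w, |v w| * (2 * B * ‖z - z'‖ ^ β) := by
          refine norm_integral_le_of_norm_le (hv.abs.mul_const _) (Eventually.of_forall fun w => ?_)
          rw [← smul_sub, norm_smul, Real.norm_eq_abs]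
          refine mul_le_mul_of_nonneg_left ?_ (abs_nonneg _)
          rcases le_total ‖z - z'‖ 1 with h | h
          · refine (hL _ _).trans ?_
            rw [sub_sub_sub_cancel_right]
            have : ‖z - z'‖ ≤ ‖z - z'‖ ^ β := by
              rcases (norm_nonneg (z - z')).eq_or_lt with h0 | h0
              · rw [← h0, Real.zero_rpow hβ0.ne']
              · simpa using Real.rpow_le_rpow_of_exponent_ge h0 h hβ1.le
            nlinarith [norm_nonneg (z - z')]
          · have h1 : (1 : ℝ) ≤ ‖z - z'‖ ^ β := Real.one_le_rpow h hβ0.le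
            refine (norm_sub_le _ _).trans ?_
            nlinarith [hB 2 le_rfl (z - w), hB 2 le_rfl (z' - w)]
      _ = _ := by rw [integral_mul_const]; ring

/-! ### Potentials with a rescaled smooth kernel -/

section scaled

variable {φ : ℂ → ℝ} {B r β M A : ℝ} {g : ℂ → ℝ}

lemma iteratedFDeriv_integral_mul_comp_smul_sub (hφ : ContDiff ℝ (⊤ : ℕ∞) φ)
    (hc : HasCompactSupport φ) (hg : LocallyIntegrable g) {s : ℝ} (hs : 0 < s) (m : ℕ) (z : ℂ) :
    iteratedFDeriv ℝ m (fun z => ∫ w, g w * φ (s • (z - w))) z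
      = ∫ w, g w • s ^ m • iteratedFDeriv ℝ m φ (s • (z - w)) := by
  have h1 : ContDiff ℝ (⊤ : ℕ∞) fun t => φ (s • t) := hφ.comp (contDiff_const_smul s)
  have h2 : HasCompactSupport fun t => φ (s • t) := hc.comp_smul hs.ne'
  have h3 := iteratedFDeriv_integral_smul_comp_sub hg m h1 h2 z
  rw [iteratedFDeriv_comp_const_smul s (hφ.of_le (by exact_mod_cast le_top))] at h3
  exact h3

lemma integrable_smul_iteratedFDeriv_comp_smul (hφ : ContDiff ℝ (⊤ : ℕ∞) φ)
    (hc : HasCompactSupport φ) (hg : LocallyIntegrable g) {s : ℝ} (hs : 0 < s) (m : ℕ) (z : ℂ) :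
    Integrable fun w => g w • s ^ m • iteratedFDeriv ℝ m φ (s • (z - w)) := by
  have hcont : Continuous fun t => iteratedFDeriv ℝ m φ (s • t) :=
    (hφ.continuous_iteratedFDeriv (by exact_mod_cast le_top)).comp (continuous_const_smul s)
  exact integrable_smul_comp_sub hg (Φ := fun t => s ^ m • iteratedFDeriv ℝ m φ (s • t))
    (hcont.const_smul (s ^ m)) (((hc.iteratedFDeriv m).comp_smul hs.ne').smul_left (f := fun _ => s ^ m)) z

lemma iteratedFDeriv_comp_smul_sub_eq_zero (hsupp : ∀ z, r < ‖z‖ → φ z = 0) {s : ℝ} (hs : 0 < s)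
    (m : ℕ) {z w : ℂ} (hw : w ∉ Metric.closedBall z (r / s)) :
    iteratedFDeriv ℝ m φ (s • (z - w)) = 0 := by
  have h1 : r < ‖s • (z - w)‖ := by
    rw [Metric.mem_closedBall, not_le, dist_comm, dist_eq_norm, div_lt_iff₀ hs] at hw
    rwa [norm_smul, Real.norm_of_nonneg hs.le, mul_comm]
  have h2 : φ =ᶠ[𝓝 (s • (z - w))] fun _ => 0 := by
    filter_upwards [(isOpen_lt continuous_const continuous_norm).mem_nhds h1] with y hy
    exact hsupp y hy
  rw [(h2.iteratedFDeriv ℝ m).eq_of_nhds]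
  simp

lemma norm_iteratedFDeriv_integral_comp_smul_le (hφ : ContDiff ℝ (⊤ : ℕ∞) φ)
    (hc : HasCompactSupport φ) (hr : 0 < r) (hsupp : ∀ z, r < ‖z‖ → φ z = 0) {m : ℕ}
    (hB : ∀ z, ‖iteratedFDeriv ℝ m φ z‖ ≤ B) (hg : LocallyIntegrable g) (hM : ∀ w, |g w| ≤ M)
    {s : ℝ} (hs : 0 < s) (z : ℂ) :
    ‖iteratedFDeriv ℝ m (fun z => ∫ w, g w * φ (s • (z - w))) z‖
      ≤ M * (s ^ m * B) * (volume.real (Metric.closedBall (0 : ℂ) 1) * (r / s) ^ 2) := by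
  rw [iteratedFDeriv_integral_mul_comp_smul_sub hφ hc hg hs]
  refine norm_integral_le_of_forall_notMem_closedBall (z := z) (by positivity) (fun w hw => ?_) fun w _ => ?_
  · rw [iteratedFDeriv_comp_smul_sub_eq_zero hsupp hs m hw, smul_zero, smul_zero]
  · rw [norm_smul, norm_smul, Real.norm_eq_abs, Real.norm_of_nonneg (by positivity)]
    have := (abs_nonneg _).trans (hM w)
    gcongr
    · exact hM w
    · exact hB _

/-- The convolution of a constant with the kernel is constant, so its second derivative vanishes.
This is the cancellation behind the Schauder estimate. -/
lemma integral_iteratedFDeriv_comp_smul_sub_eq_zero (hφ : ContDiff ℝ (⊤ : ℕ∞) φ)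
    (hc : HasCompactSupport φ) {s : ℝ} (hs : 0 < s) (z : ℂ) :
    ∫ w, s ^ 2 • iteratedFDeriv ℝ 2 φ (s • (z - w)) = 0 := by
  have h := iteratedFDeriv_integral_mul_comp_smul_sub hφ hc (g := fun _ => 1)
    (locallyIntegrable_const _) hs 2 z
  simp only [one_smul, one_mul] at h
  rw [← h]
  have : (fun z : ℂ => ∫ w, φ (s • (z - w))) = fun _ => ∫ w, φ (s • w) := by
    ext z
    exact integral_sub_left_eq_self (fun w => φ (s • w)) volume z
  rw [this, iteratedFDeriv_const_of_ne (by norm_num)]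
  rfl

/-- By the cancellation any constant may be subtracted from g; below, c is the value of g at a
nearby point, so that only the oscillation of g counts. -/
lemma iteratedFDeriv_two_eq_integral_sub (hφ : ContDiff ℝ (⊤ : ℕ∞) φ)
    (hc : HasCompactSupport φ) (hg : LocallyIntegrable g) {s : ℝ} (hs : 0 < s) (c : ℝ) (z : ℂ) :
    iteratedFDeriv ℝ 2 (fun z => ∫ w, g w * φ (s • (z - w))) z
      = ∫ w, (g w - c) • s ^ 2 • iteratedFDeriv ℝ 2 φ (s • (z - w)) := by
  have h1 := integrable_smul_iteratedFDeriv_comp_smul hφ hc hg hs 2 z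
  have h2 := integrable_smul_iteratedFDeriv_comp_smul hφ hc (g := fun _ => c)
    (locallyIntegrable_const _) hs 2 z
  simp only [sub_smul]
  rw [integral_sub h1 h2, integral_smul, integral_iteratedFDeriv_comp_smul_sub_eq_zero hφ hc hs,
    smul_zero, sub_zero, iteratedFDeriv_integral_mul_comp_smul_sub hφ hc hg hs]

/-- The kernel at scale s lives on a disk of radius r / s, where g oscillates by at most A (r / s) ^
β. The factor s ^ 2 from two derivatives is balanced by the area of the disk, and the gain (r / s) ^
β remains. -/
lemma norm_iteratedFDeriv_two_integral_comp_smul_le (hφ : ContDiff ℝ (⊤ : ℕ∞) φ)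
    (hc : HasCompactSupport φ) (hr : 0 < r) (hsupp : ∀ z, r < ‖z‖ → φ z = 0)
    (hB : ∀ z, ‖iteratedFDeriv ℝ 2 φ z‖ ≤ B) (hg : LocallyIntegrable g) (hβ : 0 < β) (hA0 : 0 ≤ A)
    (hA : ∀ w z, |g w - g z| ≤ A * ‖w - z‖ ^ β) {s : ℝ} (hs : 0 < s) (z : ℂ) :
    ‖iteratedFDeriv ℝ 2 (fun z => ∫ w, g w * φ (s • (z - w))) z‖
      ≤ A * (r / s) ^ β * (s ^ 2 * B) *
        (volume.real (Metric.closedBall (0 : ℂ) 1) * (r / s) ^ 2) := by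
  rw [iteratedFDeriv_two_eq_integral_sub hφ hc hg hs (g z)]
  have hB0 : 0 ≤ B := (norm_nonneg _).trans (hB 0)
  refine norm_integral_le_of_forall_notMem_closedBall (z := z) (by positivity) (fun w hw => ?_) fun w hw => ?_
  · rw [iteratedFDeriv_comp_smul_sub_eq_zero hsupp hs 2 hw, smul_zero, smul_zero]
  · rw [norm_smul, norm_smul, Real.norm_eq_abs, Real.norm_of_nonneg (by positivity)]
    rw [Metric.mem_closedBall, dist_eq_norm] at hw
    have h1 : |g w - g z| ≤ A * (r / s) ^ β := (hA w z).trans (by gcongr)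
    gcongr
    exact hB _

/-- For ‖z - z'‖ ≤ r / s the same constant g z is subtracted at both points and the Lipschitz bound
of the second derivative of φ is used. For larger distances the two terms are bounded separately,
and r ≤ s ‖z - z'‖ supplies the missing factor. -/
lemma norm_sub_iteratedFDeriv_two_integral_comp_smul_le (hφ : ContDiff ℝ (⊤ : ℕ∞) φ)
    (hc : HasCompactSupport φ) (hr : 0 < r) (hsupp : ∀ z, r < ‖z‖ → φ z = 0)
    (hB : ∀ z, ‖iteratedFDeriv ℝ 2 φ z‖ ≤ B)
    (hL : ∀ z z', ‖iteratedFDeriv ℝ 2 φ z - iteratedFDeriv ℝ 2 φ z'‖ ≤ B * ‖z - z'‖)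
    (hg : LocallyIntegrable g) (hβ : 0 < β) (hA0 : 0 ≤ A)
    (hA : ∀ w z, |g w - g z| ≤ A * ‖w - z‖ ^ β) {s : ℝ} (hs : 0 < s) (z z' : ℂ) :
    ‖iteratedFDeriv ℝ 2 (fun z => ∫ w, g w * φ (s • (z - w))) z
      - iteratedFDeriv ℝ 2 (fun z => ∫ w, g w * φ (s • (z - w))) z'‖
      ≤ A * (r / s) ^ β * (B * volume.real (Metric.closedBall (0 : ℂ) 1) *
        (2 ^ β * (2 * r) ^ 2 + 2 * r)) * (s * ‖z - z'‖) := by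
  have hB0 : 0 ≤ B := (norm_nonneg _).trans (hB 0)
  set V := volume.real (Metric.closedBall (0 : ℂ) 1) with hV
  have hV0 : 0 ≤ V := measureReal_nonneg
  rcases le_total ‖z - z'‖ (r / s) with h | h
  · rw [iteratedFDeriv_two_eq_integral_sub hφ hc hg hs (g z),
      iteratedFDeriv_two_eq_integral_sub hφ hc hg hs (g z), ← integral_sub]
    rotate_left
    · exact integrable_smul_iteratedFDeriv_comp_smul hφ hc (hg.sub (locallyIntegrable_const _)) hs 2 z
    · exact integrable_smul_iteratedFDeriv_comp_smul hφ hc (hg.sub (locallyIntegrable_const _)) hs 2 z'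
    -- The disk of radius 2 r / s about z contains the supports of both kernels.
    have key : ‖∫ w, ((g w - g z) • s ^ 2 • iteratedFDeriv ℝ 2 φ (s • (z - w))
        - (g w - g z) • s ^ 2 • iteratedFDeriv ℝ 2 φ (s • (z' - w)))‖
        ≤ A * (2 * (r / s)) ^ β * (s ^ 2 * (B * (s * ‖z - z'‖))) * (V * (2 * (r / s)) ^ 2) := by
      refine norm_integral_le_of_forall_notMem_closedBall (z := z) (by positivity)
        (fun w hw => ?_) fun w hw => ?_
      · rw [Metric.mem_closedBall, not_le, dist_comm, dist_eq_norm] at hw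
        have hrs : 0 < r / s := by positivity
        rw [iteratedFDeriv_comp_smul_sub_eq_zero hsupp hs 2 (z := z) (w := w),
          iteratedFDeriv_comp_smul_sub_eq_zero hsupp hs 2 (z := z') (w := w)]
        · simp
        · rw [Metric.mem_closedBall, not_le, dist_comm, dist_eq_norm]
          have : ‖z - w‖ ≤ ‖z - z'‖ + ‖z' - w‖ := by
            simpa using norm_add_le (z - z') (z' - w)
          linarith
        · rw [Metric.mem_closedBall, not_le, dist_comm, dist_eq_norm]
          linarith
      · rw [← smul_sub, ← smul_sub, norm_smul, norm_smul, Real.norm_eq_abs,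
          Real.norm_of_nonneg (by positivity)]
        rw [Metric.mem_closedBall, dist_eq_norm] at hw
        have h1 : |g w - g z| ≤ A * (2 * (r / s)) ^ β := (hA w z).trans (by gcongr)
        have h2 := hL (s • (z - w)) (s • (z' - w))
        rw [← smul_sub, sub_sub_sub_cancel_right, norm_smul, Real.norm_of_nonneg hs.le] at h2
        gcongr
    refine key.trans ?_
    rw [Real.mul_rpow (by norm_num) (by positivity)]
    calc A * (2 ^ β * (r / s) ^ β) * (s ^ 2 * (B * (s * ‖z - z'‖))) * (V * (2 * (r / s)) ^ 2)
        = A * (r / s) ^ β * (B * V * (2 ^ β * (2 * r) ^ 2)) * (s * ‖z - z'‖) := by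
          field_simp
      _ ≤ _ := by
          gcongr
          linarith
  · have h1 := norm_iteratedFDeriv_two_integral_comp_smul_le hφ hc hr hsupp hB hg hβ hA0 hA hs z
    have h2 := norm_iteratedFDeriv_two_integral_comp_smul_le hφ hc hr hsupp hB hg hβ hA0 hA hs z'
    rw [← hV] at h1 h2
    refine (norm_sub_le _ _).trans ((add_le_add h1 h2).trans ?_)
    have h3 : r ≤ s * ‖z - z'‖ := by
      rw [div_le_iff₀ hs] at h; linarith
    calc A * (r / s) ^ β * (s ^ 2 * B) * (V * (r / s) ^ 2)
          + A * (r / s) ^ β * (s ^ 2 * B) * (V * (r / s) ^ 2)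
        = A * (r / s) ^ β * (B * V * (2 * r)) * r := by field_simp; ring
      _ ≤ A * (r / s) ^ β * (B * V * (2 * r)) * (s * ‖z - z'‖) := by gcongr
      _ ≤ _ := by
          gcongr
          have : (0 : ℝ) ≤ 2 ^ β * (2 * r) ^ 2 := by positivity
          linarith

end scaled

/-! ### Dyadic decomposition and the global Schauder estimate -/

/-- A dyadic series whose terms are controlled at small and at large scales. -/
lemma exists_tsum_le_rpow {β : ℝ} (hβ0 : 0 < β) (hβ1 : β < 1) :
    ∃ C : ℝ, 0 ≤ C ∧ ∀ (b : ℕ → ℝ) (P d : ℝ), 0 < d → 0 ≤ P → (∀ k, 0 ≤ b k) →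
      (∀ k, b k ≤ P * ((2 : ℝ) ^ (-β)) ^ k) → (∀ k, b k ≤ P * ((2 : ℝ) ^ (1 - β)) ^ k * d) →
      ∑' k, b k ≤ C * P * d ^ β := by
  set θ : ℝ := (2 : ℝ) ^ (-β) with hθ
  set τ : ℝ := (2 : ℝ) ^ (1 - β) with hτ
  have hθ0 : 0 < θ := by positivity
  have hθ1 : θ < 1 := Real.rpow_lt_one_of_one_lt_of_neg (by norm_num) (by linarith)
  have hτ1 : 1 < τ := Real.one_lt_rpow (by norm_num) (by linarith)
  have hgeo : ∀ N : ℕ, ∀ (b : ℕ → ℝ) (P : ℝ), 0 ≤ P → (∀ k, 0 ≤ b k) → (∀ k, b k ≤ P * θ ^ k) →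
      Summable b ∧ ∑' k, b (k + N) ≤ P * θ ^ N * (1 - θ)⁻¹ := by
    intro N b P hP hb h
    have hs : Summable b := Summable.of_nonneg_of_le hb h
      ((summable_geometric_of_lt_one hθ0.le hθ1).mul_left P)
    refine ⟨hs, ?_⟩
    rw [← tsum_geometric_of_lt_one hθ0.le hθ1, ← tsum_mul_left]
    refine Summable.tsum_le_tsum (fun k => ?_) ((summable_nat_add_iff N).2 hs)
      ((summable_geometric_of_lt_one hθ0.le hθ1).mul_left _)
    refine (h _).trans_eq ?_
    ring
  have hτ2 : 0 < τ - 1 := by linarith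
  have hθ2 : 0 < 1 - θ := by linarith
  refine ⟨(τ - 1)⁻¹ + 2 * (1 - θ)⁻¹, by positivity, fun b P d hd hP hb h1 h2 => ?_⟩
  rcases le_total d 1 with hd1 | hd1
  -- N is chosen with 2 ^ N ≤ 1 / d < 2 ^ (N + 1). Terms before N are summed with the increasing
  -- bound and the tail with the decreasing one; both sums are of size P d ^ β.
  · obtain ⟨N, hN1, hN2⟩ := exists_nat_pow_near ((one_le_inv₀ hd).2 hd1) (one_lt_two (α := ℝ))
    obtain ⟨hs, hN⟩ := hgeo N b P hP hb h1
    rw [← hs.sum_add_tsum_nat_add N]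
    have hτN : τ ^ N ≤ d ^ (β - 1) := by
      rw [hτ, ← Real.rpow_natCast, ← Real.rpow_mul (by norm_num), mul_comm,
        Real.rpow_mul (by norm_num), Real.rpow_natCast]
      calc ((2 : ℝ) ^ N) ^ (1 - β) ≤ (d⁻¹) ^ (1 - β) := by
            apply Real.rpow_le_rpow (by positivity) hN1 (by linarith)
        _ = d ^ (β - 1) := by
            rw [← Real.rpow_neg_one, ← Real.rpow_mul hd.le]; congr 1; ring
    have hθN : θ ^ N ≤ 2 * d ^ β := by
      have h3 : ((2 : ℝ) ^ N)⁻¹ ≤ 2 * d := by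
        rw [inv_lt_iff_one_lt_mul₀ hd] at hN2
        rw [inv_le_iff_one_le_mul₀ (by positivity)]
        rw [pow_succ] at hN2
        linarith
      rw [hθ, ← Real.rpow_natCast, ← Real.rpow_mul (by norm_num), mul_comm,
        Real.rpow_mul (by norm_num), Real.rpow_natCast, Real.rpow_neg (by positivity),
        ← Real.inv_rpow (by positivity)]
      calc (((2 : ℝ) ^ N)⁻¹) ^ β ≤ (2 * d) ^ β := by
            apply Real.rpow_le_rpow (by positivity) h3 hβ0.le
        _ = 2 ^ β * d ^ β := Real.mul_rpow (by norm_num) hd.le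
        _ ≤ 2 * d ^ β := by
            gcongr
            simpa using Real.rpow_le_rpow_of_exponent_le one_le_two hβ1.le
    have hsum : ∑ k ∈ Finset.range N, b k ≤ P * d ^ β * (τ - 1)⁻¹ := by
      calc ∑ k ∈ Finset.range N, b k ≤ ∑ k ∈ Finset.range N, P * τ ^ k * d :=
            Finset.sum_le_sum fun k _ => h2 k
        _ = P * d * ((τ ^ N - 1) / (τ - 1)) := by
            rw [← geom_sum_eq hτ1.ne', Finset.mul_sum]; congr 1; ext k; ring
        _ ≤ P * d * (d ^ (β - 1) / (τ - 1)) := by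
            gcongr
            linarith
        _ = P * d ^ β * (τ - 1)⁻¹ := by
            rw [Real.rpow_sub hd, Real.rpow_one]; field_simp
    have : P * θ ^ N * (1 - θ)⁻¹ ≤ P * (2 * d ^ β) * (1 - θ)⁻¹ := by gcongr
    calc _ ≤ P * d ^ β * (τ - 1)⁻¹ + P * (2 * d ^ β) * (1 - θ)⁻¹ :=
          add_le_add hsum (hN.trans this)
      _ = _ := by ring
  · obtain ⟨hs, hN⟩ := hgeo 0 b P hP hb h1
    simp only [add_zero, pow_zero, mul_one] at hN
    have h4 : (1 : ℝ) ≤ d ^ β := Real.one_le_rpow hd1 hβ0.le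
    calc _ ≤ P * (1 - θ)⁻¹ := hN
      _ ≤ ((τ - 1)⁻¹ + 2 * (1 - θ)⁻¹) * P * 1 := by
          have : 0 ≤ (τ - 1)⁻¹ * P := by positivity
          have : 0 ≤ (1 - θ)⁻¹ * P := by positivity
          linarith
      _ ≤ _ := by gcongr

variable (χ : ContDiffBump (0 : ℂ))

/-- The dyadic block of `cutoffLog`: away from the origin it is `cutoffLog z - cutoffLog (2 z)`. -/
def dyadicLog (z : ℂ) : ℝ :=
  laplacianLogMass⁻¹ * ((χ z - χ ((2 : ℝ) • z)) * Real.log ‖z‖ - χ ((2 : ℝ) • z) * Real.log 2)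

/-- Near the origin both cutoffs equal 1, so the coefficient of the logarithm vanishes and the
function is constant. -/
lemma contDiff_dyadicLog : ContDiff ℝ (⊤ : ℕ∞) (dyadicLog χ) := by
  have h2 : ContDiff ℝ (⊤ : ℕ∞) fun z : ℂ => χ ((2 : ℝ) • z) :=
    χ.contDiff.comp (contDiff_const_smul _)
  refine contDiff_const.mul (ContDiff.sub (contDiff_iff_contDiffAt.2 fun z => ?_)
    (h2.mul contDiff_const))
  by_cases hz : z = 0
  · have h3 : Tendsto (fun z : ℂ => (2 : ℝ) • z) (𝓝 0) (𝓝 0) := by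
      simpa using (continuous_const_smul (2 : ℝ)).tendsto (0 : ℂ)
    have : (fun z : ℂ => (χ z - χ ((2 : ℝ) • z)) * Real.log ‖z‖) =ᶠ[𝓝 z] fun _ => 0 := by
      rw [hz]
      filter_upwards [χ.eventuallyEq_one, h3.eventually χ.eventuallyEq_one] with y hy hy2
      rw [hy, hy2]; simp
    exact contDiffAt_const.congr_of_eventuallyEq this
  · exact (χ.contDiffAt.sub h2.contDiffAt).mul (contDiffAt_log_norm hz)

lemma dyadicLog_eq_zero {z : ℂ} (hz : χ.rOut < ‖z‖) : dyadicLog χ z = 0 := by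
  have h2 : χ.rOut ≤ dist ((2 : ℝ) • z) 0 := by
    rw [dist_zero_right, norm_smul]
    simp only [Real.norm_ofNat]; linarith [norm_nonneg z]
  rw [dyadicLog, χ.zero_of_le_dist (by simpa using hz.le), χ.zero_of_le_dist h2]
  simp

lemma hasCompactSupport_dyadicLog : HasCompactSupport (dyadicLog χ) :=
  HasCompactSupport.intro (isCompact_closedBall 0 χ.rOut) fun z hz =>
    dyadicLog_eq_zero χ (by simpa using hz)

lemma dyadicLog_eq_sub {z : ℂ} (hz : z ≠ 0) :
    dyadicLog χ z = cutoffLog χ z - cutoffLog χ ((2 : ℝ) • z) := by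
  rw [dyadicLog, cutoffLog, cutoffLog, norm_smul, Real.log_mul (by norm_num) (norm_ne_zero_iff.2 hz)]
  simp only [Real.norm_ofNat]
  ring

/-- The partial sums telescope to `cutoffLog χ z - cutoffLog χ (2 ^ n • z)`, and the last term is
zero as soon as 2 ^ n ‖z‖ reaches the outer radius. -/
lemma hasSum_dyadicLog {z : ℂ} (hz : z ≠ 0) :
    HasSum (fun k : ℕ => dyadicLog χ ((2 : ℝ) ^ k • z)) (cutoffLog χ z) := by
  have hpart : ∀ n : ℕ, ∑ k ∈ Finset.range n, dyadicLog χ ((2 : ℝ) ^ k • z)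
      = cutoffLog χ z - cutoffLog χ ((2 : ℝ) ^ n • z) := by
    intro n
    induction n with
    | zero => simp
    | succ n ih =>
      rw [Finset.sum_range_succ, ih, dyadicLog_eq_sub χ (smul_ne_zero (by positivity) hz), smul_smul,
        ← pow_succ']
      ring
  obtain ⟨N, hN⟩ := pow_unbounded_of_one_lt (χ.rOut / ‖z‖) (one_lt_two (α := ℝ))
  have hzp : 0 < ‖z‖ := norm_pos_iff.2 hz
  rw [div_lt_iff₀ hzp] at hN
  have hbig : ∀ n ≥ N, χ.rOut < ‖(2 : ℝ) ^ n • z‖ := fun n hn => by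
    rw [norm_smul, Real.norm_of_nonneg (by positivity)]
    refine hN.trans_le ?_
    gcongr
    norm_num
  have : HasSum (fun k : ℕ => dyadicLog χ ((2 : ℝ) ^ k • z))
      (∑ k ∈ Finset.range N, dyadicLog χ ((2 : ℝ) ^ k • z)) :=
    hasSum_sum_of_ne_finset_zero fun k hk => dyadicLog_eq_zero χ (hbig k (by simpa using hk))
  rwa [hpart, cutoffLog_eq_zero χ (hbig N le_rfl).le, sub_zero] at this

/-- Global Schauder estimate for the localized logarithmic potential. -/
theorem exists_holderBound_correlation_cutoffLog {β : ℝ} (hβ0 : 0 < β) (hβ1 : β < 1) :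
    ∃ C : ℝ, 0 ≤ C ∧ ∀ (g : ℂ → ℝ) (M : ℝ), Continuous g → (∀ w, |g w| ≤ M) →
      (∀ w z, |g w - g z| ≤ M * ‖w - z‖ ^ β) →
      HolderBound β (C * M) (correlation (cutoffLog χ) g) := by
  have hφ := contDiff_dyadicLog χ
  have hc := hasCompactSupport_dyadicLog χ
  obtain ⟨B, hB0, hB, hL⟩ := exists_bound_iteratedFDeriv hφ hc
  obtain ⟨C₁, hC₁, hsum⟩ := exists_tsum_le_rpow hβ0 hβ1
  set r := χ.rOut with hr
  have hr0 : 0 < r := χ.rOut_pos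
  have hsupp : ∀ z, r < ‖z‖ → dyadicLog χ z = 0 := fun z hz => dyadicLog_eq_zero χ hz
  set V := volume.real (Metric.closedBall (0 : ℂ) 1) with hV
  have hV0 : 0 ≤ V := measureReal_nonneg
  set θ : ℝ := (2 : ℝ) ^ (-β) with hθ
  set τ : ℝ := (2 : ℝ) ^ (1 - β) with hτ
  have hθ0 : 0 < θ := by positivity
  have hθ1 : θ < 1 := Real.rpow_lt_one_of_one_lt_of_neg (by norm_num) (by linarith)
  have hθhalf : (2 : ℝ)⁻¹ ≤ θ := by
    rw [hθ, Real.rpow_neg (by norm_num)]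
    gcongr
    simpa using Real.rpow_le_rpow_of_exponent_le one_le_two hβ1.le
  have hscale : ∀ k : ℕ, (r / (2 : ℝ) ^ k) ^ β = r ^ β * θ ^ k := by
    intro k
    rw [Real.div_rpow hr0.le (by positivity), div_eq_mul_inv, hθ]
    congr 1
    rw [← Real.rpow_natCast, ← Real.rpow_natCast, ← Real.rpow_mul (by norm_num),
      ← Real.rpow_mul (by norm_num), ← Real.rpow_neg (by norm_num)]
    congr 1; ring
  -- The two summands of C₂ come from the derivatives of order at most one and of order two; C₃ is
  -- the constant of the Lipschitz-type bound.
  set C₂ : ℝ := B * V * r ^ 2 + B * V * r ^ 2 * r ^ β with hC₂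
  set C₃ : ℝ := r ^ β * (B * V * (2 ^ β * (2 * r) ^ 2 + 2 * r)) with hC₃
  have hC₂0 : 0 ≤ C₂ := by positivity
  have hC₃0 : 0 ≤ C₃ := by positivity
  refine ⟨C₂ * (1 - θ)⁻¹ + C₁ * (2 * C₂ + C₃), by
    have : 0 < 1 - θ := by linarith
    positivity, fun g M hgc hM hA => ?_⟩
  have hM0 : 0 ≤ M := (abs_nonneg _).trans (hM 0)
  have hg : LocallyIntegrable g := hgc.locallyIntegrable
  set u : ℕ → ℂ → ℝ := fun k z => ∫ w, g w * dyadicLog χ ((2 : ℝ) ^ k • (z - w)) with hu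
  have hs : ∀ k : ℕ, (0 : ℝ) < 2 ^ k := fun k => by positivity
  have hucd : ∀ k, ContDiff ℝ 2 (u k) := fun k =>
    contDiff_integral_smul_comp_sub (n := 2) hg (Φ := fun t => dyadicLog χ ((2 : ℝ) ^ k • t))
      ((hφ.comp (contDiff_const_smul _)).of_le (by norm_cast)) (hc.comp_smul (hs k).ne')
  -- For m ≤ 1 scaling alone gives 2 ^ (k (m - 2)) ≤ 2 ^ (-k) ≤ θ ^ k. For m = 2 scaling gives
  -- nothing, and the factor θ ^ k = 2 ^ (-β k) comes from the cancellation.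
  have hbd : ∀ m ≤ 2, ∀ k z, ‖iteratedFDeriv ℝ m (u k) z‖ ≤ C₂ * M * θ ^ k := by
    intro m hm k z
    rcases Nat.lt_or_ge m 2 with hm2 | hm2
    · refine (norm_iteratedFDeriv_integral_comp_smul_le hφ hc hr0 hsupp (hB m hm) hg hM (hs k)
        z).trans ?_
      have h1 : ((2 : ℝ) ^ k) ^ m / ((2 : ℝ) ^ k) ^ 2 ≤ θ ^ k := by
        have h2 : (1 : ℝ) ≤ 2 ^ k := one_le_pow₀ one_le_two
        calc ((2 : ℝ) ^ k) ^ m / ((2 : ℝ) ^ k) ^ 2 ≤ ((2 : ℝ) ^ k) ^ 1 / ((2 : ℝ) ^ k) ^ 2 := by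
              gcongr
              omega
          _ = (2⁻¹ : ℝ) ^ k := by rw [inv_pow]; field_simp
          _ ≤ θ ^ k := by gcongr
      calc M * (((2 : ℝ) ^ k) ^ m * B) * (V * (r / (2 : ℝ) ^ k) ^ 2)
          = (B * V * r ^ 2) * M * (((2 : ℝ) ^ k) ^ m / ((2 : ℝ) ^ k) ^ 2) := by
            rw [div_pow]; ring
        _ ≤ C₂ * M * θ ^ k := by
            gcongr
            have : 0 ≤ B * V * r ^ 2 * r ^ β := by positivity
            linarith
    · obtain rfl : m = 2 := le_antisymm hm hm2
      refine (norm_iteratedFDeriv_two_integral_comp_smul_le hφ hc hr0 hsupp (hB 2 le_rfl) hg hβ0 hM0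
        hA (hs k) z).trans ?_
      rw [hscale]
      calc M * (r ^ β * θ ^ k) * (((2 : ℝ) ^ k) ^ 2 * B) * (V * (r / (2 : ℝ) ^ k) ^ 2)
          = (B * V * r ^ 2 * r ^ β) * M * θ ^ k := by field_simp
        _ ≤ C₂ * M * θ ^ k := by
            gcongr
            have : 0 ≤ B * V * r ^ 2 := by positivity
            linarith
  have hsummable : Summable fun k : ℕ => C₂ * M * θ ^ k :=
    (summable_geometric_of_lt_one hθ0.le hθ1).mul_left _
  -- The potential is the sum of its dyadic pieces; sum and integral are exchanged because the L¹
  -- norms are summable, and the point w = z, where the dyadic series fails, is null.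
  have heq : correlation (cutoffLog χ) g = fun z => ∑' k, u k z := by
    ext z
    have hint : ∀ k, Integrable fun w => g w * dyadicLog χ ((2 : ℝ) ^ k • (z - w)) := fun k =>
      integrable_smul_comp_sub hg (Φ := fun t => dyadicLog χ ((2 : ℝ) ^ k • t))
        (hφ.continuous.comp (continuous_const_smul _)) (hc.comp_smul (hs k).ne') z
    have hnorm : ∀ k, ∫ w, ‖g w * dyadicLog χ ((2 : ℝ) ^ k • (z - w))‖ ≤ C₂ * M * θ ^ k := by
      intro k
      have h1 := norm_integral_le_of_forall_notMem_closedBall (z := z) (ρ := r / 2 ^ k) (C := M * B)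
        (f := fun w => ‖g w * dyadicLog χ ((2 : ℝ) ^ k • (z - w))‖) (by positivity) (fun w hw => by
          rw [Metric.mem_closedBall, not_le, dist_comm, dist_eq_norm, div_lt_iff₀ (hs k)] at hw
          rw [hsupp, mul_zero, norm_zero]
          rwa [norm_smul, Real.norm_of_nonneg (hs k).le, mul_comm]) fun w _ => by
          rw [norm_norm, norm_mul, Real.norm_eq_abs]
          have hB' : ‖dyadicLog χ ((2 : ℝ) ^ k • (z - w))‖ ≤ B := by
            simpa using hB 0 (by norm_num) ((2 : ℝ) ^ k • (z - w))
          gcongr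
          exact hM w
      rw [Real.norm_of_nonneg (integral_nonneg fun w => norm_nonneg _)] at h1
      refine h1.trans ?_
      have h2 : (((2 : ℝ) ^ k) ^ 2)⁻¹ ≤ θ ^ k := by
        have h3 : (1 : ℝ) ≤ 2 ^ k := one_le_pow₀ one_le_two
        calc (((2 : ℝ) ^ k) ^ 2)⁻¹ ≤ ((2 : ℝ) ^ k)⁻¹ := by
              gcongr
              nlinarith
          _ = (2⁻¹ : ℝ) ^ k := by rw [inv_pow]
          _ ≤ θ ^ k := by gcongr
      calc M * B * (V * (r / (2 : ℝ) ^ k) ^ 2)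
          = (B * V * r ^ 2) * M * (((2 : ℝ) ^ k) ^ 2)⁻¹ := by
            rw [div_pow]; ring
        _ ≤ C₂ * M * θ ^ k := by
            gcongr
            have : 0 ≤ B * V * r ^ 2 * r ^ β := by positivity
            linarith
    have h := hasSum_integral_of_summable_integral_norm hint
      (Summable.of_nonneg_of_le (fun k => integral_nonneg fun w => norm_nonneg _) hnorm hsummable)
    rw [h.tsum_eq, correlation]
    refine integral_congr_ae ?_
    filter_upwards [Measure.ae_ne volume z] with w hw
    rw [tsum_mul_left, (hasSum_dyadicLog χ (sub_ne_zero.2 hw.symm)).tsum_eq, mul_comm,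
      ← cutoffLog_neg, neg_sub]
  have hv : ∀ k : ℕ, (k : ℕ∞) ≤ 2 → Summable ((fun _ i => C₂ * M * θ ^ i) k) := fun k _ => hsummable
  have hbd' : ∀ (k : ℕ) (i : ℕ) (x : ℂ), (k : ℕ∞) ≤ 2 →
      ‖iteratedFDeriv ℝ k (u i) x‖ ≤ (fun _ i => C₂ * M * θ ^ i) k i := fun k i x hk =>
    hbd k (by exact_mod_cast hk) i x
  have hder : ∀ m ≤ 2, ∀ z, iteratedFDeriv ℝ m (fun z => ∑' k, u k z) z
      = ∑' k, iteratedFDeriv ℝ m (u k) z := fun m hm z =>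
    iteratedFDeriv_tsum_apply (N := 2) hucd hv hbd' (by exact_mod_cast hm) z
  have hsn : ∀ m ≤ 2, ∀ z, Summable fun k => ‖iteratedFDeriv ℝ m (u k) z‖ := fun m hm z =>
    Summable.of_nonneg_of_le (fun k => norm_nonneg _) (fun k => hbd m hm k z) hsummable
  have h1θ : 0 < 1 - θ := by linarith
  rw [heq]
  refine ⟨contDiff_tsum (N := 2) hucd hv hbd', fun m hm z => ?_, fun z z' => ?_⟩
  · rw [hder m hm]
    refine (norm_tsum_le_tsum_norm (hsn m hm z)).trans
      (((hsn m hm z).tsum_le_tsum (fun k => hbd m hm k z) hsummable).trans ?_)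
    rw [tsum_mul_left, tsum_geometric_of_lt_one hθ0.le hθ1]
    have : 0 ≤ C₁ * (2 * C₂ + C₃) * M := by positivity
    linarith
  · rcases eq_or_ne z z' with rfl | hne
    · simp only [sub_self, norm_zero]
      rw [Real.zero_rpow hβ0.ne', mul_zero]
    have hd : 0 < ‖z - z'‖ := norm_pos_iff.2 (sub_ne_zero.2 hne)
    rw [hder 2 le_rfl, hder 2 le_rfl, ← (hsn 2 le_rfl z).of_norm.tsum_sub (hsn 2 le_rfl z').of_norm]
    set b : ℕ → ℝ := fun k => ‖iteratedFDeriv ℝ 2 (u k) z - iteratedFDeriv ℝ 2 (u k) z'‖ with hb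
    have hb1 : ∀ k, b k ≤ 2 * C₂ * M * θ ^ k := fun k => (norm_sub_le _ _).trans (by
      linarith [hbd 2 le_rfl k z, hbd 2 le_rfl k z'])
    have hbs : Summable b := Summable.of_nonneg_of_le (fun k => norm_nonneg _) hb1
      ((summable_geometric_of_lt_one hθ0.le hθ1).mul_left _)
    -- The oscillation of g contributes θ ^ k and the Lipschitz constant of the rescaled kernel 2 ^
    -- k; their product is τ ^ k.
    have hb2 : ∀ k, b k ≤ C₃ * M * τ ^ k * ‖z - z'‖ := by
      intro k
      refine (norm_sub_iteratedFDeriv_two_integral_comp_smul_le hφ hc hr0 hsupp (hB 2 le_rfl) hL hg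
        hβ0 hM0 hA (hs k) z z').trans_eq ?_
      rw [hscale]
      have : τ ^ k = θ ^ k * 2 ^ k := by
        rw [← mul_pow, hτ, hθ, sub_eq_add_neg, add_comm, Real.rpow_add (by norm_num), Real.rpow_one]
      rw [this, hC₃]; ring
    refine (norm_tsum_le_tsum_norm hbs).trans ?_
    have hP : 0 ≤ (2 * C₂ + C₃) * M := by positivity
    refine (hsum b ((2 * C₂ + C₃) * M) ‖z - z'‖ hd hP (fun k => norm_nonneg _) (fun k => ?_)
      fun k => ?_).trans ?_
    · refine (hb1 k).trans ?_
      gcongr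
      linarith
    · refine (hb2 k).trans ?_
      have : 0 ≤ τ := by positivity
      gcongr
      linarith
    · have : 0 ≤ C₂ * (1 - θ)⁻¹ * M * ‖z - z'‖ ^ β := by positivity
      calc C₁ * ((2 * C₂ + C₃) * M) * ‖z - z'‖ ^ β
          = C₁ * (2 * C₂ + C₃) * M * ‖z - z'‖ ^ β := by ring
        _ ≤ _ := by linarith

/-! ### Interior Schauder estimate -/

lemma holderOnWith_of_dist_le {F : Type*} [PseudoMetricSpace F] {C β : ℝ≥0} {f : ℂ → F} {K : Set ℂ}
    (h : ∀ x ∈ K, ∀ y ∈ K, dist (f x) (f y) ≤ C * dist x y ^ (β : ℝ)) : HolderOnWith C β f K := by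
  intro x hx y hy
  have h1 := h x hx y hy
  rw [edist_nndist, edist_nndist, ← ENNReal.coe_rpow_of_nonneg _ β.coe_nonneg, ← ENNReal.coe_mul,
    ENNReal.coe_le_coe, ← NNReal.coe_le_coe]
  simpa using h1

lemma mem_cthickening_iff_infDist_le {K : Set ℂ} (hK : K.Nonempty) {δ : ℝ} (hδ : 0 ≤ δ) {z : ℂ} :
    z ∈ Metric.cthickening δ K ↔ Metric.infDist z K ≤ δ :=
  ENNReal.le_ofReal_iff_toReal_le (Metric.infEDist_ne_top hK) hδ

lemma abs_sub_le_of_holderOnWith_iteratedFDeriv_zero {C β : ℝ≥0} {f : ℂ → ℝ} {K : Set ℂ}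
    (h : HolderOnWith C β (iteratedFDeriv ℝ 0 f) K) {x y : ℂ} (hx : x ∈ K) (hy : y ∈ K) :
    |f x - f y| ≤ C * ‖x - y‖ ^ (β : ℝ) := by
  have := h.dist_le hx hy
  rwa [iteratedFDeriv_zero_eq_comp, Function.comp, Function.comp, LinearIsometryEquiv.dist_map,
    Real.dist_eq, dist_eq_norm] at this

lemma HolderBound.holderOnWith {β C : ℝ≥0} {u : ℂ → ℝ} (h : HolderBound β C u) (K : Set ℂ) :
    HolderOnWith C β (iteratedFDeriv ℝ 2 u) K :=
  holderOnWith_of_dist_le fun x _ y _ => by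
    rw [dist_eq_norm, dist_eq_norm]; exact h.dist_le x y

lemma iteratedFDeriv_eqOn {v u : ℂ → ℝ} {W : Set ℂ} (hW : IsOpen W) (h : Set.EqOn v u W) (m : ℕ) :
    Set.EqOn (iteratedFDeriv ℝ m v) (iteratedFDeriv ℝ m u) W := fun _ hz =>
  ((h.eventuallyEq_of_mem (hW.mem_nhds hz)).iteratedFDeriv ℝ m).eq_of_nhds

lemma HolderBound.holderNormLE {β C ε : ℝ≥0} {u v : ℂ → ℝ} (h : HolderBound β C u) (hC : C ≤ ε)
    {K W : Set ℂ} (hW : IsOpen W) (hKW : K ⊆ W) (huv : Set.EqOn v u W) : HolderNormLE 2 β ε v K := by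
  refine ⟨fun z hz => ?_, fun m hm z hz => ?_, ?_⟩
  · exact h.contDiff.contDiffAt.congr_of_eventuallyEq
      (huv.eventuallyEq_of_mem (hW.mem_nhds (hKW hz)))
  · rw [iteratedFDeriv_eqOn hW huv m (hKW hz)]
    exact (h.norm_le m hm z).trans hC
  · intro x hx y hy
    rw [iteratedFDeriv_eqOn hW huv 2 (hKW hx), iteratedFDeriv_eqOn hW huv 2 (hKW hy)]
    refine (h.holderOnWith K x hx y hy).trans ?_
    gcongr

/-- Interior Schauder estimate for continuous solutions of the Poisson equation in the sense of
distributions. -/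
theorem exists_holderBound_of_weak_solution {β : ℝ} (hβ0 : 0 < β) (hβ1 : β < 1) {K U : Set ℂ}
    (hK : IsCompact K) (hU : IsOpen U) (hKU : K ⊆ U) :
    ∃ K' W : Set ℂ, IsCompact K' ∧ K' ⊆ U ∧ IsOpen W ∧ K ⊆ W ∧ W ⊆ K' ∧ ∃ C : ℝ, 0 ≤ C ∧
      ∀ (v f : ℂ → ℝ) (M : ℝ), 0 ≤ M → ContinuousOn v K' → ContinuousOn f K' →
      (∀ z ∈ K', |f z| ≤ M) → (∀ z ∈ K', ∀ w ∈ K', |f z - f w| ≤ M * ‖z - w‖ ^ β) →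
      (∀ ψ : ℂ → ℝ, ContDiff ℝ (⊤ : ℕ∞) ψ → HasCompactSupport ψ → tsupport ψ ⊆ K' →
        ∫ z, v z * Laplacian.laplacian ψ z = ∫ z, f z * ψ z) →
      ∃ u, HolderBound β (C * (M + ∫ z in K', |v z|)) u ∧ Set.EqOn v u W := by
  rcases K.eq_empty_or_nonempty with rfl | hne
  · refine ⟨∅, ∅, isCompact_empty, Set.empty_subset _, isOpen_empty, le_rfl, le_rfl, 0, le_rfl,
      fun v f M _ _ _ _ _ _ => ⟨fun _ => 0, ⟨contDiff_const, fun m _ z => ?_, fun z z' => ?_⟩, ?_⟩⟩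
    · rw [zero_mul, show (fun _ : ℂ => (0 : ℝ)) = 0 from rfl, iteratedFDeriv_zero]; simp
    · simp
    · exact Set.eqOn_empty _ _
  obtain ⟨δ, hδ, hδU⟩ := hK.exists_cthickening_subset_open hU hKU
  -- Nested neighbourhoods of K of radii δ / 4, δ / 2 and δ. The kernels have radius δ / 4, so from
  -- W they do not reach beyond U'; the cutoff is 1 on K₁ and vanishes off K'.
  set K' := Metric.cthickening δ K with hK'
  set K₁ := Metric.cthickening (δ / 2) K with hK₁
  set U' := Metric.thickening (δ / 2) K with hU'
  set W := Metric.thickening (δ / 4) K with hW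
  have hK'c : IsCompact K' := hK.cthickening
  have hK₁K' : K₁ ⊆ K' := Metric.cthickening_mono (by linarith) K
  have hU'K₁ : U' ⊆ K₁ := Metric.thickening_subset_cthickening _ _
  have hWU' : W ⊆ U' := Metric.thickening_mono (by linarith) K
  let χ : ContDiffBump (0 : ℂ) := ⟨δ / 8, δ / 4, by positivity, by linarith⟩
  obtain ⟨C₁, hC₁, h₁⟩ := exists_holderBound_correlation_cutoffLog χ hβ0 hβ1
  obtain ⟨C₂, hC₂, h₂⟩ := exists_holderBound_integral_mul_comp_sub hβ0 hβ1
    (φ := fun t => cutoffLogError χ (-t)) ((contDiff_cutoffLogError χ).comp contDiff_neg)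
    ((hasCompactSupport_cutoffLogError χ).comp_homeomorph (Homeomorph.neg ℂ))
  -- A Lipschitz cutoff is enough: it multiplies only the right-hand side, which needs no more than
  -- a Hölder bound.
  set ζ : ℂ → ℝ := fun z => max 0 (1 - 2 / δ * Metric.infDist z K₁) with hζ
  have hK₁ne : K₁.Nonempty := hne.mono (Metric.self_subset_cthickening _)
  have hζ0 : ∀ z, 0 ≤ ζ z := fun z => le_max_left _ _
  have hζ1 : ∀ z, ζ z ≤ 1 := fun z => max_le zero_le_one (by
    have : 0 ≤ 2 / δ * Metric.infDist z K₁ := mul_nonneg (by positivity) Metric.infDist_nonneg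
    linarith)
  have hζK₁ : ∀ z ∈ K₁, ζ z = 1 := fun z hz => by
    simp [hζ, Metric.infDist_zero_of_mem hz]
  have hζout : ∀ z, z ∉ K' → ζ z = 0 := fun z hz => by
    refine max_eq_left ?_
    by_contra hcon
    push Not at hcon
    refine hz ?_
    have h3 : Metric.infDist z K₁ < δ / 2 := by
      have : 2 / δ * Metric.infDist z K₁ < 1 := by linarith
      rw [div_mul_eq_mul_div, div_lt_one hδ] at this
      linarith
    obtain ⟨y, hy, hzy⟩ := (Metric.infDist_lt_iff hK₁ne).1 h3
    have h4 := Metric.infDist_le_infDist_add_dist (s := K) (x := z) (y := y)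
    have h5 : Metric.infDist y K ≤ δ / 2 := (mem_cthickening_iff_infDist_le hne (by positivity)).1 hy
    exact (mem_cthickening_iff_infDist_le hne hδ.le).2 (by linarith)
  have hζlip : ∀ z w, |ζ z - ζ w| ≤ (1 + 2 / δ) * ‖z - w‖ ^ β := by
    intro z w
    have h3 : |ζ z - ζ w| ≤ 2 / δ * ‖z - w‖ := by
      refine (abs_max_sub_max_le_max 0 _ 0 _).trans (max_le (by simp; positivity) ?_)
      rw [sub_sub_sub_cancel_left, ← mul_sub, abs_mul, abs_of_pos (by positivity : 0 < 2 / δ)]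
      gcongr
      have := (Metric.lipschitz_infDist_pt K₁).dist_le_mul z w
      rw [dist_eq_norm z w] at this
      rw [abs_sub_comm]
      simpa [Real.dist_eq] using this
    have hδ2 : 0 < 2 / δ := by positivity
    rcases le_total ‖z - w‖ 1 with h | h
    · have : ‖z - w‖ ≤ ‖z - w‖ ^ β := by
        rcases (norm_nonneg (z - w)).eq_or_lt with h0 | h0
        · rw [← h0, Real.zero_rpow hβ0.ne']
        · simpa using Real.rpow_le_rpow_of_exponent_ge h0 h hβ1.le
      nlinarith [norm_nonneg (z - w)]
    · have h1 : (1 : ℝ) ≤ ‖z - w‖ ^ β := Real.one_le_rpow h hβ0.le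
      have : |ζ z - ζ w| ≤ 1 := abs_sub_le_of_nonneg_of_le (hζ0 z) (hζ1 z) (hζ0 w) (hζ1 w)
      nlinarith
  refine ⟨K', W, hK'c, hδU, Metric.isOpen_thickening, Metric.self_subset_thickening (by positivity) K,
    (hWU'.trans hU'K₁).trans hK₁K', C₁ * (2 + 2 / δ) + C₂, by positivity,
    fun v f M hM0 hv hf hM hA hweak => ?_⟩
  set f' : ℂ → ℝ := fun z => ζ z * f z with hf'
  set v' : ℂ → ℝ := K'.indicator v with hv'
  have hδ2 : 0 < 2 / δ := by positivity
  have hf'M : ∀ w, |f' w| ≤ (2 + 2 / δ) * M := fun w => by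
    by_cases hw : w ∈ K'
    · rw [hf', abs_mul, abs_of_nonneg (hζ0 w)]
      have := hM w hw
      have := hζ1 w
      have := hζ0 w
      nlinarith [abs_nonneg (f w), mul_nonneg hδ2.le hM0]
    · simp only [hf', hζout w hw, zero_mul, abs_zero]
      positivity
  have hf'A : ∀ w z, |f' w - f' z| ≤ (2 + 2 / δ) * M * ‖w - z‖ ^ β := by
    have aux : ∀ w ∈ K', ∀ z, |f' w - f' z| ≤ (2 + 2 / δ) * M * ‖w - z‖ ^ β := by
      intro w hw z
      have hp : 0 ≤ ‖w - z‖ ^ β := by positivity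
      by_cases hz : z ∈ K'
      · have e : f' w - f' z = ζ z * (f w - f z) + (ζ w - ζ z) * f w := by simp only [hf']; ring
        rw [e]
        refine (abs_add_le _ _).trans ?_
        rw [abs_mul, abs_mul, abs_of_nonneg (hζ0 z)]
        have h3 : ζ z * |f w - f z| ≤ 1 * (M * ‖w - z‖ ^ β) :=
          mul_le_mul (hζ1 z) (hA w hw z hz) (abs_nonneg _) zero_le_one
        have h4 : |ζ w - ζ z| * |f w| ≤ ((1 + 2 / δ) * ‖w - z‖ ^ β) * M :=
          mul_le_mul (hζlip w z) (hM w hw) (abs_nonneg _) (by positivity)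
        linarith
      · have e : f' w - f' z = (ζ w - ζ z) * f w := by simp only [hf', hζout z hz]; ring
        rw [e, abs_mul]
        have h4 : |ζ w - ζ z| * |f w| ≤ ((1 + 2 / δ) * ‖w - z‖ ^ β) * M :=
          mul_le_mul (hζlip w z) (hM w hw) (abs_nonneg _) (by positivity)
        have : 0 ≤ M * ‖w - z‖ ^ β := by positivity
        linarith
    intro w z
    by_cases hw : w ∈ K'
    · exact aux w hw z
    by_cases hz : z ∈ K'
    · rw [abs_sub_comm, norm_sub_rev]; exact aux z hz w
    · simp only [hf', hζout w hw, hζout z hz, zero_mul, sub_self, abs_zero]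
      positivity
  have hf'c : Continuous f' := by
    have hH : HolderWith (⟨(2 + 2 / δ) * M, by positivity⟩ : ℝ≥0) ⟨β, hβ0.le⟩ f' :=
      holderOnWith_univ.1 (holderOnWith_of_dist_le fun x _ y _ => by
        rw [Real.dist_eq, dist_eq_norm]; exact hf'A x y)
    exact hH.continuous hβ0
  have hf'i : Integrable f' := by
    refine hf'c.integrable_of_hasCompactSupport (HasCompactSupport.intro hK'c fun z hz => ?_)
    simp only [hf', hζout z hz, zero_mul]
  have hv'i : Integrable v' :=
    (integrable_indicator_iff hK'c.measurableSet).2 (hv.integrableOn_compact hK'c)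
  -- There is no point mass, so c = 0 and the pole q is a dummy value. Replacing v by v' and f by f'
  -- does not affect test functions supported in U'.
  have hrep := ae_eq_cutoffLog_representation χ (U := U') (V := W) Metric.isOpen_thickening
    (fun z hz y hy => by
      have hz' := (Metric.mem_thickening_iff_infDist_lt hne).1 hz
      refine (Metric.mem_thickening_iff_infDist_lt hne).2 ?_
      have h4 := Metric.infDist_le_infDist_add_dist (s := K) (x := y) (y := z)
      have h5 : dist y z ≤ δ / 4 := hy
      linarith) hv'i hf'i (c := 0) (q := 0) (fun ψ hψ hc hs => by
      have hs' : tsupport ψ ⊆ K' := (hs.trans hU'K₁).trans hK₁K'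
      rw [zero_mul, zero_add]
      have e1 : (fun z => v' z * Laplacian.laplacian ψ z)
          = fun z => v z * Laplacian.laplacian ψ z := by
        ext z
        by_cases hz : z ∈ K'
        · simp [hv', hz]
        · rw [image_eq_zero_of_notMem_tsupport fun h => hz (hs' (laplacian_tsupport_subset ψ h))]
          simp
      have e2 : (fun z => f' z * ψ z) = fun z => f z * ψ z := by
        ext z
        by_cases hz : z ∈ tsupport ψ
        · simp only [hf', hζK₁ z (hU'K₁ (hs hz)), one_mul]
        · rw [image_eq_zero_of_notMem_tsupport hz]; simp
      rw [e1, e2]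
      exact hweak ψ hψ hc hs')
  have hB₁ := h₁ f' _ hf'c hf'M hf'A
  have hB₂ := (h₂ v' hv'i).neg
  have hu := hB₁.add hB₂
  have e3 : ∀ z, ∫ w, v' w * cutoffLogError χ (-(z - w)) = correlation (cutoffLogError χ) v' z :=
    fun z => by rw [correlation]; congr 1; ext w; rw [neg_sub, mul_comm]
  have e4 : ∫ w, |v' w| = ∫ z in K', |v z| := by
    rw [← integral_indicator hK'c.measurableSet]
    congr 1; ext w
    rw [hv', ← Real.norm_eq_abs, norm_indicator_eq_indicator_norm]; rfl
  refine ⟨_, ⟨hu.contDiff, fun m hm z => (hu.norm_le m hm z).trans ?_,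
    fun z z' => (hu.dist_le z z').trans ?_⟩, ?_⟩
  · have h0 : 0 ≤ ∫ z in K', |v z| := integral_nonneg fun _ => abs_nonneg _
    rw [e4]
    nlinarith [mul_nonneg hC₂ hM0, mul_nonneg (mul_nonneg hC₁ (by positivity : 0 ≤ 2 + 2 / δ)) h0]
  · have h0 : 0 ≤ ∫ z in K', |v z| := integral_nonneg fun _ => abs_nonneg _
    refine mul_le_mul_of_nonneg_right ?_ (by positivity)
    rw [e4]
    nlinarith [mul_nonneg hC₂ hM0, mul_nonneg (mul_nonneg hC₁ (by positivity : 0 ≤ 2 + 2 / δ)) h0]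
  -- Both sides are continuous on the open set W, so almost everywhere equality holds everywhere.
  · refine Measure.eqOn_open_of_ae_eq (μ := volume) ?_ Metric.isOpen_thickening
      (hv.mono ((hWU'.trans hU'K₁).trans hK₁K')) hu.contDiff.continuous.continuousOn
    refine (ae_restrict_iff' Metric.isOpen_thickening.measurableSet).2 ?_
    filter_upwards [hrep] with z hz hzW
    have := hz hzW
    rw [zero_mul, zero_add] at this
    rw [e3, ← sub_eq_add_neg, ← this, hv',
      Set.indicator_of_mem (((hWU'.trans hU'K₁).trans hK₁K') hzW)]

/-! ### The measure of a positive form -/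

section surface

variable {X : Type*} [TopologicalSpace X] [ChartedSpace ℂ X]

/-- A positive `2`-form with continuous coefficients. -/
def IsPosForm (η : RealTwoForm X) : Prop :=
  ∀ e ∈ atlas ℂ X, (∀ z ∈ e.target, 0 < η.coeff e z) ∧ ContinuousOn (η.coeff e) e.target

lemma IsKahlerForm.isPosForm {β : ℝ≥0} {η : RealTwoForm X} (h : IsKahlerForm β η) : IsPosForm η :=
  fun e he => ⟨(h e he).1, (h e he).2.1.continuousOn⟩

lemma isOpen_overlap (e e' : OpenPartialHomeomorph X ℂ) :
    IsOpen (e.target ∩ e.symm ⁻¹' e'.source) :=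
  e.isOpen_inter_preimage_symm e'.open_source

lemma differentiableOn_transition [IsManifold (modelWithCornersSelf ℂ ℂ) 1 X]
    {e e' : OpenPartialHomeomorph X ℂ} (he : e ∈ atlas ℂ X)
    (he' : e' ∈ atlas ℂ X) :
    DifferentiableOn ℂ (fun z => e' (e.symm z)) (e.target ∩ e.symm ⁻¹' e'.source) := by
  have h := HasGroupoid.compatible (G := contDiffGroupoid 1 (modelWithCornersSelf ℂ ℂ)) he he'
  rw [contDiffGroupoid, mem_groupoid_of_pregroupoid, contDiffPregroupoid] at h
  have h2 : ContDiffOn ℂ 1 (fun z => e' (e.symm z)) (e.target ∩ e.symm ⁻¹' e'.source) := by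
    simpa [Function.comp_def] using h.1
  exact h2.differentiableOn (by norm_num)

lemma abs_det_toSpanSingleton (c : ℂ) :
    |((ContinuousLinearMap.toSpanSingleton ℂ c).restrictScalars ℝ).det| = ‖c‖ ^ 2 := by
  have h1 : ((ContinuousLinearMap.toSpanSingleton ℂ c).restrictScalars ℝ : ℂ →ₗ[ℝ] ℂ)
      = (LinearMap.toSpanSingleton ℂ ℂ c).restrictScalars ℝ := rfl
  rw [ContinuousLinearMap.det, h1, LinearMap.det_restrictScalars, Algebra.norm_complex_apply,
    LinearMap.det_ring, LinearMap.toSpanSingleton_apply, one_smul, Complex.normSq_eq_norm_sq,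
    abs_of_nonneg (sq_nonneg _)]

variable [IsManifold (modelWithCornersSelf ℂ ℂ) 1 X] [MeasurableSpace X] [BorelSpace X]

/-- The measure defined by a `2`-form in a chart. -/
def RealTwoForm.chartMeasure (η : RealTwoForm X) (e : OpenPartialHomeomorph X ℂ) : Measure X :=
  (((volume : Measure ℂ).restrict e.target).withDensity
      (fun z => ENNReal.ofReal (η.coeff e z))).map e.symm

lemma aemeasurable_chart_symm (e : OpenPartialHomeomorph X ℂ) :
    AEMeasurable e.symm ((volume : Measure ℂ).restrict e.target) :=
  e.continuousOn_symm.aemeasurable e.open_target.measurableSet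

lemma measurableSet_chart_preimage (e : OpenPartialHomeomorph X ℂ) {A : Set X}
    (hA : MeasurableSet A) : MeasurableSet (e.symm ⁻¹' A ∩ e.target) := by
  have h1 : Measurable (e.target.domRestrict e.symm) :=
    (continuousOn_iff_continuous_domRestrict.1 e.continuousOn_symm).measurable
  have h2 := e.open_target.measurableSet.subtype_image (h1 hA)
  convert h2 using 1
  ext z
  simp [and_comm, Set.domRestrict]

lemma RealTwoForm.chartMeasure_apply (η : RealTwoForm X) (e : OpenPartialHomeomorph X ℂ) {A : Set X}
    (hA : MeasurableSet A) :
    η.chartMeasure e A = ∫⁻ z in e.symm ⁻¹' A ∩ e.target, ENNReal.ofReal (η.coeff e z) := by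
  rw [chartMeasure, Measure.map_apply_of_aemeasurable
    ((aemeasurable_chart_symm e).mono_ac (withDensity_absolutelyContinuous _ _)) hA,
    withDensity_apply', Measure.restrict_restrict' e.open_target.measurableSet]

/-- The change of variables formula: the factor |τ'|² in the transformation rule of the coefficients
is exactly the real Jacobian of the holomorphic transition map. -/
lemma RealTwoForm.chartMeasure_eq_of_subset (η : RealTwoForm X) {e e' : OpenPartialHomeomorph X ℂ}
    (he : e ∈ atlas ℂ X) (he' : e' ∈ atlas ℂ X) {A : Set X} (hA : MeasurableSet A)
    (hAe : A ⊆ e.source) (hAe' : A ⊆ e'.source) : η.chartMeasure e A = η.chartMeasure e' A := by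
  rw [η.chartMeasure_apply e hA, η.chartMeasure_apply e' hA]
  have himg : e'.symm ⁻¹' A ∩ e'.target = (fun z => e' (e.symm z)) '' (e.symm ⁻¹' A ∩ e.target) := by
    ext w
    constructor
    · rintro ⟨hw, hwt⟩
      have hs : e'.symm w ∈ e.source := hAe hw
      refine ⟨e (e'.symm w), ⟨?_, e.map_source hs⟩, ?_⟩
      · simpa [e.left_inv hs] using hw
      · simp only [e.left_inv hs, e'.right_inv hwt]
    · rintro ⟨z, ⟨hz, hzt⟩, rfl⟩
      refine ⟨?_, e'.map_source (hAe' hz)⟩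
      simpa [e'.left_inv (hAe' hz)] using hz
  have hsub : e.symm ⁻¹' A ∩ e.target ⊆ e.target ∩ e.symm ⁻¹' e'.source := fun z hz =>
    ⟨hz.2, hAe' hz.1⟩
  have hd : ∀ z ∈ e.symm ⁻¹' A ∩ e.target, HasFDerivWithinAt (fun z => e' (e.symm z))
      ((ContinuousLinearMap.toSpanSingleton ℂ (deriv (fun z => e' (e.symm z)) z)).restrictScalars ℝ)
      (e.symm ⁻¹' A ∩ e.target) z := fun z hz => by
    have h1 := (differentiableOn_transition he he').differentiableAt
      ((isOpen_overlap e e').mem_nhds (hsub hz))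
    exact (h1.hasDerivAt.hasFDerivAt.restrictScalars ℝ).hasFDerivWithinAt
  have hinj : Set.InjOn (fun z => e' (e.symm z)) (e.symm ⁻¹' A ∩ e.target) := by
    intro z hz w hw hzw
    have := e'.injOn (hAe' hz.1) (hAe' hw.1) hzw
    exact e.symm.injOn hz.2 hw.2 this
  rw [himg, lintegral_image_eq_lintegral_abs_det_fderiv_mul volume
    (measurableSet_chart_preimage e hA) hd hinj]
  refine setLIntegral_congr_fun (measurableSet_chart_preimage e hA) fun z hz => ?_
  rw [abs_det_toSpanSingleton, η.coeff_change e he e' he' z hz.2 (hAe' hz.1), mul_comm, ENNReal.ofReal_mul (by positivity)]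

/-- On the domain of a chart, the measure of a form is the one computed in the chart. -/
theorem RealTwoForm.measure_restrict_source (η : RealTwoForm X) {e : OpenPartialHomeomorph X ℂ}
    (he : e ∈ atlas ℂ X) : η.measure.restrict e.source = η.chartMeasure e := by
  have hm : MeasurableSet e.source := e.open_source.measurableSet
  have hle : ∀ e' ∈ atlas ℂ X, η.chartMeasure e' ≤ η.measure := fun e' he' =>
    le_iSup₂_of_le e' he' le_rfl
  have h0 : ∀ e' : OpenPartialHomeomorph X ℂ, ∀ A, MeasurableSet A → A ∩ e'.source = ∅ →
      η.chartMeasure e' A = 0 := by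
    intro e' A hA h
    rw [η.chartMeasure_apply e' hA]
    have : e'.symm ⁻¹' A ∩ e'.target = ∅ := by
      ext z
      simp only [Set.mem_inter_iff, Set.mem_preimage, Set.mem_empty_iff_false, iff_false, not_and]
      intro hz hzt
      have : e'.symm z ∈ A ∩ e'.source := ⟨hz, e'.map_target hzt⟩
      simp [h] at this
    simp [this]
  -- To bound the supremum from above, it suffices to find one measure dominating every chart
  -- measure. Inside the domain of e the chart measures are compared by the change of variables, and
  -- outside it the full measure is kept.
  have hub : η.measure ≤ η.chartMeasure e + η.measure.restrict e.sourceᶜ := by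
    refine iSup₂_le fun e' he' => ?_
    refine Measure.le_iff.2 fun A hA => ?_
    change η.chartMeasure e' A ≤ _
    rw [Measure.add_apply, Measure.restrict_apply hA,
      ← measure_inter_add_sdiff A hm]
    refine add_le_add ?_ (hle e' he' _)
    have hs' : MeasurableSet e'.source := e'.open_source.measurableSet
    rw [← measure_inter_add_sdiff (A ∩ e.source) hs',
      h0 e' ((A ∩ e.source) \ e'.source) ((hA.inter hm).diff hs') (by ext; simp), add_zero,
      ← η.chartMeasure_eq_of_subset he he' ((hA.inter hm).inter hs')
        (fun x hx => hx.1.2) (fun x hx => hx.2)]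
    exact measure_mono fun x hx => hx.1.1
  refine Measure.ext fun A hA => ?_
  rw [Measure.restrict_apply hA]
  refine le_antisymm ?_ ?_
  · refine (hub _).trans ?_
    rw [Measure.add_apply, Measure.restrict_apply (hA.inter hm)]
    have : A ∩ e.source ∩ e.sourceᶜ = ∅ := by ext; simp
    rw [this, measure_empty, add_zero]
    exact measure_mono Set.inter_subset_left
  · rw [← measure_inter_add_sdiff A hm, h0 e (A \ e.source) (hA.diff hm) (by ext; simp), add_zero]
    exact hle e he _

end surface

section surface

variable {X : Type*} [TopologicalSpace X] [ChartedSpace ℂ X]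
  [IsManifold (modelWithCornersSelf ℂ ℂ) 1 X] [MeasurableSpace X] [BorelSpace X]
  {η : RealTwoForm X} {e : OpenPartialHomeomorph X ℂ}

/-- The measure defined by a `2`-form on the image of a chart. -/
def RealTwoForm.planeMeasure (η : RealTwoForm X) (e : OpenPartialHomeomorph X ℂ) : Measure ℂ :=
  ((volume : Measure ℂ).restrict e.target).withDensity (fun z => ENNReal.ofReal (η.coeff e z))

lemma RealTwoForm.planeMeasure_ac (η : RealTwoForm X) (e : OpenPartialHomeomorph X ℂ) :
    η.planeMeasure e ≪ (volume : Measure ℂ).restrict e.target :=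
  withDensity_absolutelyContinuous _ _

lemma RealTwoForm.measure_restrict_eq_map (η : RealTwoForm X) (he : e ∈ atlas ℂ X) :
    η.measure.restrict e.source = (η.planeMeasure e).map e.symm :=
  η.measure_restrict_source he

lemma RealTwoForm.aemeasurable_symm (η : RealTwoForm X) (e : OpenPartialHomeomorph X ℂ) :
    AEMeasurable e.symm (η.planeMeasure e) :=
  (aemeasurable_chart_symm e).mono_ac (η.planeMeasure_ac e)

lemma RealTwoForm.map_restrict_eq_planeMeasure (η : RealTwoForm X) (he : e ∈ atlas ℂ X) :
    (η.measure.restrict e.source).map e = η.planeMeasure e := by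
  have h1 : AEMeasurable e (η.measure.restrict e.source) :=
    e.continuousOn.aemeasurable e.open_source.measurableSet
  rw [η.measure_restrict_eq_map he] at h1 ⊢
  rw [AEMeasurable.map_map_of_aemeasurable h1 (η.aemeasurable_symm e)]
  have : (e ∘ e.symm) =ᵐ[η.planeMeasure e] id := by
    refine (η.planeMeasure_ac e).ae_le ?_
    filter_upwards [ae_restrict_mem e.open_target.measurableSet] with z hz
    exact e.right_inv hz
  rw [Measure.map_congr this, Measure.map_id]

lemma IsPosForm.aemeasurable_coeff (hη : IsPosForm η) (he : e ∈ atlas ℂ X) :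
    AEMeasurable (fun z => ENNReal.ofReal (η.coeff e z)) ((volume : Measure ℂ).restrict e.target) :=
  ((hη e he).2.aemeasurable e.open_target.measurableSet).ennreal_ofReal

lemma RealTwoForm.ae_measure (η : RealTwoForm X) (he : e ∈ atlas ℂ X) {p : ℂ → Prop}
    (h : ∀ᵐ z, z ∈ e.target → p z) : ∀ᵐ x ∂η.measure, x ∈ e.source → p (e x) := by
  refine (ae_restrict_iff' e.open_source.measurableSet).1 ?_
  have h1 : AEMeasurable e (η.measure.restrict e.source) :=
    e.continuousOn.aemeasurable e.open_source.measurableSet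
  refine ae_of_ae_map h1 ?_
  rw [η.map_restrict_eq_planeMeasure he]
  exact (η.planeMeasure_ac e).ae_le ((ae_restrict_iff' e.open_target.measurableSet).2 h)

/-- Positivity of the coefficient makes Lebesgue measure on the chart absolutely continuous with
respect to η, the converse of the previous direction. -/
lemma IsPosForm.ae_volume (hη : IsPosForm η) (he : e ∈ atlas ℂ X) {p : X → Prop}
    (h : ∀ᵐ x ∂η.measure, x ∈ e.source → p x) : ∀ᵐ z, z ∈ e.target → p (e.symm z) := by
  have h1 : ∀ᵐ x ∂(η.planeMeasure e).map e.symm, p x := by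
    rw [← η.measure_restrict_eq_map he]
    exact (ae_restrict_iff' e.open_source.measurableSet).2 h
  have h2 := ae_of_ae_map (η.aemeasurable_symm e) h1
  rw [RealTwoForm.planeMeasure, ae_withDensity_iff' (hη.aemeasurable_coeff he),
    ae_restrict_iff' e.open_target.measurableSet] at h2
  filter_upwards [h2] with z hz hzt
  refine hz hzt ?_
  simpa using (hη e he).1 z hzt

lemma IsPosForm.setIntegral_source (hη : IsPosForm η) (he : e ∈ atlas ℂ X) {F : X → ℝ}
    (hF : AEStronglyMeasurable F η.measure) :
    ∫ x in e.source, F x ∂η.measure = ∫ z in e.target, F (e.symm z) * η.coeff e z := by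
  have hF' := hF.restrict (s := e.source)
  rw [η.measure_restrict_eq_map he] at hF' ⊢
  rw [integral_map (η.aemeasurable_symm e) hF', RealTwoForm.planeMeasure,
    integral_withDensity_eq_integral_toReal_smul₀ (hη.aemeasurable_coeff he) (by simp)]
  refine setIntegral_congr_fun e.open_target.measurableSet fun z hz => ?_
  simp only [smul_eq_mul]
  rw [ENNReal.toReal_ofReal ((hη e he).1 z hz).le, mul_comm]

lemma IsPosForm.integrableOn_target (hη : IsPosForm η) (he : e ∈ atlas ℂ X) {F : X → ℝ}
    (hF : Integrable F η.measure) :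
    IntegrableOn (fun z => F (e.symm z) * η.coeff e z) e.target := by
  have hF' : Integrable F (η.measure.restrict e.source) := hF.restrict
  rw [η.measure_restrict_eq_map he] at hF'
  rw [integrable_map_measure hF'.aestronglyMeasurable (η.aemeasurable_symm e),
    RealTwoForm.planeMeasure, integrable_withDensity_iff_integrable_smul₀'
      (hη.aemeasurable_coeff he) (by simp)] at hF'
  refine (integrableOn_congr_fun (fun z hz => ?_) e.open_target.measurableSet).1 hF'
  simp only [smul_eq_mul, Function.comp]
  rw [ENNReal.toReal_ofReal ((hη e he).1 z hz).le, mul_comm]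

lemma RealTwoForm.measure_apply_of_subset (η : RealTwoForm X) (he : e ∈ atlas ℂ X) {A : Set X}
    (hA : MeasurableSet A) (hAe : A ⊆ e.source) :
    η.measure A = ∫⁻ z in e.symm ⁻¹' A ∩ e.target, ENNReal.ofReal (η.coeff e z) := by
  rw [← η.chartMeasure_apply e hA, ← η.measure_restrict_source he, Measure.restrict_apply hA,
    Set.inter_eq_left.2 hAe]

lemma IsPosForm.isFiniteMeasure [CompactSpace X] [T2Space X] (hη : IsPosForm η) :
    IsFiniteMeasure η.measure := by
  refine ⟨?_⟩
  refine IsCompact.measure_lt_top_of_nhdsWithin isCompact_univ fun x _ => ?_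
  have he := chart_mem_atlas ℂ x
  set e := chartAt ℂ x with hee
  have hx : x ∈ e.source := mem_chart_source ℂ x
  obtain ⟨r, hr, hrt⟩ := Metric.nhds_basis_closedBall.mem_iff.1
    (e.open_target.mem_nhds (e.map_source hx))
  have hcomp : IsCompact (e.symm '' Metric.closedBall (e x) r) :=
    (isCompact_closedBall _ _).image_of_continuousOn (e.continuousOn_symm.mono hrt)
  refine ⟨e.symm '' Metric.closedBall (e x) r, ?_, ?_⟩
  · rw [nhdsWithin_univ]
    have h1 : e.source ∩ e ⁻¹' Metric.ball (e x) r ∈ 𝓝 x :=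
      (e.isOpen_inter_preimage Metric.isOpen_ball).mem_nhds ⟨hx, Metric.mem_ball_self hr⟩
    filter_upwards [h1] with y hy
    exact ⟨e y, Metric.ball_subset_closedBall hy.2, e.left_inv hy.1⟩
  · have hsub : e.symm '' Metric.closedBall (e x) r ⊆ e.source := by
      rintro _ ⟨z, hz, rfl⟩; exact e.map_target (hrt hz)
    rw [η.measure_apply_of_subset he hcomp.isClosed.measurableSet hsub]
    have hset : e.symm ⁻¹' (e.symm '' Metric.closedBall (e x) r) ∩ e.target
        ⊆ Metric.closedBall (e x) r := by
      rintro z ⟨⟨w, hw, hwz⟩, hz⟩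
      rwa [← e.symm.injOn (hrt hw) hz hwz]
    refine (lintegral_mono_set hset).trans_lt ?_
    have hi : IntegrableOn (η.coeff e) (Metric.closedBall (e x) r) :=
      ((hη e he).2.mono hrt).integrableOn_compact (isCompact_closedBall _ _)
    refine lt_of_le_of_lt ?_ hi.2
    exact lintegral_mono fun z => Real.ofReal_le_enorm _

lemma IsPosForm.isOpenPosMeasure (hη : IsPosForm η) : η.measure.IsOpenPosMeasure := by
  refine ⟨fun U hU hne h0 => ?_⟩
  obtain ⟨x, hxU⟩ := hne
  have he := chart_mem_atlas ℂ x
  set e := chartAt ℂ x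
  have hx : x ∈ e.source := mem_chart_source ℂ x
  have h1 : ∀ᵐ y ∂η.measure, y ∈ e.source → y ∉ U := by
    have : ∀ᵐ y ∂η.measure, y ∉ U := measure_eq_zero_iff_ae_notMem.1 h0
    filter_upwards [this] with y hy _ using hy
  have h2 := hη.ae_volume he h1
  have hO : IsOpen (e.target ∩ e.symm ⁻¹' U) := e.isOpen_inter_preimage_symm hU
  have hpos : 0 < volume (e.target ∩ e.symm ⁻¹' U) :=
    hO.measure_pos volume ⟨e x, e.map_source hx, by simpa [e.left_inv hx] using hxU⟩
  refine hpos.ne' (measure_eq_zero_iff_ae_notMem.2 ?_)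
  filter_upwards [h2] with z hz hzO
  exact hz hzO.1 hzO.2

/-- On a compact part of a chart the coefficient is bounded away from zero. This carries L¹
smallness on the surface over to the L¹ norm that enters the planar Schauder estimate. -/
lemma IsPosForm.exists_setIntegral_le (hη : IsPosForm η) (he : e ∈ atlas ℂ X) {B : Set ℂ}
    (hB : IsCompact B) (hBt : B ⊆ e.target) :
    ∃ C : ℝ, 0 ≤ C ∧ ∀ w : X → ℝ, Integrable w η.measure →
      IntegrableOn (fun z => w (e.symm z)) B ∧
      ∫ z in B, |w (e.symm z)| ≤ C * ∫ x, |w x| ∂η.measure := by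
  have hc : ContinuousOn (fun z => (η.coeff e z)⁻¹) B :=
    ((hη e he).2.mono hBt).inv₀ fun z hz => ((hη e he).1 z (hBt hz)).ne'
  obtain ⟨C, hC⟩ := hB.exists_bound_of_continuousOn hc
  refine ⟨max C 0, le_max_right _ _, fun w hw => ?_⟩
  have hi := (hη.integrableOn_target he hw).mono_set hBt
  have e1 : Set.EqOn (fun z => (η.coeff e z)⁻¹ * (w (e.symm z) * η.coeff e z))
      (fun z => w (e.symm z)) B := fun z hz => by
    have := ((hη e he).1 z (hBt hz)).ne'
    simp only; field_simp
  have hwi : IntegrableOn (fun z => w (e.symm z)) B := by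
    refine (integrableOn_congr_fun e1 hB.measurableSet).1 ?_
    refine Integrable.bdd_mul (c := max C 0) hi (hc.aestronglyMeasurable hB.measurableSet) ?_
    filter_upwards [ae_restrict_mem hB.measurableSet] with z hz
    exact (hC z hz).trans (le_max_left _ _)
  refine ⟨hwi, ?_⟩
  have h2 := hη.setIntegral_source he hw.abs.aestronglyMeasurable
  have hi2 := hη.integrableOn_target he hw.abs
  calc ∫ z in B, |w (e.symm z)|
      ≤ ∫ z in B, max C 0 * (|w (e.symm z)| * η.coeff e z) := by
        refine setIntegral_mono_on hwi.abs ((hi2.mono_set hBt).const_mul _) hB.measurableSet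
          fun z hz => ?_
        have hp := (hη e he).1 z (hBt hz)
        have h3 := (hC z hz).trans (le_max_left C 0)
        rw [Real.norm_of_nonneg (by positivity)] at h3
        calc |w (e.symm z)| = (η.coeff e z)⁻¹ * (|w (e.symm z)| * η.coeff e z) := by field_simp
          _ ≤ _ := by gcongr
    _ = max C 0 * ∫ z in B, |w (e.symm z)| * η.coeff e z := integral_const_mul _ _
    _ ≤ max C 0 * ∫ z in e.target, |w (e.symm z)| * η.coeff e z := by
        refine mul_le_mul_of_nonneg_left ?_ (le_max_right _ _)
        refine setIntegral_mono_set hi2 ?_ hBt.eventuallyLE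
        filter_upwards [ae_restrict_mem e.open_target.measurableSet] with z hz
        exact mul_nonneg (abs_nonneg _) ((hη e he).1 z hz).le
    _ ≤ _ := by
        gcongr
        rw [← h2]
        exact setIntegral_le_integral hw.abs (Eventually.of_forall fun x => abs_nonneg _)

/-- Extension by zero of a function on the image of a chart. -/
def chartExtend (e : OpenPartialHomeomorph X ℂ) (φ : ℂ → ℝ) : X → ℝ :=
  e.source.indicator fun x => φ (e x)

lemma chartExtend_symm (φ : ℂ → ℝ) {z : ℂ} (hz : z ∈ e.target) :
    chartExtend e φ (e.symm z) = φ z := by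
  rw [chartExtend, Set.indicator_of_mem (e.map_target hz), e.right_inv hz]

lemma exists_isClosed_chartExtend_eq_zero [T2Space X] {φ : ℂ → ℝ} (hc : HasCompactSupport φ)
    (hs : tsupport φ ⊆ e.target) :
    IsClosed (e.symm '' tsupport φ) ∧ e.symm '' tsupport φ ⊆ e.source ∧
      ∀ x ∉ e.symm '' tsupport φ, chartExtend e φ x = 0 := by
  refine ⟨(IsCompact.image_of_continuousOn hc (e.continuousOn_symm.mono hs)).isClosed, ?_,
    fun x hx => ?_⟩
  · rintro _ ⟨z, hz, rfl⟩; exact e.map_target (hs hz)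
  · by_cases hxs : x ∈ e.source
    · rw [chartExtend, Set.indicator_of_mem hxs]
      exact image_eq_zero_of_notMem_tsupport fun h => hx ⟨e x, h, e.left_inv hxs⟩
    · rw [chartExtend, Set.indicator_of_notMem hxs]

lemma continuous_chartExtend [T2Space X] {φ : ℂ → ℝ} (hφ : ContinuousOn φ e.target)
    (hc : HasCompactSupport φ) (hs : tsupport φ ⊆ e.target) : Continuous (chartExtend e φ) := by
  obtain ⟨h1, h2, h3⟩ := exists_isClosed_chartExtend_eq_zero hc hs
  refine continuous_iff_continuousAt.2 fun x => ?_
  by_cases hx : x ∈ e.source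
  · have : (fun y => φ (e y)) =ᶠ[𝓝 x] chartExtend e φ := by
      filter_upwards [e.open_source.mem_nhds hx] with y hy
      rw [chartExtend, Set.indicator_of_mem hy]
    refine ContinuousAt.congr ?_ this
    exact (hφ.continuousAt (e.open_target.mem_nhds (e.map_source hx))).comp (e.continuousAt hx)
  · have : (fun _ => (0 : ℝ)) =ᶠ[𝓝 x] chartExtend e φ := by
      filter_upwards [h1.isOpen_compl.mem_nhds fun h => hx (h2 h)] with y hy
      exact (h3 y hy).symm
    exact continuousAt_const.congr this

lemma IsPosForm.integral_mul_chartExtend (hη : IsPosForm η) (he : e ∈ atlas ℂ X) {w : X → ℝ}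
    {φ : ℂ → ℝ} (hw : AEStronglyMeasurable w η.measure)
    (hφ : AEStronglyMeasurable (chartExtend e φ) η.measure) :
    ∫ x, w x * chartExtend e φ x ∂η.measure
      = ∫ z in e.target, w (e.symm z) * φ z * η.coeff e z := by
  have h0 : ∀ x, x ∉ e.source → w x * chartExtend e φ x = 0 := fun x hx => by
    rw [chartExtend, Set.indicator_of_notMem hx, mul_zero]
  rw [← setIntegral_eq_integral_of_forall_compl_eq_zero h0,
    hη.setIntegral_source he (F := fun x => w x * chartExtend e φ x) (hw.mul hφ)]
  refine setIntegral_congr_fun e.open_target.measurableSet fun z hz => ?_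
  simp only [chartExtend_symm φ hz]

end surface

/-! ### The weak Poisson equation on a surface -/

/-- The vectors d and d i form an orthogonal pair of length ‖d‖, and the trace of a bilinear form
over such a pair is ‖d‖² times its trace; the mixed terms cancel. -/
lemma clm_conformal (B : ℂ →L[ℝ] ℂ →L[ℝ] ℝ) (d : ℂ) :
    B (d * 1) (d * 1) + B (d * Complex.I) (d * Complex.I)
      = (B 1 1 + B Complex.I Complex.I) * ‖d‖ ^ 2 := by
  have h1 : d * 1 = d.re • (1 : ℂ) + d.im • Complex.I := by
    simp [Complex.re_add_im]
  have h2 : d * Complex.I = (-d.im) • (1 : ℂ) + d.re • Complex.I := by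
    apply Complex.ext <;> simp
  rw [h1, h2, ← Complex.normSq_eq_norm_sq, Complex.normSq_apply]
  simp only [map_add, map_smul, add_apply, smul_apply,
    smul_eq_mul]
  ring

/-- The chain rule produces a second-order term, the trace of the Hessian in a rotated and scaled
frame, and first-order terms in τ''. The latter cancel because 1² + i² = 0. -/
theorem laplacian_comp_holomorphic {ψ : ℂ → ℝ} (hψ : ContDiff ℝ 2 ψ) {τ : ℂ → ℂ} {U : Set ℂ}
    (hU : IsOpen U) (hτ : DifferentiableOn ℂ τ U) {z : ℂ} (hz : z ∈ U) :
    Laplacian.laplacian (fun w => ψ (τ w)) z = Laplacian.laplacian ψ (τ z) * ‖deriv τ z‖ ^ 2 := by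
  have hτa : ContDiffAt ℝ 2 τ z :=
    ((hτ.contDiffOn hU (n := 2)).contDiffAt (hU.mem_nhds hz)).restrict_scalars ℝ
  have hd : HasDerivAt (deriv τ) (deriv (deriv τ) z) z :=
    ((hτ.deriv hU).differentiableAt (hU.mem_nhds hz)).hasDerivAt
  have hψ1 : Differentiable ℝ ψ := hψ.differentiable (by norm_num)
  have hψ2 : Differentiable ℝ (fderiv ℝ ψ) :=
    (hψ.fderiv_right (m := 1) (by norm_num)).differentiable (by norm_num)
  have hτz : ∀ w ∈ U, HasDerivAt τ (deriv τ w) w := fun w hw =>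
    (hτ.differentiableAt (hU.mem_nhds hw)).hasDerivAt
  have hfd : ∀ v : ℂ, ∀ w ∈ U,
      fderiv ℝ (fun y => ψ (τ y)) w v = fderiv ℝ ψ (τ w) (deriv τ w * v) := by
    intro v w hw
    have h2 := (hψ1 (τ w)).hasFDerivAt.comp w
      ((hτz w hw).hasFDerivAt.restrictScalars ℝ)
    have h3 : fderiv ℝ (fun y => ψ (τ y)) w = _ := h2.fderiv
    rw [h3]
    simp [mul_comm]
  have hsd : ∀ v : ℂ, fderiv ℝ (fun y => fderiv ℝ (fun y => ψ (τ y)) y v) z v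
      = fderiv ℝ (fderiv ℝ ψ) (τ z) (deriv τ z * v) (deriv τ z * v)
        + fderiv ℝ ψ (τ z) (deriv (deriv τ) z * v * v) := by
    intro v
    have he : (fun y => fderiv ℝ (fun y => ψ (τ y)) y v)
        =ᶠ[𝓝 z] fun w => fderiv ℝ ψ (τ w) (deriv τ w * v) := by
      filter_upwards [hU.mem_nhds hz] with w hw using hfd v w hw
    rw [he.fderiv_eq]
    have h1 := (hψ2 (τ z)).hasFDerivAt.comp z ((hτz z hz).hasFDerivAt.restrictScalars ℝ)
    have h2 := (hd.mul_const v).hasFDerivAt.restrictScalars ℝ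
    have h3 := h1.clm_apply h2
    have h4 : fderiv ℝ (fun w => fderiv ℝ ψ (τ w) (deriv τ w * v)) z = _ := h3.fderiv
    rw [h4]
    simp [mul_comm, add_comm]
  have hcomp : ContDiffAt ℝ 2 (fun w => ψ (τ w)) z := hψ.contDiffAt.comp z hτa
  rw [laplacian_eq_fderiv_fderiv hcomp, hsd, hsd, laplacian_eq_fderiv_fderiv hψ.contDiffAt]
  have key : ∀ v : ℂ, fderiv ℝ (fun y => fderiv ℝ ψ y v) (τ z) v
      = fderiv ℝ (fderiv ℝ ψ) (τ z) v v := by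
    intro v
    rw [fderiv_clm_apply (hψ2 _) (differentiableAt_const v)]
    simp
  rw [key, key, ← clm_conformal]
  have h5 : deriv (deriv τ) z * Complex.I * Complex.I = -(deriv (deriv τ) z * 1 * 1) := by
    rw [mul_assoc, Complex.I_mul_I]; ring
  rw [h5, map_neg]
  ring

/-- A smooth function with compact support in the image of a chart. -/
structure IsChartTest {X : Type*} [TopologicalSpace X] (e : OpenPartialHomeomorph X ℂ)
    (ψ : ℂ → ℝ) : Prop where
  contDiff : ContDiff ℝ (⊤ : ℕ∞) ψ
  hasCompactSupport : HasCompactSupport ψ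
  tsupport_subset : tsupport ψ ⊆ e.target

section surface

variable {X : Type*} [TopologicalSpace X] [T2Space X] [ChartedSpace ℂ X]
  [IsManifold (modelWithCornersSelf ℂ ℂ) 1 X] [MeasurableSpace X] [BorelSpace X]
  {η : RealTwoForm X} {e e' : OpenPartialHomeomorph X ℂ} {ψ ψ' : ℂ → ℝ}

/-- The Laplacian, with respect to the form `η`, of a function `ψ` in a chart. -/
def chartLaplacian (η : RealTwoForm X) (e : OpenPartialHomeomorph X ℂ) (ψ : ℂ → ℝ) : X → ℝ :=
  chartExtend e fun z => Laplacian.laplacian ψ z / η.coeff e z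

lemma IsChartTest.contDiff_two (h : IsChartTest e ψ) : ContDiff ℝ 2 ψ :=
  contDiff_infty.1 h.contDiff 2

lemma IsChartTest.continuous_chartExtend (h : IsChartTest e ψ) : Continuous (chartExtend e ψ) :=
  _root_.continuous_chartExtend h.contDiff.continuous.continuousOn h.hasCompactSupport
    h.tsupport_subset

lemma tsupport_div_subset (φ g : ℂ → ℝ) : tsupport (fun z => φ z / g z) ⊆ tsupport φ := by
  have : (fun z => φ z / g z) = fun z => φ z * (g z)⁻¹ := by ext; rw [div_eq_mul_inv]
  rw [this]; exact tsupport_mul_subset_left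

lemma IsPosForm.continuous_chartLaplacian (hη : IsPosForm η) (he : e ∈ atlas ℂ X)
    (h : IsChartTest e ψ) : Continuous (chartLaplacian η e ψ) := by
  have hs := (tsupport_div_subset (Laplacian.laplacian ψ) (η.coeff e)).trans
    (laplacian_tsupport_subset ψ)
  refine _root_.continuous_chartExtend ?_ ?_ (hs.trans h.tsupport_subset)
  · exact ((continuous_laplacian h.contDiff_two).continuousOn).div (hη e he).2
      fun z hz => ((hη e he).1 z hz).ne'
  · exact h.hasCompactSupport.of_isClosed_subset (isClosed_tsupport _) hs

lemma IsPosForm.integral_mul_chartLaplacian (hη : IsPosForm η) (he : e ∈ atlas ℂ X)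
    (h : IsChartTest e ψ) [SecondCountableTopology X] {w : X → ℝ} (hw : AEStronglyMeasurable w η.measure) :
    ∫ x, w x * chartLaplacian η e ψ x ∂η.measure
      = ∫ z in e.target, w (e.symm z) * Laplacian.laplacian ψ z := by
  rw [chartLaplacian, hη.integral_mul_chartExtend he hw
    (hη.continuous_chartLaplacian he h).aestronglyMeasurable]
  refine setIntegral_congr_fun e.open_target.measurableSet fun z hz => ?_
  have := ((hη e he).1 z hz).ne'
  field_simp

lemma IsChartTest.setIntegral_mul_laplacian (h : IsChartTest e ψ) (w : ℂ → ℝ) :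
    ∫ z in e.target, w z * Laplacian.laplacian ψ z = ∫ z, w z * Laplacian.laplacian ψ z :=
  setIntegral_eq_integral_of_forall_compl_eq_zero fun z hz => by
    rw [image_eq_zero_of_notMem_tsupport
      fun hz' => hz (h.tsupport_subset (laplacian_tsupport_subset ψ hz')), mul_zero]

lemma IsChartTest.setIntegral_mul (h : IsChartTest e ψ) (w : ℂ → ℝ) :
    ∫ z in e.target, w z * ψ z = ∫ z, w z * ψ z :=
  setIntegral_eq_integral_of_forall_compl_eq_zero fun z hz => by
    rw [image_eq_zero_of_notMem_tsupport fun hz' => hz (h.tsupport_subset hz'), mul_zero]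

/-- The weak form of `dd^c w = c [Q] + f η`. -/
def IsWeakSolution (η : RealTwoForm X) (c : ℝ) (Q : X) (w f : X → ℝ) : Prop :=
  ∀ e ∈ atlas ℂ X, ∀ ψ : ℂ → ℝ, IsChartTest e ψ →
    ∫ x, w x * chartLaplacian η e ψ x ∂η.measure
      = c * chartExtend e ψ Q + ∫ x, f x * chartExtend e ψ x ∂η.measure

variable [SecondCountableTopology X]

lemma IsPosForm.integral_chartLaplacian (hη : IsPosForm η) (he : e ∈ atlas ℂ X)
    (h : IsChartTest e ψ) : ∫ x, chartLaplacian η e ψ x ∂η.measure = 0 := by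
  have h1 := hη.integral_mul_chartLaplacian he h (w := fun _ => 1) aestronglyMeasurable_const
  simp only [one_mul] at h1
  rw [h1]
  have h2 := h.setIntegral_mul_laplacian (fun _ => 1)
  have h3 := integral_mul_laplacian (u := fun _ => (1 : ℝ)) isOpen_univ contDiffOn_const
    h.contDiff_two h.hasCompactSupport (Set.subset_univ _)
  simp only [one_mul] at h2 h3
  rw [h2, h3]
  have : Laplacian.laplacian (fun _ : ℂ => (1 : ℝ)) = 0 := InnerProductSpace.laplacian_const
  simp [this]

/-- A test function is a weak solution with its Laplacian as right hand side. -/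
theorem IsPosForm.isWeakSolution_chartExtend (hη : IsPosForm η) (he : e ∈ atlas ℂ X)
    (h : IsChartTest e ψ) (Q : X) :
    IsWeakSolution η 0 Q (chartExtend e ψ) (chartLaplacian η e ψ) := by
  intro e' he' ψ' h'
  rw [zero_mul, zero_add, hη.integral_mul_chartLaplacian he' h'
    h.continuous_chartExtend.aestronglyMeasurable, hη.integral_mul_chartExtend he'
    (hη.continuous_chartLaplacian he h).aestronglyMeasurable
    h'.continuous_chartExtend.aestronglyMeasurable]
  -- Seen in the second chart, the extended test function is ψ composed with the transition map on
  -- the overlap U and is zero near every other point, because its support is compact. It is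
  -- therefore C² and Green's identity applies.
  set U := e'.target ∩ e'.symm ⁻¹' e.source with hU
  have hUo : IsOpen U := isOpen_overlap e' e
  have hτ := differentiableOn_transition he' he
  obtain ⟨hcl, hcs, hc0⟩ := exists_isClosed_chartExtend_eq_zero h.hasCompactSupport
    h.tsupport_subset
  have hO : IsOpen (e'.target ∩ e'.symm ⁻¹' (e.symm '' tsupport ψ)ᶜ) :=
    e'.isOpen_inter_preimage_symm hcl.isOpen_compl
  have hin : ∀ z ∈ U, (fun z => chartExtend e ψ (e'.symm z)) =ᶠ[𝓝 z]
      fun z => ψ (e (e'.symm z)) := fun z hz => by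
    filter_upwards [hUo.mem_nhds hz] with y hy
    rw [chartExtend, Set.indicator_of_mem (by exact hy.2)]
  have hout : ∀ z ∈ e'.target, z ∉ U → (fun z => chartExtend e ψ (e'.symm z)) =ᶠ[𝓝 z]
      fun _ => 0 := fun z hz hzU => by
    filter_upwards [hO.mem_nhds ⟨hz, fun hz' => hzU ⟨hz, hcs hz'⟩⟩] with y hy
    exact hc0 _ hy.2
  have hu : ContDiffOn ℝ 2 (fun z => chartExtend e ψ (e'.symm z)) e'.target := by
    intro z hz
    refine ContDiffAt.contDiffWithinAt ?_
    by_cases hzU : z ∈ U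
    · refine ContDiffAt.congr_of_eventuallyEq ?_ (hin z hzU)
      exact h.contDiff_two.contDiffAt.comp z
        (((hτ.contDiffOn hUo (n := 2)).contDiffAt (hUo.mem_nhds hzU)).restrict_scalars ℝ)
    · exact contDiffAt_const.congr_of_eventuallyEq (hout z hz hzU)
  rw [h'.setIntegral_mul_laplacian, integral_mul_laplacian e'.open_target hu h'.contDiff_two
    h'.hasCompactSupport h'.tsupport_subset, ← h'.setIntegral_mul]
  refine setIntegral_congr_fun e'.open_target.measurableSet fun z hz => ?_
  rw [mul_right_comm]
  congr 1
  by_cases hzU : z ∈ U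
  -- The conformal factor of the Laplacian cancels against the one in the transformation rule of η.
  · rw [InnerProductSpace.laplacian_congr_nhds (hin z hzU) |>.eq_of_nhds,
      laplacian_comp_holomorphic h.contDiff_two hUo hτ hzU, chartLaplacian, chartExtend,
      Set.indicator_of_mem (by exact hzU.2), η.coeff_change e' he' e he z hz hzU.2]
    have := ((hη e he).1 _ (e.map_source hzU.2)).ne'
    field_simp
  · rw [InnerProductSpace.laplacian_congr_nhds (hout z hz hzU) |>.eq_of_nhds]
    rw [chartLaplacian, chartExtend, Set.indicator_of_notMem (by exact fun h => hzU ⟨hz, h⟩),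
      zero_mul]
    have : Laplacian.laplacian (fun _ : ℂ => (0 : ℝ)) = 0 := InnerProductSpace.laplacian_const
    simp [this]

lemma IsWeakSolution.congr_ae {c : ℝ} {Q : X} {w f w' f' : X → ℝ} (h : IsWeakSolution η c Q w f)
    (hw : w =ᵐ[η.measure] w') (hf : f =ᵐ[η.measure] f') : IsWeakSolution η c Q w' f' := by
  intro e he ψ hψ
  rw [integral_congr_ae (g := fun x => w x * chartLaplacian η e ψ x)
    (by filter_upwards [hw] with x hx; rw [hx]), h e he ψ hψ]
  congr 1
  exact integral_congr_ae (by filter_upwards [hf] with x hx; rw [hx])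

variable [CompactSpace X]

lemma integrable_mul_continuous {w F : X → ℝ}
    (hw : Integrable w η.measure) (hF : Continuous F) :
    Integrable (fun x => w x * F x) η.measure := by
  obtain ⟨C, hC⟩ := isCompact_univ.exists_bound_of_continuousOn hF.continuousOn
  exact hw.mul_bdd (c := C) hF.aestronglyMeasurable (Eventually.of_forall fun x => hC x trivial)

lemma IsWeakSolution.add (hη : IsPosForm η) {c c' : ℝ} {Q : X} {w f w' f' : X → ℝ}
    (h : IsWeakSolution η c Q w f) (h' : IsWeakSolution η c' Q w' f')
    (hw : Integrable w η.measure) (hf : Integrable f η.measure)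
    (hw' : Integrable w' η.measure) (hf' : Integrable f' η.measure) :
    IsWeakSolution η (c + c') Q (fun x => w x + w' x) (fun x => f x + f' x) := by
  intro e he ψ hψ
  have hF := hη.continuous_chartLaplacian he hψ
  have hE := hψ.continuous_chartExtend
  simp only [add_mul]
  rw [integral_add (integrable_mul_continuous hw hF) (integrable_mul_continuous hw' hF),
    integral_add (integrable_mul_continuous hf hE) (integrable_mul_continuous hf' hE),
    h e he ψ hψ, h' e he ψ hψ]
  ring

lemma IsWeakSolution.const_mul {c : ℝ} {Q : X} {w f : X → ℝ}
    (h : IsWeakSolution η c Q w f) (a : ℝ) :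
    IsWeakSolution η (a * c) Q (fun x => a * w x) (fun x => a * f x) := by
  intro e he ψ hψ
  simp only [mul_assoc]
  rw [integral_const_mul, integral_const_mul, h e he ψ hψ]
  ring

lemma IsWeakSolution.sub (hη : IsPosForm η) {c c' : ℝ} {Q : X} {w f w' f' : X → ℝ}
    (h : IsWeakSolution η c Q w f) (h' : IsWeakSolution η c' Q w' f')
    (hw : Integrable w η.measure) (hf : Integrable f η.measure)
    (hw' : Integrable w' η.measure) (hf' : Integrable f' η.measure) :
    IsWeakSolution η (c - c') Q (fun x => w x - w' x) (fun x => f x - f' x) := by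
  have := h.add hη (h'.const_mul (-1)) hw hf (hw'.const_mul (-1)) (hf'.const_mul (-1))
  simpa [sub_eq_add_neg] using this

lemma IsPosForm.isWeakSolution_const (hη : IsPosForm η) (a : ℝ) (Q : X) :
    IsWeakSolution η 0 Q (fun _ => a) (fun _ => 0) := by
  intro e he ψ hψ
  rw [integral_const_mul, hη.integral_chartLaplacian he hψ]
  simp

end surface

/-! ### Local parametrices on the surface -/

/-- Continuity of translations in L²; it makes the logarithmic kernel depend continuously on its
base point in spite of the singularity. -/
theorem tendsto_eLpNorm_translate_sub {φ : ℂ → ℝ} (hφ : MemLp φ 2 volume) (z : ℂ) :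
    Tendsto (fun z' => eLpNorm (fun w => φ (w - z') - φ (w - z)) 2 volume) (𝓝 z) (𝓝 0) := by
  have : Fact ((2 : ℝ≥0∞) ≠ ∞) := ⟨by norm_num⟩
  set F : Lp ℝ 2 (volume : Measure ℂ) := hφ.toLp φ
  have hc : Continuous fun z' : ℂ => (DomAddAct.mk (-z') +ᵥ F : Lp ℝ 2 (volume : Measure ℂ)) :=
    (DomAddAct.continuous_mk.comp continuous_neg).vadd continuous_const
  have h1 := (hc.tendsto z).edist
    (tendsto_const_nhds (x := (DomAddAct.mk (-z) +ᵥ F : Lp ℝ 2 (volume : Measure ℂ))))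
  rw [edist_self] at h1
  refine h1.congr fun z' => ?_
  rw [DomAddAct.mk_vadd_toLp, DomAddAct.mk_vadd_toLp, Lp.edist_toLp_toLp]
  congr 1
  ext w
  simp [sub_eq_neg_add]

section surface

variable {X : Type*} [TopologicalSpace X] [T2Space X] [ChartedSpace ℂ X]
  [IsManifold (modelWithCornersSelf ℂ ℂ) 1 X] [MeasurableSpace X] [BorelSpace X]
  {η : RealTwoForm X} {e : OpenPartialHomeomorph X ℂ}

lemma aestronglyMeasurable_chartExtend (η : RealTwoForm X) (he : e ∈ atlas ℂ X) {φ : ℂ → ℝ}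
    (hφ : AEStronglyMeasurable φ volume) : AEStronglyMeasurable (chartExtend e φ) η.measure := by
  rw [chartExtend, aestronglyMeasurable_indicator_iff e.open_source.measurableSet]
  refine AEStronglyMeasurable.comp_aemeasurable (g := φ) ?_
    (e.continuousOn.aemeasurable e.open_source.measurableSet)
  rw [η.map_restrict_eq_planeMeasure he]
  exact hφ.restrict.mono_ac (η.planeMeasure_ac e)

lemma IsPosForm.exists_planeMeasure_restrict_le (hη : IsPosForm η) (he : e ∈ atlas ℂ X)
    {B : Set ℂ} (hB : IsCompact B) (hBt : B ⊆ e.target) :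
    ∃ C : ℝ≥0, (η.planeMeasure e).restrict B ≤ (C : ℝ≥0∞) • (volume : Measure ℂ) := by
  obtain ⟨C, hC⟩ := hB.exists_bound_of_continuousOn ((hη e he).2.mono hBt)
  refine ⟨C.toNNReal, ?_⟩
  rw [RealTwoForm.planeMeasure, restrict_withDensity hB.measurableSet, ← withDensity_const]
  refine (withDensity_mono (g := fun _ => (C.toNNReal : ℝ≥0∞)) ?_).trans ?_
  · filter_upwards [ae_restrict_mem hB.measurableSet] with z hz
    exact ENNReal.ofReal_le_ofReal ((le_abs_self _).trans (hC z hz))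
  · rw [withDensity_const, withDensity_const]
    gcongr
    exact Measure.restrict_le_self.trans Measure.restrict_le_self

lemma IsPosForm.exists_eLpNorm_chartExtend_le (hη : IsPosForm η) (he : e ∈ atlas ℂ X)
    {B : Set ℂ} (hB : IsCompact B) (hBt : B ⊆ e.target) :
    ∃ C : ℝ≥0∞, C ≠ ∞ ∧ ∀ φ : ℂ → ℝ, AEStronglyMeasurable φ volume →
      eLpNorm (chartExtend e (B.indicator φ)) 2 η.measure ≤ C * eLpNorm φ 2 volume := by
  obtain ⟨C, hC⟩ := hη.exists_planeMeasure_restrict_le he hB hBt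
  refine ⟨(C : ℝ≥0∞) ^ (1 / (2 : ℝ≥0∞)).toReal, by simp, fun φ hφ => ?_⟩
  have hφB := hφ.indicator hB.measurableSet
  calc eLpNorm (chartExtend e (B.indicator φ)) 2 η.measure
      = eLpNorm (B.indicator φ ∘ e) 2 (η.measure.restrict e.source) := by
        rw [chartExtend, eLpNorm_indicator_eq_eLpNorm_restrict e.open_source.measurableSet]; rfl
    _ = eLpNorm (B.indicator φ) 2 (η.planeMeasure e) := by
        rw [← η.map_restrict_eq_planeMeasure he, eLpNorm_map_measure]
        · rw [η.map_restrict_eq_planeMeasure he]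
          exact hφB.restrict.mono_ac (η.planeMeasure_ac e)
        · exact e.continuousOn.aemeasurable e.open_source.measurableSet
    _ = eLpNorm φ 2 ((η.planeMeasure e).restrict B) :=
        eLpNorm_indicator_eq_eLpNorm_restrict hB.measurableSet
    _ ≤ eLpNorm φ 2 ((C : ℝ≥0∞) • (volume : Measure ℂ)) := eLpNorm_mono_measure _ hC
    _ = _ := by rw [eLpNorm_smul_measure_of_ne_top (by norm_num)]; rfl

/-- Kernels `k`, `s` that represent, near `N`, a function by its distributional Laplacian up to a
continuous error. -/
structure IsLocalParametrix (η : RealTwoForm X) (N : Set X) (k s : X → X → ℝ) : Prop where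
  isOpen : IsOpen N
  memLp : ∀ x, MemLp (k x) 2 η.measure
  tendsto_eLpNorm : ∀ x ∈ N, Tendsto (fun y => eLpNorm (fun t => k y t - k x t) 2 η.measure)
    (𝓝 x) (𝓝 0)
  nonpos : ∀ x y, k x y ≤ 0
  continuousAt : ∀ x ∈ N, ∀ Q, x ≠ Q → ContinuousAt (fun y => k y Q) x
  aestronglyMeasurable : ∀ x, AEStronglyMeasurable (s x) η.measure
  bounded : ∃ C, ∀ x y, |s x y| ≤ C
  uniform : ∀ x ∈ N, ∀ ε > 0, ∀ᶠ x' in 𝓝 x, ∀ y, |s x' y - s x y| ≤ ε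
  representation : ∀ (c : ℝ) (Q : X) (w f : X → ℝ), Integrable w η.measure →
    Integrable f η.measure → IsWeakSolution η c Q w f →
    ∀ᵐ x ∂η.measure, x ∈ N → w x = c * k x Q + ∫ y, f y * k x y ∂η.measure
      - ∫ y, w y * s x y ∂η.measure

variable [SecondCountableTopology X]

/-- The kernels are the translates of the cut-off logarithm and of its error term, read in a chart
and restricted to a disk; the representation is the planar one. -/
theorem IsPosForm.exists_isLocalParametrix (hη : IsPosForm η) (x₀ : X) :
    ∃ N k s, x₀ ∈ N ∧ IsLocalParametrix η N k s := by
  classical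
  have he := chart_mem_atlas ℂ x₀
  set e := chartAt ℂ x₀
  have hx₀ : x₀ ∈ e.source := mem_chart_source ℂ x₀
  obtain ⟨r, hr, hrt⟩ := Metric.nhds_basis_closedBall.mem_iff.1
    (e.open_target.mem_nhds (e.map_source hx₀))
  -- ρ ≤ 1 makes the cut-off logarithm nonpositive and square integrable. Kernels of radius ρ based
  -- in the disk V of radius ρ stay in the disk B of radius 2 ρ, which lies in the chart.
  set ρ := min 1 (r / 2) with hρ
  have hρ0 : 0 < ρ := by positivity
  have hρ1 : ρ ≤ 1 := min_le_left _ _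
  set B := Metric.closedBall (e x₀) (2 * ρ) with hBdef
  have hBt : B ⊆ e.target := (Metric.closedBall_subset_closedBall
    (by have := min_le_right 1 (r / 2); linarith)).trans hrt
  have hB : IsCompact B := isCompact_closedBall _ _
  set V := Metric.ball (e x₀) ρ with hVdef
  have hVB : V ⊆ B := fun z hz => by
    have : dist z (e x₀) < ρ := hz
    exact Metric.mem_closedBall.2 (by linarith)
  let χ : ContDiffBump (0 : ℂ) := ⟨ρ / 2, ρ, by positivity, by linarith⟩
  have hχ : χ.rOut = ρ := rfl
  set E := cutoffLog χ with hE
  set S := cutoffLogError χ with hS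
  have hEm : AEStronglyMeasurable E volume := (measurable_cutoffLog χ).aestronglyMeasurable
  have hSm : Continuous S := (contDiff_cutoffLogError χ (n := 0)).continuous
  have hEtm : ∀ z : ℂ, AEStronglyMeasurable (fun w => E (w - z)) volume := fun z =>
    ((measurable_cutoffLog χ).comp (measurable_id.sub_const z)).aestronglyMeasurable
  set k : X → X → ℝ := fun x => chartExtend e (B.indicator fun w => E (w - e x)) with hk
  -- The error kernel is integrated against w without the form, so it is divided by the coefficient
  -- to become a kernel with respect to η. The kernel k meets the product f η and needs no such
  -- correction.
  set s : X → X → ℝ := fun x =>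
    chartExtend e (B.indicator fun w => S (w - e x) / η.coeff e w) with hs
  set N := e.source ∩ e ⁻¹' V with hN
  have hNo : IsOpen N := e.isOpen_inter_preimage Metric.isOpen_ball
  have hcpos : ∀ z ∈ B, 0 < η.coeff e z := fun z hz => (hη e he).1 z (hBt hz)
  have hcc : ContinuousOn (η.coeff e) B := (hη e he).2.mono hBt
  have hkm : ∀ x, AEStronglyMeasurable (k x) η.measure := fun x =>
    aestronglyMeasurable_chartExtend η he ((hEtm _).indicator hB.measurableSet)
  have hsm : ∀ x, AEStronglyMeasurable (s x) η.measure := fun x => by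
    refine aestronglyMeasurable_chartExtend η he ?_
    rw [aestronglyMeasurable_indicator_iff hB.measurableSet]
    exact ((hSm.comp (continuous_id.sub continuous_const)).continuousOn.div hcc
      fun z hz => (hcpos z hz).ne').aestronglyMeasurable hB.measurableSet
  obtain ⟨C, hC, hCb⟩ := hη.exists_eLpNorm_chartExtend_le he hB hBt
  obtain ⟨Ci, hCi⟩ := hB.exists_bound_of_continuousOn (hcc.inv₀ fun z hz => (hcpos z hz).ne')
  obtain ⟨CS, hCS⟩ := hSm.bounded_above_of_compact_support (hasCompactSupport_cutoffLogError χ)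
  have hCS0 : 0 ≤ CS := (norm_nonneg _).trans (hCS 0)
  have hCi0 : 0 ≤ Ci := (norm_nonneg _).trans
    (hCi (e x₀) (Metric.mem_closedBall_self (by positivity)))
  have hSu : UniformContinuous S :=
    (hasCompactSupport_cutoffLogError χ).uniformContinuous_of_continuous hSm
  refine ⟨N, k, s, ⟨hx₀, Metric.mem_ball_self hρ0⟩, hNo, fun x => ⟨hkm x, ?_⟩, fun x hx => ?_,
    fun x y => ?_, fun x hx Q hxQ => ?_, hsm, ⟨CS * Ci, fun x y => ?_⟩,
    fun x hx ε hε => ?_, fun c Q w f hw hf hwf => ?_⟩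
  · refine (hCb _ (hEtm _)).trans_lt (ENNReal.mul_lt_top hC.lt_top ?_)
    have := (memLp_cutoffLog χ (hχ.le.trans hρ1)).comp_measurePreserving
      (measurePreserving_sub_right volume (e x))
    exact this.2
  · have h1 := tendsto_eLpNorm_translate_sub (memLp_cutoffLog χ (hχ.le.trans hρ1)) (e x)
    have h2 := ENNReal.Tendsto.const_mul (a := C) (h1.comp (e.continuousAt hx.1)) (Or.inr hC)
    rw [mul_zero] at h2
    refine tendsto_of_tendsto_of_tendsto_of_le_of_le tendsto_const_nhds h2 (fun _ => zero_le)
      fun y => ?_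
    refine le_trans (le_of_eq ?_) (hCb _ ((hEtm (e y)).sub (hEtm (e x))))
    congr 1
    ext t
    simp only [hk, chartExtend, Set.indicator_apply]
    split_ifs
    · rfl
    · exact sub_zero _
    · exact sub_zero _
  · simp only [hk, chartExtend, Set.indicator_apply]
    split_ifs
    · exact cutoffLog_nonpos χ (hχ.le.trans hρ1) _
    · rfl
    · rfl
  · simp only [hk, chartExtend, Set.indicator_apply]
    split_ifs with h1 h2
    · have hne : e Q - e x ≠ 0 := sub_ne_zero.2 fun h => hxQ (e.injOn hx.1 h1 h.symm)
      exact (continuousAt_cutoffLog χ hne).comp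
        (f := fun y => e Q - e y) (continuousAt_const.sub (e.continuousAt hx.1))
    · exact continuousAt_const
    · exact continuousAt_const
  · simp only [hs, chartExtend, Set.indicator_apply]
    split_ifs with h1 h2
    · rw [div_eq_mul_inv, abs_mul]
      exact mul_le_mul (hCS _) (hCi _ h2) (abs_nonneg _) hCS0
    · simpa using mul_nonneg hCS0 hCi0
    · simpa using mul_nonneg hCS0 hCi0
  · obtain ⟨δ, hδ, hδS⟩ := Metric.uniformContinuous_iff.1 hSu (ε / (Ci + 1)) (by positivity)
    filter_upwards [(e.continuousAt hx.1).eventually (Metric.ball_mem_nhds _ hδ)] with x' hx' y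
    simp only [hs, chartExtend, Set.indicator_apply]
    split_ifs with h1 h2
    · rw [← sub_div, div_eq_mul_inv, abs_mul]
      have h3 := hδS (a := e y - e x') (b := e y - e x)
        (by rw [dist_sub_left]; exact hx')
      rw [Real.dist_eq] at h3
      calc _ ≤ ε / (Ci + 1) * Ci :=
            mul_le_mul h3.le (hCi _ h2) (abs_nonneg _) (by positivity)
        _ ≤ ε := by
            rw [div_mul_eq_mul_div, div_le_iff₀ (by positivity)]
            nlinarith
    · simpa using hε.le
    · simpa using hε.le
  · set v := B.indicator fun z => w (e.symm z) with hv
    set g := B.indicator fun z => f (e.symm z) * η.coeff e z with hg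
    have hvi : Integrable v := by
      obtain ⟨_, _, h⟩ := hη.exists_setIntegral_le he hB hBt
      exact (integrable_indicator_iff hB.measurableSet).2 (h w hw).1
    have hgi : Integrable g :=
      (integrable_indicator_iff hB.measurableSet).2 ((hη.integrableOn_target he hf).mono_set hBt)
    have hVU : ∀ z ∈ V, Metric.closedBall z χ.rOut ⊆ Metric.ball (e x₀) (2 * ρ) := by
      intro z hz y hy
      have h1 : dist z (e x₀) < ρ := hz
      have h2 : dist y z ≤ ρ := hy
      exact Metric.mem_ball.2 (by linarith [dist_triangle y z (e x₀)])
    -- If the pole lies outside the chart, the point mass is invisible there and c' = 0. If it lies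
    -- in the chart but not in B, it is farther than ρ from every point of V, and the logarithmic
    -- term is zero.
    obtain ⟨c', q, hcq, hcq2⟩ : ∃ (c' : ℝ) (q : ℂ),
        (∀ ψ : ℂ → ℝ, c * chartExtend e ψ Q = c' * ψ q) ∧
        ∀ x ∈ N, c' * E (e x - q) = c * k x Q := by
      by_cases hQ : Q ∈ e.source
      · refine ⟨c, e Q, fun ψ => by rw [chartExtend, Set.indicator_of_mem hQ], fun x hx => ?_⟩
        simp only [hk, chartExtend]
        rw [Set.indicator_of_mem hQ, ← neg_sub, hE, cutoffLog_neg]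
        by_cases hQB : e Q ∈ B
        · rw [Set.indicator_of_mem hQB]
        · rw [Set.indicator_of_notMem hQB, cutoffLog_eq_zero]
          have h1 : dist (e x) (e x₀) < ρ := hx.2
          have h2 : 2 * ρ < dist (e Q) (e x₀) := not_le.1 hQB
          rw [hχ, ← dist_eq_norm]
          linarith [dist_triangle (e Q) (e x) (e x₀)]
      · exact ⟨0, 0, fun ψ => by rw [chartExtend, Set.indicator_of_notMem hQ]; simp, fun x _ => by
          simp only [hk, chartExtend]; rw [Set.indicator_of_notMem hQ]; simp⟩
    have hrep := ae_eq_cutoffLog_representation χ (V := V) Metric.isOpen_ball hVU hvi hgi (c := c')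
      (q := q) fun ψ h1 h2 h3 => by
        have hψ : IsChartTest e ψ := ⟨h1, h2, h3.trans (Metric.ball_subset_closedBall.trans hBt)⟩
        have hψB : ∀ z ∉ B, ψ z = 0 := fun z hz =>
          image_eq_zero_of_notMem_tsupport fun h => hz (Metric.ball_subset_closedBall (h3 h))
        have hψB' : ∀ z ∉ B, Laplacian.laplacian ψ z = 0 := fun z hz =>
          image_eq_zero_of_notMem_tsupport fun h =>
            hz (Metric.ball_subset_closedBall (h3 (laplacian_tsupport_subset ψ h)))
        have h4 := hwf e he ψ hψ
        rw [hη.integral_mul_chartLaplacian he hψ hw.1, hη.integral_mul_chartExtend he hf.1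
          hψ.continuous_chartExtend.aestronglyMeasurable, hcq,
          hψ.setIntegral_mul_laplacian fun z => w (e.symm z)] at h4
        have h5 := hψ.setIntegral_mul fun z => f (e.symm z) * η.coeff e z
        have h6 : ∀ z, g z * ψ z = f (e.symm z) * η.coeff e z * ψ z := fun z => by
          by_cases hz : z ∈ B
          · rw [hg, Set.indicator_of_mem hz]
          · rw [hψB z hz]; simp
        have h7 : ∀ z, v z * Laplacian.laplacian ψ z
            = w (e.symm z) * Laplacian.laplacian ψ z := fun z => by
          by_cases hz : z ∈ B
          · rw [hv, Set.indicator_of_mem hz]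
          · rw [hψB' z hz]; simp
        simp only [h6, h7]
        rw [h4, ← h5]
        simp only [mul_right_comm]
    filter_upwards [η.ae_measure he (hrep.mono fun z hz _ => hz)] with x hx hxN
    have h1 := hx hxN.1 hxN.2
    rw [hcq2 x hxN, hv, Set.indicator_of_mem (hVB hxN.2), e.left_inv hxN.1] at h1
    rw [h1]
    have hint : ∀ F : ℂ → ℝ, (∀ z ∉ B, F z = 0) → ∫ z, F z = ∫ z in e.target, F z := fun F hF =>
      (setIntegral_eq_integral_of_forall_compl_eq_zero fun z hz =>
        hF z fun h => hz (hBt h)).symm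
    congr 1
    · congr 1
      rw [hη.integral_mul_chartExtend he hf.1 (hkm x), correlation, hint]
      · refine integral_congr_ae (Eventually.of_forall fun z => ?_)
        simp only [hg, Set.indicator_apply]
        split_ifs
        · ring
        · simp
      · intro z hz
        rw [hg, Set.indicator_of_notMem hz, mul_zero]
    · rw [hη.integral_mul_chartExtend he hw.1 (hsm x), correlation, hint]
      · refine integral_congr_ae (Eventually.of_forall fun z => ?_)
        simp only [Set.indicator_apply]
        split_ifs with hz
        · have := (hcpos z hz).ne'
          field_simp
          exact mul_comm _ _
        · simp
      · intro z hz
        rw [Set.indicator_of_notMem hz, mul_zero]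

end surface

/-! ### Regularity of weak solutions -/

lemma inner_toLp_eq_integral {α : Type*} [MeasurableSpace α] {μ : Measure α} {f g : α → ℝ}
    (hf : MemLp f 2 μ) (hg : MemLp g 2 μ) :
    inner ℝ (hf.toLp f) (hg.toLp g) = ∫ x, f x * g x ∂μ := by
  rw [L2.inner_def]
  refine integral_congr_ae ?_
  filter_upwards [hf.coeFn_toLp, hg.coeFn_toLp] with x h1 h2
  rw [h1, h2]
  simp [mul_comm]

lemma abs_integral_mul_le {α : Type*} [MeasurableSpace α] {μ : Measure α} {f g : α → ℝ}
    (hf : MemLp f 2 μ) (hg : MemLp g 2 μ) :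
    |∫ x, f x * g x ∂μ| ≤ (eLpNorm f 2 μ).toReal * (eLpNorm g 2 μ).toReal := by
  rw [← inner_toLp_eq_integral hf hg, ← Lp.norm_toLp f hf, ← Lp.norm_toLp g hg]
  exact abs_real_inner_le_norm _ _

/-- Continuous local representatives agree on overlaps because open sets have positive measure, so
each point may use its own representative. A countable subcover keeps the exceptional sets null. -/
lemma exists_continuousOn_of_locally_ae_eq {X : Type*} [TopologicalSpace X]
    [SecondCountableTopology X] [MeasurableSpace X] [OpensMeasurableSpace X] {μ : Measure X}
    [μ.IsOpenPosMeasure] {U : Set X} {w : X → ℝ}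
    (h : ∀ x ∈ U, ∃ N, IsOpen N ∧ x ∈ N ∧ ∃ v : X → ℝ, ContinuousOn v N ∧
      ∀ᵐ y ∂μ, y ∈ N → w y = v y) :
    ∃ g : X → ℝ, ContinuousOn g U ∧ ∀ᵐ y ∂μ, y ∈ U → w y = g y := by
  classical
  choose! N hN hxN v hv hw using h
  have hag : ∀ x ∈ U, ∀ y ∈ U, Set.EqOn (v x) (v y) (N x ∩ N y) := by
    intro x hx y hy
    have ho := (hN x hx).inter (hN y hy)
    refine Measure.eqOn_open_of_ae_eq (μ := μ) ?_ ho
      ((hv x hx).mono Set.inter_subset_left) ((hv y hy).mono Set.inter_subset_right)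
    refine (ae_restrict_iff' ho.measurableSet).2 ?_
    filter_upwards [hw x hx, hw y hy] with t h1 h2 ht
    rw [← h1 ht.1, ← h2 ht.2]
  have hg : ∀ x ∈ U, ∀ y ∈ N x, y ∈ U → v y y = v x y := fun x hx y hyx hy =>
    hag y hy x hx ⟨hxN y hy, hyx⟩
  refine ⟨fun x => v x x, fun x hx => ?_, ?_⟩
  · have h1 : ContinuousWithinAt (v x) U x :=
      ((hv x hx).continuousAt ((hN x hx).mem_nhds (hxN x hx))).continuousWithinAt
    refine h1.congr_of_eventuallyEq ?_ rfl
    filter_upwards [self_mem_nhdsWithin, mem_nhdsWithin_of_mem_nhds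
      ((hN x hx).mem_nhds (hxN x hx))] with y hy hyN using hg x hx y hyN hy
  · obtain ⟨T, hTU, hT, hcov⟩ := TopologicalSpace.isOpen_biUnion_countable U N hN
    have h2 : ∀ᵐ y ∂μ, ∀ x ∈ T, y ∈ N x → w y = v x y :=
      (ae_ball_iff hT).2 fun x hx => hw x (hTU hx)
    filter_upwards [h2] with y hy hyU
    have h3 : y ∈ ⋃ x ∈ T, N x := by rw [hcov]; exact Set.mem_biUnion hyU (hxN y hyU)
    obtain ⟨x, hx, hyx⟩ := Set.mem_iUnion₂.1 h3
    rw [hy x hx hyx, hg x (hTU hx) y hyx hyU]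

section surface

variable {X : Type*} [TopologicalSpace X] [T2Space X] [ChartedSpace ℂ X]
  [IsManifold (modelWithCornersSelf ℂ ℂ) 1 X] [MeasurableSpace X] [BorelSpace X]
  {η : RealTwoForm X} {e : OpenPartialHomeomorph X ℂ} {N : Set X} {k s : X → X → ℝ}

lemma IsLocalParametrix.continuousOn_integral_mul (h : IsLocalParametrix η N k s) {f : X → ℝ}
    (hf : MemLp f 2 η.measure) : ContinuousOn (fun x => ∫ y, f y * k x y ∂η.measure) N := by
  intro x hx
  refine ContinuousAt.continuousWithinAt ?_
  rw [ContinuousAt, tendsto_iff_dist_tendsto_zero]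
  have h1 : Tendsto (fun y => (eLpNorm f 2 η.measure).toReal *
      (eLpNorm (fun t => k y t - k x t) 2 η.measure).toReal) (𝓝 x) (𝓝 0) := by
    have := (ENNReal.tendsto_toReal ENNReal.zero_ne_top).comp (h.tendsto_eLpNorm x hx)
    simpa using this.const_mul (eLpNorm f 2 η.measure).toReal
  refine squeeze_zero' (Eventually.of_forall fun _ => dist_nonneg) ?_ h1
  filter_upwards with y
  have hi : ∀ z, Integrable (fun t => f t * k z t) η.measure := fun z =>
    hf.integrable_mul (h.memLp z)
  rw [Real.dist_eq, ← integral_sub (hi y) (hi x)]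
  simp only [← mul_sub]
  exact abs_integral_mul_le hf ((h.memLp y).sub (h.memLp x))

lemma IsLocalParametrix.integrable_mul (h : IsLocalParametrix η N k s) {w : X → ℝ}
    (hw : Integrable w η.measure) (x : X) :
    Integrable (fun y => w y * s x y) η.measure := by
  obtain ⟨C, hC⟩ := h.bounded
  exact hw.mul_bdd (c := C) (h.aestronglyMeasurable x) (Eventually.of_forall fun y => hC x y)

lemma IsLocalParametrix.abs_integral_sub_le (h : IsLocalParametrix η N k s) {w : X → ℝ}
    (hw : Integrable w η.measure) {x x' : X} {ε : ℝ}
    (hε : ∀ y, |s x' y - s x y| ≤ ε) :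
    |∫ y, w y * s x' y ∂η.measure - ∫ y, w y * s x y ∂η.measure| ≤ ε * ∫ y, |w y| ∂η.measure := by
  rw [← integral_sub (h.integrable_mul hw x') (h.integrable_mul hw x), ← Real.norm_eq_abs,
    ← integral_const_mul]
  refine norm_integral_le_of_norm_le (hw.abs.const_mul ε) (Eventually.of_forall fun y => ?_)
  rw [← mul_sub, Real.norm_eq_abs, abs_mul, mul_comm]
  exact mul_le_mul_of_nonneg_right (hε y) (abs_nonneg _)

lemma IsLocalParametrix.continuousOn_integral_mul_error (h : IsLocalParametrix η N k s)
    {w : X → ℝ} (hw : Integrable w η.measure) :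
    ContinuousOn (fun x => ∫ y, w y * s x y ∂η.measure) N := by
  intro x hx
  refine ContinuousAt.continuousWithinAt ?_
  rw [Metric.continuousAt_iff']
  intro ε hε
  have hI : 0 ≤ ∫ y, |w y| ∂η.measure := integral_nonneg fun _ => abs_nonneg _
  filter_upwards [h.uniform x hx (ε / (∫ y, |w y| ∂η.measure + 1)) (by positivity)] with x' hs
  rw [Real.dist_eq]
  refine (h.abs_integral_sub_le hw hs).trans_lt ?_
  rw [div_mul_eq_mul_div, div_lt_iff₀ (by positivity)]
  nlinarith

variable [SecondCountableTopology X] [CompactSpace X]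

/-- A weak solution with square integrable right hand side is continuous away from the pole. -/
theorem IsPosForm.exists_continuousOn_of_isWeakSolution (hη : IsPosForm η) {c : ℝ} {Q : X}
    {w f : X → ℝ} (hw : Integrable w η.measure) (hf : MemLp f 2 η.measure)
    (h : IsWeakSolution η c Q w f) {U : Set X} (hU : IsOpen U) (hQ : c = 0 ∨ Q ∉ U) :
    ∃ g : X → ℝ, ContinuousOn g U ∧ ∀ᵐ y ∂η.measure, y ∈ U → w y = g y := by
  have := hη.isOpenPosMeasure
  have := hη.isFiniteMeasure
  refine exists_continuousOn_of_locally_ae_eq fun x hx => ?_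
  obtain ⟨N, k, s, hxN, hP⟩ := hη.exists_isLocalParametrix x
  refine ⟨N ∩ U, hP.isOpen.inter hU, ⟨hxN, hx⟩, fun x => c * k x Q +
    ∫ y, f y * k x y ∂η.measure - ∫ y, w y * s x y ∂η.measure, ?_, ?_⟩
  · refine ContinuousOn.sub (ContinuousOn.add ?_ ((hP.continuousOn_integral_mul hf).mono
      Set.inter_subset_left)) ((hP.continuousOn_integral_mul_error hw).mono Set.inter_subset_left)
    rcases hQ with rfl | hQ
    · simpa using continuousOn_const
    · intro y hy
      exact ((hP.continuousAt y hy.1 Q fun h => hQ (h ▸ hy.2)).const_mul c).continuousWithinAt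
  · filter_upwards [hP.representation c Q w f hw (hf.integrable (by norm_num)) h] with y hy hyN
    exact hy hyN.1

/-- Weyl's lemma followed by the maximum principle. The interior estimate with zero right-hand side
(the exponent 1/2 is arbitrary) shows that v is C² near z₀, hence harmonic and the real part of a
holomorphic F. The maximum modulus principle applied to exp F, whose modulus is exp v, gives local
constancy. -/
lemma eventually_eq_of_isLocalMax_of_weak_harmonic {v : ℂ → ℝ} {U : Set ℂ} (hU : IsOpen U)
    (hv : ContinuousOn v U) (h : ∀ ψ : ℂ → ℝ, ContDiff ℝ (⊤ : ℕ∞) ψ → HasCompactSupport ψ →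
      tsupport ψ ⊆ U → ∫ z, v z * Laplacian.laplacian ψ z = 0) {z₀ : ℂ} (hz₀ : z₀ ∈ U)
    (hmax : ∀ z ∈ U, v z ≤ v z₀) : ∀ᶠ z in 𝓝 z₀, v z = v z₀ := by
  obtain ⟨K', W, hK', hK'U, hWo, hKW, hWK', C, hC, hb⟩ := exists_holderBound_of_weak_solution
    (β := 1 / 2) (by norm_num) (by norm_num) (isCompact_singleton (x := z₀)) hU
    (Set.singleton_subset_iff.2 hz₀)
  obtain ⟨u, hu, huv⟩ := hb v (fun _ => 0) 0 le_rfl (hv.mono hK'U) continuousOn_const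
    (by simp) (by simp) fun ψ h1 h2 h3 => by simpa using h ψ h1 h2 (h3.trans hK'U)
  have hΔ : Set.EqOn (Laplacian.laplacian u) 0 W := by
    have hc : Continuous (Laplacian.laplacian u) := continuous_laplacian hu.contDiff
    have hae : ∀ᵐ z, z ∈ W → Laplacian.laplacian u z = 0 := by
      refine hWo.ae_eq_zero_of_integral_contDiff_smul_eq_zero
        (hc.locallyIntegrable.locallyIntegrableOn _) fun ψ h1 h2 h3 => ?_
      have h4 := integral_mul_laplacian isOpen_univ hu.contDiff.contDiffOn
        (contDiff_infty.1 h1 2) h2 (Set.subset_univ _)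
      simp only [smul_eq_mul, mul_comm (ψ _)]
      rw [← h4, ← h ψ h1 h2 (h3.trans (hWK'.trans hK'U))]
      refine integral_congr_ae (Eventually.of_forall fun z => ?_)
      by_cases hz : z ∈ W
      · simp only [huv hz]
      · simp only [image_eq_zero_of_notMem_tsupport fun h => hz (h3
          (laplacian_tsupport_subset ψ h)), mul_zero]
    exact Measure.eqOn_open_of_ae_eq (μ := volume) ((ae_restrict_iff' hWo.measurableSet).2 hae) hWo
      hc.continuousOn continuousOn_const
  obtain ⟨r, hr, hrW⟩ := Metric.isOpen_iff.1 hWo z₀ (hKW rfl)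
  obtain ⟨F, hF, hFu⟩ := InnerProductSpace.HarmonicOnNhd.exists_analyticOnNhd_ball_re_eq
    (f := u) (z := z₀) (R := r) fun z hz => ⟨hu.contDiff.contDiffAt, by
      filter_upwards [hWo.mem_nhds (hrW hz)] with y hy using hΔ hy⟩
  have hnorm : ∀ z ∈ Metric.ball z₀ r, ‖Complex.exp (F z)‖ = Real.exp (v z) := fun z hz => by
    rw [Complex.norm_exp, huv (hrW hz), ← hFu hz]
  have hmem : z₀ ∈ Metric.ball z₀ r := Metric.mem_ball_self hr
  have hconst := Complex.norm_eqOn_of_isPreconnected_of_isMaxOn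
    (f := fun z => Complex.exp (F z)) (convex_ball z₀ r).isPreconnected Metric.isOpen_ball
    (fun z hz => ((hF z hz).differentiableAt.cexp).differentiableWithinAt) hmem (fun z hz => by
      simp only [Set.mem_ofPred_eq, Function.comp]
      rw [hnorm z hz, hnorm _ hmem]
      exact Real.exp_le_exp.2 (hmax z (hK'U (hWK' (hrW hz)))))
  filter_upwards [Metric.ball_mem_nhds z₀ hr] with z hz
  have h5 := hconst hz
  simp only [Function.comp, Function.const_apply] at h5
  rw [hnorm z hz, hnorm _ hmem] at h5
  exact Real.exp_injective h5

/-- A weakly harmonic integrable function on a compact connected surface is constant. -/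
theorem IsPosForm.ae_eq_const_of_isWeakSolution_zero [ConnectedSpace X] (hη : IsPosForm η) {Q : X}
    {w : X → ℝ} (hw : Integrable w η.measure) (h : IsWeakSolution η 0 Q w fun _ => 0) :
    ∃ a : ℝ, w =ᵐ[η.measure] fun _ => a := by
  obtain ⟨g, hg, hwg⟩ := hη.exists_continuousOn_of_isWeakSolution hw
    (f := fun _ => 0) (by simp) h isOpen_univ (Or.inl rfl)
  have hgc : Continuous g := continuousOn_univ.1 hg
  have hwg' : w =ᵐ[η.measure] g := by filter_upwards [hwg] with x hx using hx trivial
  have h' := h.congr_ae hwg' (Eventually.of_forall fun _ => rfl)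
  obtain ⟨x₀, -, hx₀⟩ := isCompact_univ.exists_isMaxOn Set.univ_nonempty hg
  refine ⟨g x₀, hwg'.trans (Eventually.of_forall ?_)⟩
  -- The set where the continuous representative attains its maximum is closed, and open by the
  -- local maximum principle; connectedness finishes.
  have hcl : IsClopen {x | g x = g x₀} := by
    refine ⟨isClosed_eq hgc continuous_const, isOpen_iff_mem_nhds.2 fun x hx => ?_⟩
    have he := chart_mem_atlas ℂ x
    set e := chartAt ℂ x
    have hxe : x ∈ e.source := mem_chart_source ℂ x
    have h1 := eventually_eq_of_isLocalMax_of_weak_harmonic (v := fun z => g (e.symm z))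
      e.open_target (hgc.comp_continuousOn e.continuousOn_symm) (fun ψ h1 h2 h3 => by
        have hψ : IsChartTest e ψ := ⟨h1, h2, h3⟩
        have h4 := h' e he ψ hψ
        rw [hη.integral_mul_chartLaplacian he hψ hgc.aestronglyMeasurable,
          hψ.setIntegral_mul_laplacian fun z => g (e.symm z)] at h4
        simpa using h4) (e.map_source hxe) (fun z _ => by
        rw [e.left_inv hxe, show g x = g x₀ from hx]
        exact hx₀ (Set.mem_univ _))
    filter_upwards [(e.continuousAt hxe).eventually h1, e.open_source.mem_nhds hxe] with y hy hye
    rw [e.left_inv hye, e.left_inv hxe] at hy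
    exact hy.trans hx
  have := hcl.eq_univ ⟨x₀, rfl⟩
  exact fun x => (Set.eq_univ_iff_forall.1 this x : _)

end surface

/-! ### The Poisson equation in `L²` -/

lemma inner_toLp_right {α : Type*} [MeasurableSpace α] {μ : Measure α} (w : Lp ℝ 2 μ) {g : α → ℝ}
    (hg : MemLp g 2 μ) : inner ℝ w (hg.toLp g) = ∫ x, w x * g x ∂μ := by
  rw [← inner_toLp_eq_integral (Lp.memLp w) hg, Lp.toLp_coeFn]

lemma integral_abs_le_mul_norm {α : Type*} [MeasurableSpace α] {μ : Measure α} [IsFiniteMeasure μ]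
    (w : Lp ℝ 2 μ) :
    ∫ x, |w x| ∂μ ≤ (eLpNorm (fun _ : α => (1 : ℝ)) 2 μ).toReal * ‖w‖ := by
  have h := abs_integral_mul_le (memLp_const (1 : ℝ)) (Lp.memLp w).abs (μ := μ)
  simp only [one_mul] at h
  have h2 : eLpNorm (fun x => |w x|) 2 μ = eLpNorm w 2 μ := eLpNorm_norm (f := ⇑w)
  calc _ ≤ |∫ x, |w x| ∂μ| := le_abs_self _
    _ ≤ _ := h
    _ = _ := by rw [Lp.norm_def, ← h2]; rfl

section surface

variable {X : Type*} [TopologicalSpace X] [T2Space X] [ChartedSpace ℂ X]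
  [IsManifold (modelWithCornersSelf ℂ ℂ) 1 X] [MeasurableSpace X] [BorelSpace X]
  {η : RealTwoForm X} [SecondCountableTopology X] [CompactSpace X]

lemma memLp_of_continuous {μ : Measure X} [IsFiniteMeasure μ] {F : X → ℝ} (hF : Continuous F)
    (p : ℝ≥0∞) : MemLp F p μ := by
  obtain ⟨C, hC⟩ := isCompact_univ.exists_bound_of_continuousOn hF.continuousOn
  exact MemLp.of_bound hF.aestronglyMeasurable C (Eventually.of_forall fun x => hC x trivial)

lemma IsLocalParametrix.memLp_error [IsFiniteMeasure η.measure] {N : Set X} {k s : X → X → ℝ}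
    (h : IsLocalParametrix η N k s) (x : X) : MemLp (s x) 2 η.measure := by
  obtain ⟨C, hC⟩ := h.bounded
  exact MemLp.of_bound (h.aestronglyMeasurable x) C (Eventually.of_forall fun y => hC x y)

/-- The pairs `(w, f)` of square integrable functions with `dd^c w = f η`. -/
def IsPosForm.weakGraph (hη : IsPosForm η) : Submodule ℝ (Lp ℝ 2 η.measure × Lp ℝ 2 η.measure) where
  carrier := {p | ∀ Q, IsWeakSolution η 0 Q p.1 p.2}
  zero_mem' := fun Q => (hη.isWeakSolution_const 0 Q).congr_ae (Lp.coeFn_zero ..).symm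
    (Lp.coeFn_zero ..).symm
  add_mem' := fun {a b} ha hb Q => by
    have := hη.isFiniteMeasure
    have hi : ∀ w : Lp ℝ 2 η.measure, Integrable w η.measure := fun w =>
      (Lp.memLp w).integrable (by norm_num)
    have h := (ha Q).add hη (hb Q) (hi _) (hi _) (hi _) (hi _)
    rw [add_zero] at h
    exact h.congr_ae (Lp.coeFn_add ..).symm (Lp.coeFn_add ..).symm
  smul_mem' := fun c a ha Q => by
    have h := (ha Q).const_mul c
    rw [mul_zero] at h
    exact h.congr_ae (Lp.coeFn_smul c a.1).symm (Lp.coeFn_smul c a.2).symm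

/-- Each test function imposes an equality between inner products with fixed elements of L². The
Laplacian is thus a closed, possibly unbounded, operator. -/
lemma IsPosForm.isClosed_weakGraph (hη : IsPosForm η) :
    IsClosed (hη.weakGraph : Set (Lp ℝ 2 η.measure × Lp ℝ 2 η.measure)) := by
  have := hη.isFiniteMeasure
  have : (hη.weakGraph : Set (Lp ℝ 2 η.measure × Lp ℝ 2 η.measure)) =
      ⋂ (_ : X) (e : OpenPartialHomeomorph X ℂ) (_ : e ∈ atlas ℂ X) (ψ : ℂ → ℝ)
        (_ : IsChartTest e ψ), {p | ∫ x, p.1 x * chartLaplacian η e ψ x ∂η.measure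
          = ∫ x, p.2 x * chartExtend e ψ x ∂η.measure} := by
    ext p
    simp [IsPosForm.weakGraph, IsWeakSolution]
  rw [this]
  refine isClosed_iInter fun _ => isClosed_iInter fun e => isClosed_iInter fun he =>
    isClosed_iInter fun ψ => isClosed_iInter fun hψ => ?_
  have h1 := memLp_of_continuous (μ := η.measure) (hη.continuous_chartLaplacian he hψ) 2
  have h2 := memLp_of_continuous (μ := η.measure) hψ.continuous_chartExtend 2
  simp only [← inner_toLp_right _ h1, ← inner_toLp_right _ h2]
  exact isClosed_eq (continuous_fst.inner continuous_const) (continuous_snd.inner continuous_const)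

/-- A priori estimate for the Poisson equation, up to finitely many functionals. -/
theorem IsPosForm.exists_norm_le_of_isWeakSolution (hη : IsPosForm η) :
    ∃ (t : Finset X) (σ : X → Lp ℝ 2 η.measure) (C : ℝ), 0 ≤ C ∧ ∀ p ∈ hη.weakGraph,
      ‖p.1‖ ≤ C * (‖p.2‖ + ∑ x ∈ t, |inner ℝ p.1 (σ x)|) := by
  have := hη.isFiniteMeasure
  set a : ℝ := (measureUnivNNReal η.measure : ℝ) ^ (2 : ℝ≥0∞).toReal⁻¹ with ha
  set b : ℝ := (eLpNorm (fun _ : X => (1 : ℝ)) 2 η.measure).toReal with hb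
  have ha0 : 0 ≤ a := by positivity
  have hb0 : 0 ≤ b := ENNReal.toReal_nonneg
  -- Here a passes from a sup bound to the L² norm and b from the L² norm to the L¹ norm. The choice
  -- of ε lets the error term, at most half of ‖w‖, be absorbed on the left.
  set ε : ℝ := 1 / (2 * (a * b + 1)) with hε
  have hε0 : 0 < ε := by positivity
  have hεab : a * (ε * b) ≤ 1 / 2 := by
    rw [hε, mul_left_comm, div_mul_eq_mul_div, one_mul, div_le_iff₀ (by positivity)]
    linarith
  choose N k s hxN hP using fun x => hη.exists_isLocalParametrix x
  set M : X → Set X := fun x => N x ∩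
    {y | eLpNorm (fun t => k x y t - k x x t) 2 η.measure ≤ 1 ∧ ∀ t, |s x y t - s x x t| ≤ ε}
  have hM : ∀ x, M x ∈ 𝓝 x := fun x => by
    filter_upwards [(hP x).isOpen.mem_nhds (hxN x), (hP x).uniform x (hxN x) ε hε0,
      ((hP x).tendsto_eLpNorm x (hxN x)).eventually (Iic_mem_nhds zero_lt_one)] with y h1 h2 h3
    exact ⟨h1, h3, h2⟩
  obtain ⟨t, -, ht⟩ := isCompact_univ.elim_nhds_subcover M fun x _ => hM x
  set c : X → ℝ := fun x => (eLpNorm (k x x) 2 η.measure).toReal + 1 with hc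
  have hc0 : ∀ x, 0 ≤ c x := fun x => add_nonneg ENNReal.toReal_nonneg zero_le_one
  have hkc : ∀ x, ∀ y ∈ M x, (eLpNorm (k x y) 2 η.measure).toReal ≤ c x := fun x y hy => by
    have h1 := (hP x).memLp x
    have h2 := (hP x).memLp y
    have h3 : eLpNorm (k x y) 2 η.measure ≤ eLpNorm (k x x) 2 η.measure + 1 := by
      calc eLpNorm (k x y) 2 η.measure
          = eLpNorm (k x x + fun t => k x y t - k x x t) 2 η.measure := by
            congr 1; ext t; simp
        _ ≤ _ := (eLpNorm_add_le h1.1 (h2.sub h1).1 (by norm_num)).trans (by gcongr; exact hy.2.1)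
    have h4 := ENNReal.toReal_mono (ENNReal.add_ne_top.2 ⟨h1.2.ne, ENNReal.one_ne_top⟩) h3
    rwa [ENNReal.toReal_add h1.2.ne ENNReal.one_ne_top, ENNReal.toReal_one] at h4
  set K : ℝ := ∑ x ∈ t, c x
  have hK0 : 0 ≤ K := Finset.sum_nonneg fun x _ => hc0 x
  refine ⟨t, fun x => ((hP x).memLp_error x).toLp (s x x), 2 * a * (K + 1),
    mul_nonneg (mul_nonneg zero_le_two ha0) (add_nonneg hK0 zero_le_one),
    fun p hp => ?_⟩
  set w := p.1
  set f := p.2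
  have hw : Integrable w η.measure := (Lp.memLp w).integrable (by norm_num)
  have hf : Integrable f η.measure := (Lp.memLp f).integrable (by norm_num)
  set T : ℝ := ∑ x ∈ t, |inner ℝ w (((hP x).memLp_error x).toLp (s x x))| with hT
  have hT0 : 0 ≤ T := Finset.sum_nonneg fun x _ => abs_nonneg _
  have hae : ∀ᵐ y ∂η.measure, ∀ x ∈ t, y ∈ N x → w y = 0 * k x y x
      + ∫ z, f z * k x y z ∂η.measure - ∫ z, w z * s x y z ∂η.measure :=
    (ae_ball_iff t.countable_toSet).2 fun x _ => (hP x).representation 0 x w f hw hf (hp x)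
  -- In the local formula at y, the kernel s x y is replaced by its value s x x at the centre. The
  -- difference costs ε times the L¹ norm of w, and what remains is one of finitely many fixed
  -- functionals of w.
  have hbd : ∀ᵐ y ∂η.measure, ‖w y‖ ≤ K * ‖f‖ + T + ε * (b * ‖w‖) := by
    filter_upwards [hae] with y hy
    have hy' : y ∈ ⋃ x ∈ t, M x := ht trivial
    obtain ⟨x, hx, hyx⟩ := Set.mem_iUnion₂.1 hy'
    rw [hy x hx hyx.1, zero_mul, zero_add]
    have h1 : |∫ z, f z * k x y z ∂η.measure| ≤ K * ‖f‖ := by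
      refine (abs_integral_mul_le (Lp.memLp f) ((hP x).memLp y)).trans ?_
      rw [show (eLpNorm f 2 η.measure).toReal = ‖f‖ from rfl, mul_comm]
      exact mul_le_mul_of_nonneg_right ((hkc x y hyx).trans
        (Finset.single_le_sum (f := c) (fun x _ => hc0 x) hx)) (norm_nonneg _)
    have h2 := (hP x).abs_integral_sub_le hw hyx.2.2
    have h3 : |∫ z, w z * s x x z ∂η.measure| ≤ T := by
      rw [← inner_toLp_right w ((hP x).memLp_error x)]
      exact Finset.single_le_sum
        (f := fun x => |inner ℝ w (((hP x).memLp_error x).toLp (s x x))|)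
        (fun x _ => abs_nonneg _) hx
    have h4 := mul_le_mul_of_nonneg_left (integral_abs_le_mul_norm w) hε0.le
    rw [Real.norm_eq_abs]
    rw [abs_le] at h1 h2 h3 ⊢
    constructor <;> linarith
  have h5 := Lp.norm_le_of_ae_bound (add_nonneg (add_nonneg (mul_nonneg hK0 (norm_nonneg f)) hT0)
    (mul_nonneg hε0.le (mul_nonneg hb0 (norm_nonneg w)))) hbd
  rw [← ha] at h5
  have h6 : a * (ε * (b * ‖w‖)) ≤ 1 / 2 * ‖w‖ := by
    calc _ = a * (ε * b) * ‖w‖ := by ring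
      _ ≤ _ := mul_le_mul_of_nonneg_right hεab (norm_nonneg _)
  have h7 : K * ‖f‖ + T ≤ (K + 1) * (‖f‖ + T) := by nlinarith [norm_nonneg f]
  have h8 := mul_le_mul_of_nonneg_left h7 ha0
  rw [mul_add] at h5
  linarith

end surface

/-- On the kernel of L, which is complete and of finite codimension, f is bounded below, so the
image of this kernel is closed. The full range differs from it by a finite-dimensional space. -/
lemma isClosed_range_of_norm_le_on_ker {E F G : Type*} [NormedAddCommGroup E] [NormedSpace ℝ E]
    [CompleteSpace E] [NormedAddCommGroup F] [NormedSpace ℝ F] [NormedAddCommGroup G]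
    [NormedSpace ℝ G] [FiniteDimensional ℝ G] (f : E →L[ℝ] F) (L : E →L[ℝ] G) (C : ℝ)
    (h : ∀ x, L x = 0 → ‖x‖ ≤ C * ‖f x‖) :
    IsClosed ((f : E →ₗ[ℝ] F).range : Set F) := by
  set S := (L : E →ₗ[ℝ] G).ker
  have hcofg : S.CoFG := Submodule.CoFG.ker _
  have : CompleteSpace S := ContinuousLinearMap.completeSpace_ker L
  have hanti : AntilipschitzWith C.toNNReal (f.comp S.subtypeL) := by
    refine ContinuousLinearMap.antilipschitz_of_bound _ fun p => ?_
    refine (h p p.2).trans (mul_le_mul_of_nonneg_right (Real.le_coe_toNNReal C) (norm_nonneg _))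
  have hcl := hanti.isClosed_range (f.comp S.subtypeL).uniformContinuous
  refine LinearMap.isClosed_range_of_isClosed_map_of_finiteDimensional_quotient (s := S) ?_
  convert hcl using 1
  ext y
  simp

section surface

variable {X : Type*} [TopologicalSpace X] [T2Space X] [ChartedSpace ℂ X]
  [IsManifold (modelWithCornersSelf ℂ ℂ) 1 X] [MeasurableSpace X] [BorelSpace X]
  {η : RealTwoForm X} [SecondCountableTopology X] [CompactSpace X]

/-- The finitely many functionals of the a priori estimate form the map L; where they vanish, the
estimate bounds w by its Laplacian. -/
lemma IsPosForm.isClosed_range_snd (hη : IsPosForm η) :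
    IsClosed ((((LinearMap.snd ℝ (Lp ℝ 2 η.measure) (Lp ℝ 2 η.measure)).comp
      hη.weakGraph.subtype).range : Submodule ℝ (Lp ℝ 2 η.measure)) : Set (Lp ℝ 2 η.measure)) := by
  obtain ⟨t, σ, C, hC, hest⟩ := hη.exists_norm_le_of_isWeakSolution
  set D := hη.weakGraph with hD
  have : CompleteSpace D := hη.isClosed_weakGraph.completeSpace_coe
  set L : D →L[ℝ] (t → ℝ) := ContinuousLinearMap.pi fun x =>
    (innerSL ℝ (σ x)).comp ((ContinuousLinearMap.fst ℝ _ _).comp D.subtypeL) with hL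
  -- The norm of a pair is the maximum of the two norms, so the bound must also cover the second
  -- component; hence `max C 1`.
  refine isClosed_range_of_norm_le_on_ker ((ContinuousLinearMap.snd ℝ _ _).comp D.subtypeL) L
    (max C 1) fun p hp => ?_
  have h1 := hest p p.2
  have h2 : ∑ x ∈ t, |inner ℝ p.1.1 (σ x)| = 0 := by
    refine Finset.sum_eq_zero fun x hx => ?_
    have h4 := congrFun hp ⟨x, hx⟩
    rw [real_inner_comm]
    simpa [hL] using h4
  rw [h2, add_zero] at h1
  have h7 := norm_nonneg p.1.2
  refine max_le (h1.trans (mul_le_mul_of_nonneg_right (le_max_left _ _) h7)) ?_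
  have h8 := mul_le_mul_of_nonneg_right (le_max_right C 1) h7
  rwa [one_mul] at h8

lemma IsPosForm.mk_mem_weakGraph (hη : IsPosForm η) {w f : X → ℝ} (hw : MemLp w 2 η.measure)
    (hf : MemLp f 2 η.measure) (h : ∀ Q, IsWeakSolution η 0 Q w f) :
    (hw.toLp w, hf.toLp f) ∈ hη.weakGraph := fun Q =>
  (h Q).congr_ae hw.coeFn_toLp.symm hf.coeFn_toLp.symm

variable [ConnectedSpace X]

/-- The range is closed, hence equal to its double orthogonal complement. A function orthogonal to
the range is orthogonal to the Laplacians of all test functions, so it is weakly harmonic and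
therefore constant. A function of mean zero is orthogonal to constants. -/
theorem IsPosForm.exists_mem_weakGraph (hη : IsPosForm η) {f : Lp ℝ 2 η.measure}
    (hf : ∫ x, f x ∂η.measure = 0) : ∃ w, (w, f) ∈ hη.weakGraph := by
  have := hη.isFiniteMeasure
  set R := ((LinearMap.snd ℝ (Lp ℝ 2 η.measure) (Lp ℝ 2 η.measure)).comp
      hη.weakGraph.subtype).range with hR
  have hcl : IsClosed (R : Set (Lp ℝ 2 η.measure)) := hη.isClosed_range_snd
  have : CompleteSpace R := hcl.completeSpace_coe
  have hfR : f ∈ R := by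
    rw [← R.orthogonal_orthogonal]
    refine (Submodule.mem_orthogonal _ _).2 fun h hh => ?_
    have hweak : IsWeakSolution η 0 (Classical.arbitrary X) h fun _ => 0 := by
      intro e he ψ hψ
      have h1 := memLp_of_continuous (μ := η.measure) (hη.continuous_chartLaplacian he hψ) 2
      have h2 := memLp_of_continuous (μ := η.measure) hψ.continuous_chartExtend 2
      have hm : h1.toLp _ ∈ R := ⟨⟨_, hη.mk_mem_weakGraph h2 h1 fun Q =>
        hη.isWeakSolution_chartExtend he hψ Q⟩, rfl⟩
      rw [← inner_toLp_right h h1, real_inner_comm, (Submodule.mem_orthogonal _ _).1 hh _ hm]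
      simp
    obtain ⟨a, ha⟩ := hη.ae_eq_const_of_isWeakSolution_zero
      ((Lp.memLp h).integrable (by norm_num)) hweak
    rw [real_inner_comm, ← Lp.toLp_coeFn f (Lp.memLp f), ← Lp.toLp_coeFn h (Lp.memLp h),
      inner_toLp_eq_integral, integral_congr_ae (g := fun x => f x * a)
      (by filter_upwards [ha] with x hx; rw [hx]), integral_mul_const, hf, zero_mul]
  obtain ⟨p, hp⟩ := hfR
  exact ⟨p.1.1, by rw [← hp]; exact p.2⟩

/-- Square integrable functions of mean zero. -/
def meanZero (η : RealTwoForm X) [IsFiniteMeasure η.measure] : Submodule ℝ (Lp ℝ 2 η.measure) :=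
  (ℝ ∙ (memLp_const (1 : ℝ)).toLp (fun _ : X => (1 : ℝ)))ᗮ

lemma mem_meanZero [IsFiniteMeasure η.measure] {f : Lp ℝ 2 η.measure} :
    f ∈ meanZero η ↔ ∫ x, f x ∂η.measure = 0 := by
  rw [meanZero, Submodule.mem_orthogonal_singleton_iff_inner_left, inner_toLp_right]
  simp

instance [IsFiniteMeasure η.measure] : CompleteSpace (meanZero η) :=
  (Submodule.isClosed_orthogonal _).completeSpace_coe

lemma IsPosForm.eq_zero_of_isWeakSolution_zero (hη : IsPosForm η) {w : Lp ℝ 2 η.measure} {Q : X}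
    (h : IsWeakSolution η 0 Q w fun _ => 0) (h0 : ∫ x, w x ∂η.measure = 0) : w = 0 := by
  have := hη.isFiniteMeasure
  have := hη.isOpenPosMeasure
  obtain ⟨a, ha⟩ := hη.ae_eq_const_of_isWeakSolution_zero
    ((Lp.memLp w).integrable (by norm_num)) h
  rw [integral_congr_ae ha, integral_const, smul_eq_mul] at h0
  have hpos : 0 < η.measure.real Set.univ :=
    ENNReal.toReal_pos (isOpen_univ.measure_ne_zero _ Set.univ_nonempty) (measure_ne_top _ _)
  have ha0 : a = 0 := by
    rcases mul_eq_zero.1 h0 with h | h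
    · exact absurd h hpos.ne'
    · exact h
  refine Lp.ext ?_
  filter_upwards [ha, Lp.coeFn_zero ℝ 2 η.measure] with x h1 h2
  rw [h1, h2, ha0]; rfl

/-- The solution operator of the Poisson equation. -/
theorem IsPosForm.exists_solution_operator (hη : IsPosForm η) :
    ∃ A : Lp ℝ 2 η.measure →L[ℝ] Lp ℝ 2 η.measure, ∀ f : Lp ℝ 2 η.measure,
      ∫ x, f x ∂η.measure = 0 → (A f, f) ∈ hη.weakGraph ∧ ∫ x, A f x ∂η.measure = 0 := by
  have := hη.isFiniteMeasure
  have := hη.isOpenPosMeasure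
  set K := meanZero η with hK
  have hKc : IsClosed (K : Set (Lp ℝ 2 η.measure)) := Submodule.isClosed_orthogonal _
  set D := hη.weakGraph ⊓ K.prod K with hD
  have hDc : IsClosed (D : Set (Lp ℝ 2 η.measure × Lp ℝ 2 η.measure)) :=
    hη.isClosed_weakGraph.inter (hKc.prod hKc)
  have : CompleteSpace D := hDc.completeSpace_coe
  -- Between functions of mean zero, the projection of the graph to its second component is a
  -- continuous bijection of Banach spaces. Its inverse is bounded by the open mapping theorem.
  set g : D →L[ℝ] K := ((ContinuousLinearMap.snd ℝ _ _).comp D.subtypeL).codRestrict K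
    fun p => p.2.2.2 with hg
  have hker : (g : D →ₗ[ℝ] K).ker = ⊥ := by
    refine LinearMap.ker_eq_bot'.2 fun p hp => ?_
    have h2 : p.1.2 = 0 := congrArg Subtype.val hp
    have h1 : p.1.1 = 0 := by
      refine hη.eq_zero_of_isWeakSolution_zero (Q := Classical.arbitrary X) ?_
        (mem_meanZero.1 p.2.2.1)
      refine (p.2.1 _).congr_ae (Eventually.of_forall fun _ => rfl) ?_
      rw [h2]
      exact Lp.coeFn_zero ..
    exact Subtype.ext (Prod.ext h1 h2)
  have hsurj : (g : D →ₗ[ℝ] K).range = ⊤ := by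
    refine LinearMap.range_eq_top.2 fun f => ?_
    obtain ⟨w, hw⟩ := hη.exists_mem_weakGraph (mem_meanZero.1 f.2)
    set one := (memLp_const (1 : ℝ) (p := 2) (μ := η.measure)).toLp (fun _ : X => (1 : ℝ)) with hone
    have hpos : 0 < η.measure.real Set.univ :=
      ENNReal.toReal_pos (isOpen_univ.measure_ne_zero _ Set.univ_nonempty) (measure_ne_top _ _)
    have hone_mem : ∀ a : ℝ, (a • one, (0 : Lp ℝ 2 η.measure)) ∈ hη.weakGraph := fun a Q => by
      refine (hη.isWeakSolution_const a Q).congr_ae ?_ (Lp.coeFn_zero ..).symm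
      filter_upwards [Lp.coeFn_smul a one, (memLp_const (1 : ℝ) (p := 2)
        (μ := η.measure)).coeFn_toLp] with x h1 h2
      rw [h1, Pi.smul_apply, hone, h2, smul_eq_mul, mul_one]
    -- Subtracting the mean of w does not change its Laplacian.
    set a := (∫ x, w x ∂η.measure) / η.measure.real Set.univ with ha
    have hmean : w - a • one ∈ K := by
      rw [mem_meanZero, integral_congr_ae (Lp.coeFn_sub ..)]
      have h1 : (⇑w - ⇑(a • one)) =ᵐ[η.measure] fun x => w x - a := by
        filter_upwards [Lp.coeFn_smul a one, (memLp_const (1 : ℝ) (p := 2)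
          (μ := η.measure)).coeFn_toLp] with x h1 h2
        rw [Pi.sub_apply, h1, Pi.smul_apply, hone, h2, smul_eq_mul, mul_one]
      rw [integral_congr_ae h1, integral_sub ((Lp.memLp w).integrable (by norm_num))
        (integrable_const _), integral_const, smul_eq_mul, ha]
      field_simp
      ring
    refine ⟨⟨(w - a • one, f), ?_, hmean, f.2⟩, rfl⟩
    have := hη.weakGraph.sub_mem hw (hone_mem a)
    simpa using this
  set A := ContinuousLinearEquiv.ofBijective g hker hsurj with hA
  -- The inverse is extended to all of L² by first projecting to mean zero, so that it has an
  -- adjoint on L².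
  refine ⟨((ContinuousLinearMap.fst ℝ _ _).comp D.subtypeL).comp
    ((A.symm : K →L[ℝ] D).comp K.orthogonalProjectionOnto), fun f hf => ?_⟩
  have hfK : f ∈ K := mem_meanZero.2 hf
  have h1 : K.orthogonalProjectionOnto f = ⟨f, hfK⟩ := by
    exact Submodule.orthogonalProjectionOnto_mem_subspace_eq_self (⟨f, hfK⟩ : K)
  set p := A.symm ⟨f, hfK⟩ with hp
  have h2 : p.1.2 = f := congrArg Subtype.val (A.apply_symm_apply ⟨f, hfK⟩)
  have h3 : (((ContinuousLinearMap.fst ℝ _ _).comp D.subtypeL).comp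
    ((A.symm : K →L[ℝ] D).comp K.orthogonalProjectionOnto)) f = p.1.1 := by
    simp [h1, hp]
  rw [h3]
  refine ⟨?_, mem_meanZero.1 p.2.2.1⟩
  have h4 := p.2.1
  rwa [← Prod.mk.eta (p := p.1), h2] at h4

end surface

/-! ### Green's functions as square integrable functions -/

section surface

variable {X : Type*} [TopologicalSpace X] [T2Space X] [ChartedSpace ℂ X]
  [IsManifold (modelWithCornersSelf ℂ ℂ) 1 X] [MeasurableSpace X] [BorelSpace X]
  {η : RealTwoForm X} [SecondCountableTopology X] [CompactSpace X]

lemma IsLocalParametrix.continuousOn_toLp {N : Set X} {k s : X → X → ℝ}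
    (h : IsLocalParametrix η N k s) : ContinuousOn (fun x => (h.memLp x).toLp (k x)) N := by
  intro x hx
  refine ContinuousAt.continuousWithinAt ?_
  exact (Lp.tendsto_Lp_iff_tendsto_eLpNorm'' (fi := 𝓝 x) k h.memLp (k x) (h.memLp x)).2
    (h.tendsto_eLpNorm x hx)

lemma IsLocalParametrix.continuousOn_toLp_error [IsFiniteMeasure η.measure] {N : Set X}
    {k s : X → X → ℝ} (h : IsLocalParametrix η N k s) :
    ContinuousOn (fun x => (h.memLp_error x).toLp (s x)) N := by
  intro x hx
  refine ContinuousAt.continuousWithinAt ?_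
  rw [Metric.continuousAt_iff']
  intro ε hε
  set a : ℝ := (measureUnivNNReal η.measure : ℝ) ^ (2 : ℝ≥0∞).toReal⁻¹ with ha
  have ha0 : 0 ≤ a := by positivity
  filter_upwards [h.uniform x hx (ε / (a + 1)) (by positivity)] with y hy
  rw [dist_eq_norm, ← MemLp.toLp_sub]
  refine (Lp.norm_le_of_ae_bound (C := ε / (a + 1)) (by positivity) ?_).trans_lt ?_
  · filter_upwards [((h.memLp_error y).sub (h.memLp_error x)).coeFn_toLp] with t ht
    rw [ht]
    exact hy t
  · rw [← ha, mul_div_left_comm]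
    have : a / (a + 1) < 1 := by rw [div_lt_one (by positivity)]; linarith
    nlinarith

variable [ConnectedSpace X]

lemma IsPosForm.vol_pos (hη : IsPosForm η) : 0 < η.vol := by
  have := hη.isFiniteMeasure
  have := hη.isOpenPosMeasure
  exact ENNReal.toReal_pos (isOpen_univ.measure_ne_zero _ Set.univ_nonempty) (measure_ne_top _ _)

/-- Let φ have mean zero and Laplacian F, so that φ = A F. The local formula gives φ(Q) = ⟨F, k_Q⟩ -
⟨A F, s_Q⟩ = ⟨F, k_Q - A* s_Q⟩. Thus the mean-zero part of k_Q - A* s_Q is a Green's function, and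
it inherits continuity in Q from the two kernels. -/
lemma IsPosForm.exists_local_green (hη : IsPosForm η) (x₀ : X) :
    ∃ N : Set X, N ∈ 𝓝 x₀ ∧ ∃ g : X → Lp ℝ 2 η.measure, ContinuousOn g N ∧ ∀ Q ∈ N,
      ∫ x, g Q x ∂η.measure = 0 ∧ IsWeakSolution η 1 Q (g Q) fun _ => -(1 / η.vol) := by
  have := hη.isFiniteMeasure
  have := hη.isOpenPosMeasure
  obtain ⟨A, hA⟩ := hη.exists_solution_operator
  obtain ⟨N, k, s, hxN, hP⟩ := hη.exists_isLocalParametrix x₀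
  set K := meanZero η with hK
  set kL : X → Lp ℝ 2 η.measure := fun x => (hP.memLp x).toLp (k x) with hkL
  set sL : X → Lp ℝ 2 η.measure := fun x => (hP.memLp_error x).toLp (s x) with hsL
  refine ⟨N, hP.isOpen.mem_nhds hxN, fun x => K.starProjection
    (kL x - ContinuousLinearMap.adjoint A (sL x)), ?_, fun Q hQ =>
    ⟨mem_meanZero.1 (K.starProjection_apply_mem _), ?_⟩⟩
  · exact K.starProjection.continuous.comp_continuousOn (hP.continuousOn_toLp.sub
      ((ContinuousLinearMap.adjoint A).continuous.comp_continuousOn hP.continuousOn_toLp_error))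
  intro e he ψ hψ
  set F := chartLaplacian η e ψ with hF
  have hFc : Continuous F := hη.continuous_chartLaplacian he hψ
  have hψc : Continuous (chartExtend e ψ) := hψ.continuous_chartExtend
  have hFm := memLp_of_continuous (μ := η.measure) hFc 2
  set FL := hFm.toLp F with hFL
  have hF0 : ∫ x, FL x ∂η.measure = 0 := by
    rw [integral_congr_ae hFm.coeFn_toLp]
    exact hη.integral_chartLaplacian he hψ
  -- The mean of the test function is subtracted; it reappears as the term -1 / vol on the
  -- right-hand side of the Green's equation.
  set m := (∫ x, chartExtend e ψ x ∂η.measure) / η.vol with hm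
  set φ : X → ℝ := fun x => chartExtend e ψ x - m with hφ
  have hφc : Continuous φ := hψc.sub continuous_const
  have hφm := memLp_of_continuous (μ := η.measure) hφc 2
  have hi : ∀ {u : X → ℝ}, Continuous u → Integrable u η.measure := fun hu =>
    (memLp_of_continuous (μ := η.measure) hu 2).integrable (by norm_num)
  have hweak : ∀ Q, IsWeakSolution η 0 Q φ F := fun Q => by
    have := (hη.isWeakSolution_chartExtend he hψ Q).sub hη (hη.isWeakSolution_const m Q)
      (hi hψc) (hi hFc) (integrable_const _) (integrable_const _)
    simpa using this
  have hφ0 : ∫ x, φ x ∂η.measure = 0 := by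
    rw [hφ, integral_sub (hi hψc) (integrable_const _), integral_const, smul_eq_mul]
    have := hη.vol_pos.ne'
    rw [show η.measure.real Set.univ = η.vol from rfl, hm]
    field_simp
    ring
  have hAF : A FL = hφm.toLp φ := by
    rw [← sub_eq_zero]
    obtain ⟨h1, h2⟩ := hA FL hF0
    have h3 := hη.weakGraph.sub_mem h1 (hη.mk_mem_weakGraph hφm hFm hweak)
    rw [Prod.mk_sub_mk, sub_self] at h3
    refine hη.eq_zero_of_isWeakSolution_zero (Q := Q) ((h3 Q).congr_ae
      (Eventually.of_forall fun _ => rfl) (Lp.coeFn_zero ..)) ?_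
    rw [integral_congr_ae (Lp.coeFn_sub ..), integral_congr_ae (g := fun x => A FL x - φ x)
      (by filter_upwards [hφm.coeFn_toLp] with x hx; rw [Pi.sub_apply, hx]),
      integral_sub ((Lp.memLp _).integrable (by norm_num)) (hi hφc), h2, hφ0, sub_zero]
  -- The local formula holds almost everywhere; since both sides are continuous on N, it may be
  -- evaluated at the single point Q.
  have hrep : Set.EqOn φ (fun y => ∫ z, F z * k y z ∂η.measure - ∫ z, φ z * s y z ∂η.measure) N := by
    refine Measure.eqOn_open_of_ae_eq (μ := η.measure) ?_ hP.isOpen hφc.continuousOn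
      ((hP.continuousOn_integral_mul hFm).sub (hP.continuousOn_integral_mul_error (hi hφc)))
    refine (ae_restrict_iff' hP.isOpen.measurableSet).2 ?_
    filter_upwards [hP.representation 0 Q φ F (hi hφc) (hi hFc) (hweak Q)] with y hy hyN
    simpa using hy hyN
  -- The projection is self-adjoint and fixes F, which has mean zero, so it disappears from the
  -- pairing.
  rw [← inner_toLp_right _ hFm, Submodule.inner_starProjection_left_eq_right,
    K.starProjection_eq_self_iff.2 (mem_meanZero.2 hF0), inner_sub_left,
    ContinuousLinearMap.adjoint_inner_left, hAF, hkL, hsL, hFL, inner_toLp_eq_integral,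
    inner_toLp_eq_integral]
  have h4 := hrep hQ
  simp only [mul_comm (k Q _), mul_comm (s Q _)]
  simp only at h4
  rw [← h4, hφ, integral_const_mul, hm]
  ring

lemma IsPosForm.green_Lp_unique (hη : IsPosForm η) {Q : X} {a : ℝ} {g g' : Lp ℝ 2 η.measure}
    (hg : IsWeakSolution η 1 Q g fun _ => a) (hg0 : ∫ x, g x ∂η.measure = 0)
    (hg' : IsWeakSolution η 1 Q g' fun _ => a) (hg0' : ∫ x, g' x ∂η.measure = 0) : g = g' := by
  have := hη.isFiniteMeasure
  have hi : ∀ w : Lp ℝ 2 η.measure, Integrable w η.measure := fun w =>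
    (Lp.memLp w).integrable (by norm_num)
  rw [← sub_eq_zero]
  have h := hg.sub hη hg' (hi _) (integrable_const _) (hi _) (integrable_const _)
  refine hη.eq_zero_of_isWeakSolution_zero (Q := Q) ?_ ?_
  · have h2 := h.congr_ae (Lp.coeFn_sub g g').symm (Eventually.of_forall fun _ => rfl)
    simpa using h2
  · rw [integral_congr_ae (Lp.coeFn_sub ..)]
    exact (integral_sub (hi g) (hi g')).trans (by rw [hg0, hg0', sub_zero])

/-- Green's functions as a continuous family of square integrable functions. -/
theorem IsPosForm.exists_continuous_green (hη : IsPosForm η) :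
    ∃ g : X → Lp ℝ 2 η.measure, Continuous g ∧ ∀ Q,
      ∫ x, g Q x ∂η.measure = 0 ∧ IsWeakSolution η 1 Q (g Q) fun _ => -(1 / η.vol) := by
  choose N hN g hgc hg using hη.exists_local_green
  have hmem : ∀ x, x ∈ N x := fun x => mem_of_mem_nhds (hN x)
  -- By uniqueness the local families agree at common poles, so the diagonal choice coincides near
  -- each x with one continuous family.
  refine ⟨fun x => g x x, continuous_iff_continuousAt.2 fun x => ?_, fun Q => hg Q Q (hmem Q)⟩
  refine ((hgc x).continuousAt (hN x)).congr ?_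
  filter_upwards [hN x] with y hy
  exact hη.green_Lp_unique (hg x y hy).2 (hg x y hy).1 (hg y y (hmem y)).2 (hg y y (hmem y)).1

end surface

/-! ### Comparison of two forms -/

section surface

variable {X : Type*} [TopologicalSpace X] [T2Space X] [ChartedSpace ℂ X]
  [IsManifold (modelWithCornersSelf ℂ ℂ) 1 X] [MeasurableSpace X] [BorelSpace X]
  {η θ : RealTwoForm X} {e : OpenPartialHomeomorph X ℂ}

/-- The quotient `η / θ` of two forms. -/
def RealTwoForm.density (η θ : RealTwoForm X) (x : X) : ℝ :=
  η.coeff (chartAt ℂ x) (chartAt ℂ x x) / θ.coeff (chartAt ℂ x) (chartAt ℂ x x)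

/-- The Jacobian factors of the two forms cancel in the quotient, so the density defined with the
preferred chart serves in every chart. -/
lemma IsPosForm.coeff_eq_density_mul (hθ : IsPosForm θ) (he : e ∈ atlas ℂ X) {x : X}
    (hx : x ∈ e.source) : η.coeff e (e x) = η.density θ x * θ.coeff e (e x) := by
  have he' := chart_mem_atlas ℂ x
  have hx' := mem_chart_source ℂ x
  rw [RealTwoForm.density]
  set e' := chartAt ℂ x
  have h1 := θ.coeff_change e' he' e he (e' x) (e'.map_source hx') (by rwa [e'.left_inv hx'])
  have h2 := η.coeff_change e' he' e he (e' x) (e'.map_source hx') (by rwa [e'.left_inv hx'])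
  rw [e'.left_inv hx'] at h1 h2
  have h3 := (hθ e' he').1 _ (e'.map_source hx')
  rw [h1] at h3
  have h5 := (hθ e he).1 _ (e.map_source hx)
  rw [h2, h1]
  set d := ‖deriv (fun w => e (e'.symm w)) (e' x)‖
  have h4 : d ≠ 0 := fun h => by rw [h] at h3; simp at h3
  field_simp

lemma IsPosForm.coeff_eq_density_symm_mul (hθ : IsPosForm θ) (he : e ∈ atlas ℂ X) {z : ℂ}
    (hz : z ∈ e.target) : η.coeff e z = η.density θ (e.symm z) * θ.coeff e z := by
  have := hθ.coeff_eq_density_mul (η := η) he (e.map_target hz)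
  rwa [e.right_inv hz] at this

lemma IsPosForm.density_pos (hη : IsPosForm η) (hθ : IsPosForm θ) (x : X) : 0 < η.density θ x :=
  div_pos ((hη _ (chart_mem_atlas ℂ x)).1 _ (mem_chart_target ℂ x))
    ((hθ _ (chart_mem_atlas ℂ x)).1 _ (mem_chart_target ℂ x))

lemma IsPosForm.continuous_density (hη : IsPosForm η) (hθ : IsPosForm θ) :
    Continuous (η.density θ) := by
  refine continuous_iff_continuousAt.2 fun x => ?_
  have he := chart_mem_atlas ℂ x
  have hx := mem_chart_source ℂ x
  set e := chartAt ℂ x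
  have h1 : (fun y => η.coeff e (e y) / θ.coeff e (e y)) =ᶠ[𝓝 x] η.density θ := by
    filter_upwards [e.open_source.mem_nhds hx] with y hy
    have := ((hθ e he).1 _ (e.map_source hy)).ne'
    rw [hθ.coeff_eq_density_mul (η := η) he hy]
    field_simp
  refine ContinuousAt.congr ?_ h1
  have ht := e.open_target.mem_nhds (e.map_source hx)
  exact (ContinuousAt.comp (f := e) ((hη e he).2.continuousAt ht) (e.continuousAt hx)).div
    (ContinuousAt.comp (f := e) ((hθ e he).2.continuousAt ht) (e.continuousAt hx))
    ((hθ e he).1 _ (e.map_source hx)).ne'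

variable [SecondCountableTopology X]

lemma IsPosForm.measure_eq_withDensity (hη : IsPosForm η) (hθ : IsPosForm θ) :
    η.measure = θ.measure.withDensity fun x => ENNReal.ofReal (η.density θ x) := by
  obtain ⟨T, hT, hcov⟩ := TopologicalSpace.countable_cover_nhds fun x : X =>
    (chartAt ℂ x).open_source.mem_nhds (mem_chart_source ℂ x)
  have hTc : Countable T := hT.to_subtype
  have hcov' : ⋃ i : T, (chartAt ℂ (i : X)).source = Set.univ := by
    rw [← hcov, Set.iUnion_subtype]
  refine (Measure.ext_iff_of_iUnion_eq_univ hcov').2 fun i => ?_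
  have he := chart_mem_atlas ℂ (i : X)
  set e := chartAt ℂ (i : X)
  have hd : Measurable fun x => ENNReal.ofReal (η.density θ x) :=
    (hη.continuous_density hθ).measurable.ennreal_ofReal
  ext s hs
  rw [Measure.restrict_apply hs, Measure.restrict_apply hs,
    withDensity_apply _ (hs.inter e.open_source.measurableSet), Set.inter_comm,
    η.measure_apply_of_subset he (e.open_source.measurableSet.inter hs) Set.inter_subset_left,
    Set.inter_comm e.source s, ← Measure.restrict_restrict hs, ← lintegral_indicator hs,
    θ.measure_restrict_eq_map he,
    lintegral_map' (hd.indicator hs).aemeasurable (θ.aemeasurable_symm e),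
    RealTwoForm.planeMeasure, lintegral_withDensity_eq_lintegral_mul₀' (hθ.aemeasurable_coeff he)]
  · rw [← Measure.restrict_restrict_of_subset (s := e.symm ⁻¹' (s ∩ e.source) ∩ e.target)
      Set.inter_subset_right, ← lintegral_indicator]
    · refine setLIntegral_congr_fun e.open_target.measurableSet fun z hz => ?_
      have hzs : z ∈ e.symm ⁻¹' (s ∩ e.source) ∩ e.target ↔ e.symm z ∈ s :=
        ⟨fun h => h.1.1, fun h => ⟨⟨h, e.map_target hz⟩, hz⟩⟩
      by_cases h : e.symm z ∈ s
      · simp only [Pi.mul_apply]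
        rw [Set.indicator_of_mem (hzs.2 h), Set.indicator_of_mem h,
          hθ.coeff_eq_density_symm_mul (η := η) he hz,
          ENNReal.ofReal_mul (hη.density_pos hθ _).le, mul_comm]
      · simp only [Pi.mul_apply]
        rw [Set.indicator_of_notMem (mt hzs.1 h), Set.indicator_of_notMem h, mul_zero]
    · exact measurableSet_chart_preimage e (hs.inter e.open_source.measurableSet)
  · exact (hd.indicator hs).comp_aemeasurable (θ.aemeasurable_symm e)

lemma IsPosForm.integral_eq_integral_mul_density (hη : IsPosForm η) (hθ : IsPosForm θ)
    (w : X → ℝ) : ∫ x, w x ∂η.measure = ∫ x, w x * η.density θ x ∂θ.measure := by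
  rw [hη.measure_eq_withDensity hθ, integral_withDensity_eq_integral_toReal_smul
    (hη.continuous_density hθ).measurable.ennreal_ofReal (by simp)]
  refine integral_congr_ae (Eventually.of_forall fun x => ?_)
  simp only [smul_eq_mul]
  rw [ENNReal.toReal_ofReal (hη.density_pos hθ x).le, mul_comm]

lemma IsPosForm.vol_eq_integral_density (hη : IsPosForm η) (hθ : IsPosForm θ) :
    η.vol = ∫ x, η.density θ x ∂θ.measure := by
  have := hη.integral_eq_integral_mul_density hθ fun _ => 1
  simpa [RealTwoForm.vol] using this

variable [CompactSpace X]

lemma IsPosForm.integrable_of_integrable (hη : IsPosForm η) (hθ : IsPosForm θ) {w : X → ℝ}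
    (hw : Integrable w η.measure) : Integrable w θ.measure := by
  have h1 : Continuous fun x => (η.density θ x)⁻¹ :=
    (hη.continuous_density hθ).inv₀ fun x => (hη.density_pos hθ x).ne'
  have h2 : Integrable (fun x => w x * η.density θ x) θ.measure := by
    rw [hη.measure_eq_withDensity hθ, integrable_withDensity_iff_integrable_smul'
      (hη.continuous_density hθ).measurable.ennreal_ofReal (by simp)] at hw
    refine hw.congr (Eventually.of_forall fun x => ?_)
    simp only [smul_eq_mul]
    rw [ENNReal.toReal_ofReal (hη.density_pos hθ x).le, mul_comm]
  refine (integrable_mul_continuous h2 h1).congr (Eventually.of_forall fun x => ?_)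
  have := (hη.density_pos hθ x).ne'
  simp only
  field_simp

lemma RealTwoForm.measure_singleton (η : RealTwoForm X) (Q : X) : η.measure {Q} = 0 := by
  have he := chart_mem_atlas ℂ Q
  have hQ := mem_chart_source ℂ Q
  set e := chartAt ℂ Q
  rw [η.measure_apply_of_subset he (measurableSet_singleton Q) (by simpa using hQ)]
  have hsub : e.symm ⁻¹' {Q} ∩ e.target ⊆ {e Q} := by
    rintro z ⟨hz, hzt⟩
    rw [Set.mem_singleton_iff, ← show e.symm z = Q from hz, e.right_inv hzt]
  exact setLIntegral_measure_zero _ _ (measure_mono_null hsub (MeasureTheory.measure_singleton _))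

lemma RealTwoForm.ae_ne (η : RealTwoForm X) (Q : X) : ∀ᵐ x ∂η.measure, x ∈ ({Q}ᶜ : Set X) :=
  measure_eq_zero_iff_ae_notMem.1 (η.measure_singleton Q)

/-! ### Existence and uniqueness of Green's functions -/

/-- Neither dd^c nor the point mass depends on the reference form. Expressing η as density times θ
places the Green's functions of all forms η in the function spaces of one fixed form θ. -/
lemma IsGreenFunctionAt.isWeakSolution {Q : X} {g : X → ℝ} (h : IsGreenFunctionAt η Q g)
    (hη : IsPosForm η) (hθ : IsPosForm θ) :
    IsWeakSolution θ 1 Q g fun x => -(1 / η.vol) * η.density θ x := by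
  intro e he ψ hψ
  rw [hθ.integral_mul_chartLaplacian he hψ (hη.integrable_of_integrable hθ h.integrable).1,
    h.ddc_eq e he ψ hψ.contDiff hψ.hasCompactSupport hψ.tsupport_subset,
    hθ.integral_mul_chartExtend he (((hη.continuous_density hθ).const_mul
      _).aestronglyMeasurable) hψ.continuous_chartExtend.aestronglyMeasurable, one_mul,
    ← chartExtend, sub_eq_add_neg, ← neg_mul, ← integral_const_mul]
  congr 1
  refine setIntegral_congr_fun e.open_target.measurableSet fun z hz => ?_
  rw [hθ.coeff_eq_density_symm_mul (η := η) he hz]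
  ring

variable [ConnectedSpace X]

theorem IsPosForm.exists_isGreenFunctionAt (hη : IsPosForm η) (Q : X) :
    ∃ g, IsGreenFunctionAt η Q g := by
  have := hη.isFiniteMeasure
  obtain ⟨w, -, hw⟩ := hη.exists_continuous_green
  have hwi : Integrable (w Q) η.measure := (Lp.memLp (w Q)).integrable (by norm_num)
  obtain ⟨g, hg, hwg⟩ := hη.exists_continuousOn_of_isWeakSolution hwi (memLp_const _) (hw Q).2
    isOpen_compl_singleton (Or.inr fun h => h rfl)
  have hwg' : w Q =ᵐ[η.measure] g := by
    filter_upwards [hwg, η.ae_ne Q] with x h1 h2 using h1 h2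
  have hgi : Integrable g η.measure := hwi.congr hwg'
  refine ⟨g, hg, hgi, by rw [← integral_congr_ae hwg', (hw Q).1], fun e he ψ h1 h2 h3 => ?_⟩
  have hψ : IsChartTest e ψ := ⟨h1, h2, h3⟩
  have h4 := ((hw Q).2.congr_ae hwg' (Eventually.of_forall fun _ => rfl)) e he ψ hψ
  rw [hη.integral_mul_chartLaplacian he hψ hgi.1, one_mul,
    hη.integral_mul_chartExtend he aestronglyMeasurable_const
      hψ.continuous_chartExtend.aestronglyMeasurable] at h4
  rw [h4, ← chartExtend, sub_eq_add_neg, ← neg_mul, ← integral_const_mul]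
  simp only [mul_assoc]

/-- The difference is weakly harmonic, hence constant almost everywhere, and the normalization makes
the constant zero. Continuity off Q gives equality at every point there. -/
theorem IsGreenFunctionAt.eqOn {Q : X} {g g' : X → ℝ} (hη : IsPosForm η)
    (h : IsGreenFunctionAt η Q g) (h' : IsGreenFunctionAt η Q g') : Set.EqOn g g' {Q}ᶜ := by
  have := hη.isFiniteMeasure
  have := hη.isOpenPosMeasure
  have hdi : Integrable (fun x => -(1 / η.vol) * η.density η x) η.measure :=
    (memLp_of_continuous ((hη.continuous_density hη).const_mul _) 1).integrable le_rfl
  have h1 := (h.isWeakSolution hη hη).sub hη (h'.isWeakSolution hη hη) h.integrable hdi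
    h'.integrable hdi
  simp only [sub_self] at h1
  obtain ⟨a, ha⟩ := hη.ae_eq_const_of_isWeakSolution_zero (h.integrable.sub h'.integrable) h1
  have h2 : ∫ x, (g x - g' x) ∂η.measure = 0 := by
    rw [integral_sub h.integrable h'.integrable, h.integral_eq_zero, h'.integral_eq_zero, sub_zero]
  rw [show (fun x => g x - g' x) = g - g' from rfl, integral_congr_ae ha, integral_const,
    smul_eq_mul] at h2
  have ha0 : a = 0 := (mul_eq_zero.1 h2).resolve_left hη.vol_pos.ne'
  refine Measure.eqOn_open_of_ae_eq (μ := η.measure) (ae_restrict_of_ae ?_) isOpen_compl_singleton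
    h.continuousOn h'.continuousOn
  filter_upwards [ha] with x hx
  have : g x - g' x = a := hx
  linarith

end surface

/-! ### L¹ comparison of the Green's functions of two forms -/

section surface

variable {X : Type*} [TopologicalSpace X] [T2Space X] [ChartedSpace ℂ X]
  [IsManifold (modelWithCornersSelf ℂ ℂ) 1 X] [MeasurableSpace X] [BorelSpace X]
  {η θ : RealTwoForm X} {e : OpenPartialHomeomorph X ℂ}
  [SecondCountableTopology X] [CompactSpace X] [ConnectedSpace X]

lemma IsPosForm.abs_vol_sub_le (hη : IsPosForm η) (hθ : IsPosForm θ) {δ : ℝ}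
    (hδ : ∀ x, |η.density θ x - 1| ≤ δ) : |η.vol - θ.vol| ≤ δ * θ.vol := by
  have := hθ.isFiniteMeasure
  have hi : Integrable (η.density θ) θ.measure :=
    (memLp_of_continuous (hη.continuous_density hθ) 1).integrable le_rfl
  have h2 : η.vol - θ.vol = ∫ x, (η.density θ x - 1) ∂θ.measure := by
    rw [integral_sub hi (integrable_const _), ← hη.vol_eq_integral_density hθ]
    simp [RealTwoForm.vol]
  rw [h2, ← Real.norm_eq_abs]
  exact norm_integral_le_of_norm_le_const (Eventually.of_forall fun x => hδ x)

/-- Over the common denominator, the numerator is (density - 1) vol θ minus the difference of the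
volumes, and each part is at most δ vol θ. No smallness of δ is needed, and the uniform bound relies
on that. -/
lemma IsPosForm.abs_density_div_vol_sub_le (hη : IsPosForm η) (hθ : IsPosForm θ) {δ : ℝ}
    (hδ : ∀ x, |η.density θ x - 1| ≤ δ) (x : X) :
    |η.density θ x / η.vol - 1 / θ.vol| ≤ 2 * (δ / η.vol) := by
  have := hθ.isFiniteMeasure
  have hV := hη.vol_pos
  have hV₀ := hθ.vol_pos
  have h1 := hη.abs_vol_sub_le hθ hδ
  have h3 : η.density θ x / η.vol - 1 / θ.vol
      = ((η.density θ x - 1) * θ.vol - (η.vol - θ.vol)) / (η.vol * θ.vol) := by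
    field_simp
    ring
  rw [h3, abs_div, abs_of_pos (mul_pos hV hV₀), div_le_iff₀ (mul_pos hV hV₀)]
  calc _ ≤ |(η.density θ x - 1) * θ.vol| + |η.vol - θ.vol| := abs_sub _ _
    _ ≤ δ * θ.vol + δ * θ.vol := by
        rw [abs_mul, abs_of_pos hV₀]
        exact add_le_add (mul_le_mul_of_nonneg_right (hδ x) hV₀.le) h1
    _ = _ := by field_simp; ring

/-- Comparison in `L¹` of a Green's function of `η` with the Green's functions of `θ`. -/
theorem IsPosForm.exists_integral_abs_green_sub_le (hθ : IsPosForm θ) :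
    ∃ (g : X → Lp ℝ 2 θ.measure) (C : ℝ), Continuous g ∧ 0 ≤ C ∧
      ∀ η : RealTwoForm X, IsPosForm η → ∀ δ : ℝ, (∀ x, |η.density θ x - 1| ≤ δ) →
      ∀ Q G, IsGreenFunctionAt η Q G → ∀ Q',
        ∫ x, |G x - g Q' x| ∂θ.measure
          ≤ C * (‖g Q - g Q'‖ + δ / η.vol + (δ / η.vol) ^ 2) := by
  have := hθ.isFiniteMeasure
  obtain ⟨g, hgc, hg⟩ := hθ.exists_continuous_green
  obtain ⟨A, hA⟩ := hθ.exists_solution_operator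
  obtain ⟨S, hS⟩ := isCompact_univ.exists_bound_of_continuousOn hgc.continuousOn
  have hV₀ := hθ.vol_pos
  set V₀ := θ.vol with hV₀def
  set b : ℝ := (eLpNorm (fun _ : X => (1 : ℝ)) 2 θ.measure).toReal with hb
  set a' : ℝ := (measureUnivNNReal θ.measure : ℝ) ^ (2 : ℝ≥0∞).toReal⁻¹ with ha'
  have hb0 : 0 ≤ b := ENNReal.toReal_nonneg
  have ha0 : 0 ≤ a' := by positivity
  have hS0 : 0 ≤ S := (norm_nonneg _).trans (hS (Classical.arbitrary X) trivial)
  set B := ‖A‖ * (a' * 2) with hB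
  have hB0 : 0 ≤ B := mul_nonneg (norm_nonneg _) (mul_nonneg ha0 zero_le_two)
  refine ⟨g, b + b * B + V₀ * b * S + V₀ * b * B, hgc, by positivity,
    fun η hη δ hδ Q G hG Q' => ?_⟩
  have hV := hη.vol_pos
  set V := η.vol with hVdef
  have hδ0 : 0 ≤ δ := (abs_nonneg _).trans (hδ (Classical.arbitrary X))
  set r := δ / V with hr
  have hr0 : 0 ≤ r := div_nonneg hδ0 hV.le
  set ρ := η.density θ with hρ
  have hρc : Continuous ρ := hη.continuous_density hθ
  -- This function, of mean zero for θ, is the discrepancy between the smooth parts of the two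
  -- Green's equations.
  have hfc : Continuous fun x => ρ x / V - 1 / V₀ := (hρc.div_const _).sub continuous_const
  have hfm := memLp_of_continuous (μ := θ.measure) hfc 2
  set f := hfm.toLp _ with hf
  have hi : ∀ w : Lp ℝ 2 θ.measure, Integrable w θ.measure := fun w =>
    (Lp.memLp w).integrable (by norm_num)
  have hρi : Integrable ρ θ.measure := (memLp_of_continuous hρc 1).integrable le_rfl
  have hf0 : ∫ x, f x ∂θ.measure = 0 := by
    rw [integral_congr_ae hfm.coeFn_toLp, integral_sub (hρi.div_const _) (integrable_const _),
      integral_div, ← hη.vol_eq_integral_density hθ, integral_const, smul_eq_mul,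
      show θ.measure.real Set.univ = V₀ from rfl]
    field_simp
    ring
  have hfn : ‖f‖ ≤ a' * 2 * r := by
    rw [mul_assoc]
    refine Lp.norm_le_of_ae_bound (mul_nonneg zero_le_two hr0) ?_
    filter_upwards [hfm.coeFn_toLp] with x hx
    rw [hx]
    exact hη.abs_density_div_vol_sub_le hθ hδ x
  obtain ⟨hAw, hA0⟩ := hA f hf0
  have hAn : ‖A f‖ ≤ B * r := by
    calc _ ≤ ‖A‖ * ‖f‖ := A.le_opNorm f
      _ ≤ ‖A‖ * (a' * 2 * r) := by gcongr
      _ = _ := by rw [hB]; ring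
  -- The function u solves the same equation as G, with the same pole, so G - u is a constant c.
  set u := g Q - A f with hu
  have hun : ‖u‖ ≤ S + B * r := (norm_sub_le _ _).trans (add_le_add (hS Q trivial) hAn)
  have huae : u =ᵐ[θ.measure] fun x => g Q x - A f x := Lp.coeFn_sub ..
  have hu0 : ∫ x, u x ∂θ.measure = 0 := by
    rw [integral_congr_ae huae, integral_sub (hi _) (hi _), (hg Q).1, hA0, sub_zero]
  have hGi := hη.integrable_of_integrable hθ hG.integrable
  have hGw := hG.isWeakSolution hη hθ
  have huw := (hg Q).2.sub hθ (hAw Q) (hi _) (integrable_const _) (hi _) (hi _)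
  have hdiff := hGw.sub hθ huw hGi (hρi.const_mul _) ((hi _).sub (hi _))
    ((integrable_const _).sub (hi _))
  have hdiff' : IsWeakSolution θ 0 Q (fun x => G x - u x) fun _ => 0 := by
    have h1 := hdiff.congr_ae (w' := fun x => G x - u x) (f' := fun _ => 0)
      (by filter_upwards [huae] with x hx; rw [hx]) (by
        filter_upwards [hfm.coeFn_toLp] with x hx
        simp only [hf, hx]
        ring)
    simpa using h1
  obtain ⟨c, hc⟩ := hθ.ae_eq_const_of_isWeakSolution_zero (hGi.sub (hi u)) hdiff'
  -- The constant is read off from the normalization ∫ G ρ θ = 0. As u has mean zero for θ, it gives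
  -- c V = -∫ u (ρ - 1) θ.
  have hcb : |c| ≤ r * (b * (S + B * r)) := by
    have h1 : ∫ x, G x * ρ x ∂θ.measure = 0 := by
      rw [← hη.integral_eq_integral_mul_density hθ, hG.integral_eq_zero]
    have h2 : ∫ x, (u x * (ρ x - 1) + (u x + c * ρ x)) ∂θ.measure = 0 := by
      rw [← h1]
      refine integral_congr_ae ?_
      filter_upwards [hc] with x hx
      have hx' : G x - u x = c := hx
      rw [← hx']
      ring
    have hu1 : Integrable (fun x => u x * (ρ x - 1)) θ.measure :=
      integrable_mul_continuous (hi u) (hρc.sub continuous_const)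
    have hu2 : Integrable (fun x => u x + c * ρ x) θ.measure := (hi u).add (hρi.const_mul c)
    rw [integral_add hu1 hu2, integral_add (hi u) (hρi.const_mul c),
      hu0, integral_const_mul, ← hη.vol_eq_integral_density hθ, zero_add] at h2
    have h3 : |∫ x, u x * (ρ x - 1) ∂θ.measure| ≤ δ * (b * ‖u‖) := by
      calc |∫ x, u x * (ρ x - 1) ∂θ.measure| ≤ ∫ x, δ * |u x| ∂θ.measure := by
            rw [← Real.norm_eq_abs]
            refine norm_integral_le_of_norm_le ((hi u).abs.const_mul δ)
              (Eventually.of_forall fun x => ?_)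
            rw [norm_mul, mul_comm]
            exact mul_le_mul_of_nonneg_right (hδ x) (abs_nonneg _)
        _ ≤ _ := by
            rw [integral_const_mul]
            exact mul_le_mul_of_nonneg_left (integral_abs_le_mul_norm u) hδ0
    have h4 : c * V = -∫ x, u x * (ρ x - 1) ∂θ.measure := by linarith
    have h5 : |c| * V ≤ δ * (b * (S + B * r)) := by
      rw [← abs_of_pos hV, ← abs_mul, h4, abs_neg]
      refine h3.trans ?_
      gcongr
    rw [hr, div_mul_eq_mul_div, le_div_iff₀ hV]
    exact h5
  have hmain : ∫ x, |G x - g Q' x| ∂θ.measure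
      ≤ ∫ x, (|(g Q - g Q' - A f) x| + |c|) ∂θ.measure := by
    refine integral_mono_ae (hGi.sub (hi _)).abs ((hi _).abs.add (integrable_const _)) ?_
    filter_upwards [hc, huae, Lp.coeFn_sub (g Q - g Q') (A f), Lp.coeFn_sub (g Q) (g Q')]
      with x h1 h2 h3 h4
    have h1' : G x - u x = c := h1
    rw [h3, Pi.sub_apply, h4, Pi.sub_apply]
    refine le_trans (le_of_eq ?_) (abs_add_le _ _)
    rw [← h1', h2]
    congr 1
    ring
  refine hmain.trans ?_
  rw [integral_add (hi _).abs (integrable_const _), integral_const, smul_eq_mul,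
    show θ.measure.real Set.univ = V₀ from rfl]
  have h6 : ∫ x, |(g Q - g Q' - A f) x| ∂θ.measure ≤ b * (‖g Q - g Q'‖ + B * r) :=
    (integral_abs_le_mul_norm _).trans (mul_le_mul_of_nonneg_left
      ((norm_sub_le _ _).trans (add_le_add le_rfl hAn)) hb0)
  have h7 := mul_le_mul_of_nonneg_left hcb hV₀.le
  have h8 : 0 ≤ ‖g Q - g Q'‖ := norm_nonneg _
  refine (add_le_add h6 h7).trans ?_
  generalize ‖g Q - g Q'‖ = n at h8
  clear_value b B V₀ r
  have e1 : b * (n + B * r) + V₀ * (r * (b * (S + B * r)))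
      = b * n + b * B * r + V₀ * b * S * r + V₀ * b * B * r ^ 2 := by ring
  rw [e1]
  have p1 : 0 ≤ b * B := mul_nonneg hb0 hB0
  have p2 : 0 ≤ V₀ * b * S := by positivity
  have p3 : 0 ≤ V₀ * b * B := by positivity
  have t0 : n ≤ n + r + r ^ 2 := by nlinarith
  have t1 : r ≤ n + r + r ^ 2 := by nlinarith
  have t2 : r ^ 2 ≤ n + r + r ^ 2 := by linarith
  have := mul_le_mul_of_nonneg_left t0 hb0
  have := mul_le_mul_of_nonneg_left t1 p1
  have := mul_le_mul_of_nonneg_left t1 p2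
  have := mul_le_mul_of_nonneg_left t2 p3
  linarith

end surface

/-! ### The uniform upper bound -/

section surface

variable {X : Type*} [TopologicalSpace X] [T2Space X] [ChartedSpace ℂ X]
  [IsManifold (modelWithCornersSelf ℂ ℂ) 1 X] [MeasurableSpace X] [BorelSpace X]
  {η θ : RealTwoForm X} {e : OpenPartialHomeomorph X ℂ}
  [SecondCountableTopology X] [CompactSpace X]

/-- For c ≥ 0 the term c k(x, Q) is nonpositive and is dropped. The remaining terms are bounded by
Cauchy-Schwarz and by the boundedness of s, uniformly over a finite cover, so the constant depends
on neither c nor Q. -/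
theorem IsPosForm.exists_ae_le_of_isWeakSolution (hθ : IsPosForm θ) :
    ∃ C : ℝ, 0 ≤ C ∧ ∀ (c : ℝ) (Q : X) (w f : X → ℝ), 0 ≤ c → Integrable w θ.measure →
      MemLp f 2 θ.measure → IsWeakSolution θ c Q w f →
      ∀ᵐ y ∂θ.measure, w y ≤ C * ((eLpNorm f 2 θ.measure).toReal + ∫ x, |w x| ∂θ.measure) := by
  have := hθ.isFiniteMeasure
  choose N k s hxN hP using fun x => hθ.exists_isLocalParametrix x
  choose S hS using fun x => (hP x).bounded
  set M : X → Set X := fun x => N x ∩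
    {y | dist (((hP x).memLp y).toLp (k x y)) (((hP x).memLp x).toLp (k x x)) < 1}
  have hM : ∀ x, M x ∈ 𝓝 x := fun x =>
    inter_mem ((hP x).isOpen.mem_nhds (hxN x)) ((((hP x).continuousOn_toLp).continuousAt
      ((hP x).isOpen.mem_nhds (hxN x))).eventually (Metric.ball_mem_nhds _ zero_lt_one))
  obtain ⟨t, -, ht⟩ := isCompact_univ.elim_nhds_subcover M fun x _ => hM x
  set c' : X → ℝ := fun x => ‖((hP x).memLp x).toLp (k x x)‖ + 1 + |S x| with hc'
  have hc0 : ∀ x, 0 ≤ c' x := fun x => by positivity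
  have hC0 : 0 ≤ ∑ x ∈ t, c' x := Finset.sum_nonneg fun x _ => hc0 x
  refine ⟨∑ x ∈ t, c' x, hC0, fun c Q w f hc hw hf h => ?_⟩
  have hae : ∀ᵐ y ∂θ.measure, ∀ x ∈ t, y ∈ N x → w y = c * k x y Q
      + ∫ z, f z * k x y z ∂θ.measure - ∫ z, w z * s x y z ∂θ.measure :=
    (ae_ball_iff t.countable_toSet).2 fun x _ =>
      (hP x).representation c Q w f hw (hf.integrable (by norm_num)) h
  filter_upwards [hae] with y hy
  have hy' : y ∈ ⋃ x ∈ t, M x := ht trivial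
  obtain ⟨x, hx, hyx⟩ := Set.mem_iUnion₂.1 hy'
  rw [hy x hx hyx.1]
  have h0 : c * k x y Q ≤ 0 := mul_nonpos_of_nonneg_of_nonpos hc ((hP x).nonpos _ _)
  have hle := Finset.single_le_sum (f := c') (fun x _ => hc0 x) hx
  have h1 : |∫ z, f z * k x y z ∂θ.measure| ≤ (∑ x ∈ t, c' x) * (eLpNorm f 2 θ.measure).toReal := by
    refine (abs_integral_mul_le hf ((hP x).memLp y)).trans ?_
    rw [← Lp.norm_toLp _ ((hP x).memLp y), mul_comm]
    refine mul_le_mul_of_nonneg_right (le_trans ?_ hle) ENNReal.toReal_nonneg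
    have h2 : dist (((hP x).memLp y).toLp (k x y)) (((hP x).memLp x).toLp (k x x)) < 1 := hyx.2
    rw [dist_eq_norm] at h2
    have h3 := norm_le_norm_add_norm_sub' (((hP x).memLp y).toLp (k x y))
      (((hP x).memLp x).toLp (k x x))
    have h4 := abs_nonneg (S x)
    simp only [hc']
    linarith
  have h2 : |∫ z, w z * s x y z ∂θ.measure| ≤ (∑ x ∈ t, c' x) * ∫ z, |w z| ∂θ.measure := by
    rw [← Real.norm_eq_abs, ← integral_const_mul]
    refine norm_integral_le_of_norm_le (hw.abs.const_mul _) (Eventually.of_forall fun z => ?_)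
    rw [norm_mul, mul_comm]
    refine mul_le_mul_of_nonneg_right (((hS x y z).trans (le_abs_self _)).trans (le_trans ?_ hle))
      (abs_nonneg _)
    exact le_add_of_nonneg_left (by positivity)
  rw [mul_add]
  rw [abs_le] at h1 h2
  linarith

lemma le_of_ae_le_of_continuousOn {μ : Measure X} [μ.IsOpenPosMeasure] {U : Set X}
    (hU : IsOpen U) {g : X → ℝ} (hg : ContinuousOn g U) {K : ℝ} (h : ∀ᵐ x ∂μ, g x ≤ K) {x : X}
    (hx : x ∈ U) : g x ≤ K := by
  have h1 : Set.EqOn (fun x => max (g x) K) (fun _ => K) U :=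
    Measure.eqOn_open_of_ae_eq (μ := μ) (ae_restrict_of_ae (h.mono fun x hx => max_eq_right hx)) hU
      (hg.sup continuousOn_const) continuousOn_const
  exact max_eq_right_iff.1 (h1 hx)

variable [ConnectedSpace X]

/-- Green's functions of the forms between `Λ⁻¹ θ` and `Λ θ` are uniformly bounded above. -/
theorem IsPosForm.exists_green_le (hθ : IsPosForm θ) {Λ : ℝ} (hΛ : 0 < Λ) :
    ∃ K : ℝ, 0 < K ∧ ∀ η : RealTwoForm X, IsPosForm η → (∀ x, Λ⁻¹ ≤ η.density θ x) →
      (∀ x, η.density θ x ≤ Λ) → ∀ Q G, IsGreenFunctionAt η Q G → ∀ P, P ≠ Q → G P ≤ K := by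
  have := hθ.isFiniteMeasure
  have := hθ.isOpenPosMeasure
  obtain ⟨g, C, hgc, hC, hg⟩ := hθ.exists_integral_abs_green_sub_le
  obtain ⟨C', hC', hb⟩ := hθ.exists_ae_le_of_isWeakSolution
  obtain ⟨S, hS⟩ := isCompact_univ.exists_bound_of_continuousOn hgc.continuousOn
  have hV₀ := hθ.vol_pos
  set b : ℝ := (eLpNorm (fun _ : X => (1 : ℝ)) 2 θ.measure).toReal with hbdef
  set a' : ℝ := (measureUnivNNReal θ.measure : ℝ) ^ (2 : ℝ≥0∞).toReal⁻¹ with ha'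
  have hb0 : 0 ≤ b := ENNReal.toReal_nonneg
  have ha0 : 0 ≤ a' := by positivity
  have hS0 : 0 ≤ S := (norm_nonneg _).trans (hS (Classical.arbitrary X) trivial)
  -- R bounds δ / vol η with δ = Λ + 1: the densities lie between 0 and Λ, and the volume of η is at
  -- least Λ⁻¹ vol θ.
  set R := (Λ + 1) / (Λ⁻¹ * θ.vol) with hR
  have hR0 : 0 ≤ R := div_nonneg (by linarith) (mul_pos (inv_pos.2 hΛ) hV₀).le
  refine ⟨C' * (a' * R + (C * (R + R ^ 2) + b * S)) + 1,
    add_pos_of_nonneg_of_pos (mul_nonneg hC' (add_nonneg (mul_nonneg ha0 hR0)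
      (add_nonneg (mul_nonneg hC (add_nonneg hR0 (sq_nonneg R))) (mul_nonneg hb0 hS0)))) one_pos,
    fun η hη h1 h2 Q G hG P hP => ?_⟩
  have hV := hη.vol_pos
  have hρc := hη.continuous_density hθ
  have hVΛ : Λ⁻¹ * θ.vol ≤ η.vol := by
    rw [hη.vol_eq_integral_density hθ]
    calc Λ⁻¹ * θ.vol = ∫ _, Λ⁻¹ ∂θ.measure := by simp [RealTwoForm.vol, mul_comm]
      _ ≤ _ := integral_mono (integrable_const _)
        ((memLp_of_continuous hρc 1).integrable le_rfl) h1
  have hr : (Λ + 1) / η.vol ≤ R :=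
    div_le_div_of_nonneg_left (by linarith) (mul_pos (inv_pos.2 hΛ) hV₀) hVΛ
  have hr0 : 0 ≤ (Λ + 1) / η.vol := div_nonneg (by linarith) hV.le
  have hGi := hη.integrable_of_integrable hθ hG.integrable
  have hgi : Integrable (g Q) θ.measure := (Lp.memLp (g Q)).integrable (by norm_num)
  have h3 : ∫ x, |G x - g Q x| ∂θ.measure ≤ C * (R + R ^ 2) := by
    refine (hg η hη (Λ + 1) (fun x => ?_) Q G hG Q).trans ?_
    · have := hη.density_pos hθ x
      rw [abs_le]
      constructor <;> linarith [h2 x]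
    · rw [sub_self, norm_zero, zero_add]
      exact mul_le_mul_of_nonneg_left (add_le_add hr (pow_le_pow_left₀ hr0 hr 2)) hC
  have h4 : ∫ x, |G x| ∂θ.measure ≤ C * (R + R ^ 2) + b * S := by
    calc ∫ x, |G x| ∂θ.measure ≤ ∫ x, (|G x - g Q x| + |g Q x|) ∂θ.measure := by
          refine integral_mono hGi.abs ((hGi.sub hgi).abs.add hgi.abs) fun x => ?_
          have := abs_add_le (G x - g Q x) (g Q x)
          simpa using this
      _ = ∫ x, |G x - g Q x| ∂θ.measure + ∫ x, |g Q x| ∂θ.measure :=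
          integral_add (hGi.sub hgi).abs hgi.abs
      _ ≤ _ := add_le_add h3 ((integral_abs_le_mul_norm _).trans
          (mul_le_mul_of_nonneg_left (hS Q trivial) hb0))
  have hfc : Continuous fun x => -(1 / η.vol) * η.density θ x := hρc.const_mul _
  have hfm := memLp_of_continuous (μ := θ.measure) hfc 2
  have h5 : (eLpNorm (fun x => -(1 / η.vol) * η.density θ x) 2 θ.measure).toReal ≤ a' * R := by
    rw [← Lp.norm_toLp _ hfm]
    refine Lp.norm_le_of_ae_bound hR0 ?_
    filter_upwards [hfm.coeFn_toLp] with x hx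
    rw [hx, norm_mul, norm_neg, Real.norm_of_nonneg (one_div_nonneg.2 hV.le),
      Real.norm_of_nonneg (hη.density_pos hθ x).le, one_div_mul_eq_div]
    exact (div_le_div_of_nonneg_right (by linarith [h2 x]) hV.le).trans hr
  have h6 := hb 1 Q G _ zero_le_one hGi hfm (hG.isWeakSolution hη hθ)
  -- The bound holds almost everywhere and passes to every P ≠ Q by continuity.
  refine le_of_ae_le_of_continuousOn (μ := θ.measure) isOpen_compl_singleton hG.continuousOn ?_ hP
  filter_upwards [h6] with x hx
  refine hx.trans ((mul_le_mul_of_nonneg_left (add_le_add h5 h4) hC').trans ?_)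
  linarith

/-- On a closed coordinate disk the coefficient of θ has a positive minimum, so uniform convergence
of coefficients gives uniform convergence of quotients; compactness leaves finitely many disks. -/
lemma tendsto_density {β : ℝ≥0} {η : ℕ → RealTwoForm X} (hθ : IsPosForm θ)
    (h : TendstoHolderForm β η θ) {δ : ℝ} (hδ : 0 < δ) :
    ∀ᶠ i in atTop, ∀ x, |(η i).density θ x - 1| ≤ δ := by
  have hloc : ∀ x₀ : X, ∃ M ∈ 𝓝 x₀, ∀ᶠ i in atTop, ∀ x ∈ M, |(η i).density θ x - 1| ≤ δ := by
    intro x₀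
    have he := chart_mem_atlas ℂ x₀
    have hx₀ := mem_chart_source ℂ x₀
    set e := chartAt ℂ x₀
    obtain ⟨r, hr, hrt⟩ := Metric.nhds_basis_closedBall.mem_iff.1
      (e.open_target.mem_nhds (e.map_source hx₀))
    have hK : IsCompact (Metric.closedBall (e x₀) r) := isCompact_closedBall _ _
    obtain ⟨z₀, hz₀, hmin⟩ := hK.exists_isMinOn ⟨e x₀, Metric.mem_closedBall_self hr.le⟩
      ((hθ e he).2.mono hrt)
    have hm := (hθ e he).1 z₀ (hrt hz₀)
    refine ⟨e.source ∩ e ⁻¹' Metric.ball (e x₀) r, (e.isOpen_inter_preimage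
      Metric.isOpen_ball).mem_nhds ⟨hx₀, Metric.mem_ball_self hr⟩, ?_⟩
    filter_upwards [(h e he).2 _ hK hrt (δ * θ.coeff e z₀).toNNReal
      (Real.toNNReal_pos.2 (by positivity))] with i hi x hx
    have hxK := Metric.ball_subset_closedBall hx.2
    have h1 := hi.2.1 0 le_rfl (e x) hxK
    rw [norm_iteratedFDeriv_zero, Real.coe_toNNReal _ (by positivity)] at h1
    have h2 := hθ.coeff_eq_density_mul (η := η i) he hx.1
    have h3 : θ.coeff e z₀ ≤ θ.coeff e (e x) := hmin hxK
    have h4 := hm.trans_le h3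
    have h5 : |(η i).density θ x - 1| * θ.coeff e (e x) ≤ δ * θ.coeff e (e x) := by
      rw [← abs_of_pos h4, ← abs_mul, abs_of_pos h4, sub_mul, one_mul, ← h2]
      exact h1.trans (mul_le_mul_of_nonneg_left h3 hδ.le)
    exact le_of_mul_le_mul_right h5 h4
  choose M hM hMi using hloc
  obtain ⟨t, -, ht⟩ := isCompact_univ.elim_nhds_subcover M fun x _ => hM x
  filter_upwards [(Finset.eventually_all t).2 fun x _ => hMi x] with i hi x
  have hx : x ∈ ⋃ y ∈ t, M y := ht trivial
  obtain ⟨y, hy, hxy⟩ := Set.mem_iUnion₂.1 hx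
  exact hi y hy x hxy

end surface

/-! ### Convergence of Green's functions -/

lemma holderBound_zero (β : ℝ) : HolderBound β 0 fun _ => 0 := by
  have e : ∀ m z, iteratedFDeriv ℝ m (fun _ : ℂ => (0 : ℝ)) z = 0 := fun m z => by
    rw [show (fun _ : ℂ => (0 : ℝ)) = 0 from rfl, iteratedFDeriv_zero]; rfl
  exact ⟨contDiff_const, fun m _ z => by rw [e, norm_zero], fun z z' => by simp [e]⟩

lemma HolderBound.nat_mul {β C : ℝ} {u : ℂ → ℝ} (h : HolderBound β C u) (n : ℕ) :
    HolderBound β (n * C) (fun z => n * u z) := by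
  induction n with
  | zero => simpa using holderBound_zero β
  | succ n ih => simpa [add_mul] using ih.add h

lemma HolderBound.sum {ι : Type*} {β : ℝ} {C : ι → ℝ} {u : ι → ℂ → ℝ} (t : Finset ι)
    (h : ∀ j ∈ t, HolderBound β (C j) (u j)) :
    HolderBound β (∑ j ∈ t, C j) (fun z => ∑ j ∈ t, u j z) := by
  classical
  induction t using Finset.induction_on with
  | empty => simpa using holderBound_zero β
  | insert a t ha ih =>
    simp only [Finset.sum_insert ha]
    exact (h a (Finset.mem_insert_self _ _)).add
      (ih fun j hj => h j (Finset.mem_insert_of_mem hj))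

lemma HolderBound.mono {β C C' : ℝ} {u : ℂ → ℝ} (h : HolderBound β C u) (hC : C ≤ C') :
    HolderBound β C' u :=
  ⟨h.contDiff, fun m hm z => (h.norm_le m hm z).trans hC, fun z z' => (h.dist_le z z').trans
    (mul_le_mul_of_nonneg_right hC (Real.rpow_nonneg (norm_nonneg _) _))⟩

section surface

variable {X : Type*} [TopologicalSpace X] [T2Space X] [ChartedSpace ℂ X]
  [IsManifold (modelWithCornersSelf ℂ ℂ) 1 X] [MeasurableSpace X] [BorelSpace X]
  {θ : RealTwoForm X} {η : ℕ → RealTwoForm X} {e : OpenPartialHomeomorph X ℂ} {β : ℝ≥0}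
  [SecondCountableTopology X] [CompactSpace X]

variable [ConnectedSpace X]

lemma exists_tendsto_density_bound (hθ : IsPosForm θ) (hη : ∀ i, IsPosForm (η i))
    (h : TendstoHolderForm β η θ) :
    ∃ δ : ℕ → ℝ, Tendsto δ atTop (𝓝 0) ∧ ∀ i x, |(η i).density θ x - 1| ≤ δ i := by
  have hb : ∀ i, BddAbove (Set.range fun x => |(η i).density θ x - 1|) := fun i => by
    have hc : Continuous fun x => |(η i).density θ x - 1| :=
      (((hη i).continuous_density hθ).sub continuous_const).abs
    simpa using isCompact_univ.bddAbove_image hc.continuousOn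
  refine ⟨fun i => ⨆ x, |(η i).density θ x - 1|, ?_, fun i x => le_ciSup (hb i) x⟩
  rw [Metric.tendsto_nhds]
  intro ε hε
  filter_upwards [tendsto_density hθ h (half_pos hε)] with i hi
  rw [Real.dist_eq, sub_zero, abs_of_nonneg (Real.iSup_nonneg fun _ => abs_nonneg _)]
  exact (Real.iSup_le hi (half_pos hε).le).trans_lt (half_lt_self hε)

lemma tendsto_vol (hθ : IsPosForm θ) (hη : ∀ i, IsPosForm (η i)) (h : TendstoHolderForm β η θ) :
    Tendsto (fun i => (η i).vol) atTop (𝓝 θ.vol) := by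
  obtain ⟨δ, hδ, hb⟩ := exists_tendsto_density_bound hθ hη h
  rw [tendsto_iff_dist_tendsto_zero]
  have h1 := hδ.mul_const θ.vol
  rw [zero_mul] at h1
  exact squeeze_zero (fun _ => dist_nonneg) (fun i => (hη i).abs_vol_sub_le hθ (hb i)) h1

/-- Both functions are compared with the L² Green's function of θ with pole Q₀. Its continuous
dependence on the pole handles the motion of Q i, and the convergence of the densities handles that
of the forms. -/
lemma tendsto_integral_abs_green_sub (hθ : IsPosForm θ) (hη : ∀ i, IsPosForm (η i))
    (h : TendstoHolderForm β η θ) {Q : ℕ → X} {Q₀ : X} (hQ : Tendsto Q atTop (𝓝 Q₀))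
    {G : ℕ → X → ℝ} {G₀ : X → ℝ} (hG : ∀ i, IsGreenFunctionAt (η i) (Q i) (G i))
    (hG₀ : IsGreenFunctionAt θ Q₀ G₀) :
    Tendsto (fun i => ∫ x, |G i x - G₀ x| ∂θ.measure) atTop (𝓝 0) := by
  obtain ⟨δ, hδ, hb⟩ := exists_tendsto_density_bound hθ hη h
  obtain ⟨g, C, hgc, hC, hg⟩ := hθ.exists_integral_abs_green_sub_le
  have hr : Tendsto (fun i => δ i / (η i).vol) atTop (𝓝 0) := by
    have := hδ.div (tendsto_vol hθ hη h) hθ.vol_pos.ne'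
    rwa [zero_div] at this
  have h1 : Tendsto (fun i => C * (‖g (Q i) - g Q₀‖ + δ i / (η i).vol + (δ i / (η i).vol) ^ 2))
      atTop (𝓝 0) := by
    have h2 : Tendsto (fun i => ‖g (Q i) - g Q₀‖) atTop (𝓝 0) := by
      have := (((hgc.tendsto Q₀).comp hQ).sub_const (g Q₀)).norm
      simpa using this
    simpa using ((h2.add hr).add (hr.pow 2)).const_mul C
  have hgi : ∀ Q, Integrable (g Q) θ.measure := fun Q => by
    have := hθ.isFiniteMeasure
    exact (Lp.memLp (g Q)).integrable (by norm_num)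
  have hi : ∀ i, Integrable (G i) θ.measure := fun i =>
    (hη i).integrable_of_integrable hθ (hG i).integrable
  -- Applying the comparison to θ itself with δ = 0 identifies G₀ with the L² Green's function.
  have hself : ∀ x, |θ.density θ x - 1| ≤ 0 := fun x => by
    have hx := ((hθ _ (chart_mem_atlas ℂ x)).1 _ (mem_chart_target ℂ x)).ne'
    rw [RealTwoForm.density, div_self hx]; simp
  have h0 : ∫ x, |G₀ x - g Q₀ x| ∂θ.measure ≤ 0 := by
    have := hg θ hθ 0 hself Q₀ G₀ hG₀ Q₀
    simpa using this
  refine squeeze_zero (fun i => integral_nonneg fun _ => abs_nonneg _) (fun i => ?_) h1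
  calc ∫ x, |G i x - G₀ x| ∂θ.measure
      ≤ ∫ x, (|G i x - g Q₀ x| + |G₀ x - g Q₀ x|) ∂θ.measure := by
        refine integral_mono ((hi i).sub hG₀.integrable).abs
          (((hi i).sub (hgi _)).abs.add (hG₀.integrable.sub (hgi _)).abs) fun x => ?_
        have := abs_sub (G i x - g Q₀ x) (G₀ x - g Q₀ x)
        simpa using this
    _ = ∫ x, |G i x - g Q₀ x| ∂θ.measure + ∫ x, |G₀ x - g Q₀ x| ∂θ.measure :=
        integral_add ((hi i).sub (hgi _)).abs (hG₀.integrable.sub (hgi _)).abs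
    _ ≤ _ := by linarith [hg (η i) (hη i) (δ i) (hb i) (Q i) (G i) (hG i) Q₀]

lemma IsGreenFunctionAt.integral_mul_laplacian {η : RealTwoForm X} {Q : X} {G : X → ℝ}
    (hG : IsGreenFunctionAt η Q G) (he : e ∈ atlas ℂ X) {K' : Set ℂ} (hK' : K' ⊆ e.target)
    (hQ : ∀ z ∈ K', e.symm z ≠ Q) {ψ : ℂ → ℝ} (h1 : ContDiff ℝ (⊤ : ℕ∞) ψ)
    (h2 : HasCompactSupport ψ) (h3 : tsupport ψ ⊆ K') :
    ∫ z, G (e.symm z) * Laplacian.laplacian ψ z = ∫ z, -(η.coeff e z / η.vol) * ψ z := by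
  have hψ : IsChartTest e ψ := ⟨h1, h2, h3.trans hK'⟩
  have h4 := hG.ddc_eq e he ψ h1 h2 (h3.trans hK')
  rw [hψ.setIntegral_mul_laplacian fun z => G (e.symm z)] at h4
  have h5 : e.source.indicator (fun P => ψ (e P)) Q = 0 := by
    by_cases hQs : Q ∈ e.source
    · rw [Set.indicator_of_mem hQs]
      exact image_eq_zero_of_notMem_tsupport fun h => hQ _ (h3 h) (e.left_inv hQs)
    · rw [Set.indicator_of_notMem hQs]
  rw [h4, h5, zero_sub, ← neg_mul, ← integral_const_mul,
    ← hψ.setIntegral_mul fun z => -(η.coeff e z / η.vol)]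
  refine integral_congr_ae (Eventually.of_forall fun z => ?_)
  simp only
  ring

lemma IsGreenFunctionAt.continuousOn_symm {η : RealTwoForm X} {Q : X} {G : X → ℝ}
    (hG : IsGreenFunctionAt η Q G) {K' : Set ℂ} (hK' : K' ⊆ e.target)
    (hQ : ∀ z ∈ K', e.symm z ≠ Q) : ContinuousOn (fun z => G (e.symm z)) K' :=
  hG.continuousOn.comp (e.continuousOn_symm.mono hK') hQ

lemma IsKahlerForm.exists_bound_coeff (hθ : IsKahlerForm β θ) (he : e ∈ atlas ℂ X) {K' : Set ℂ}
    (hK : IsCompact K') (hK' : K' ⊆ e.target) :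
    ∃ B : ℝ, 0 ≤ B ∧ (∀ z ∈ K', |θ.coeff e z| ≤ B) ∧
      ∀ z ∈ K', ∀ w ∈ K', |θ.coeff e z - θ.coeff e w| ≤ B * ‖z - w‖ ^ (β : ℝ) := by
  obtain ⟨B₁, hB₁⟩ := hK.exists_bound_of_continuousOn ((hθ.isPosForm e he).2.mono hK')
  obtain ⟨B₂, hB₂⟩ := (hθ e he).2.2 K' hK hK'
  refine ⟨max B₁ B₂, le_max_of_le_right B₂.2, fun z hz => (hB₁ z hz).trans (le_max_left _ _),
    fun z hz w hw => (abs_sub_le_of_holderOnWith_iteratedFDeriv_zero hB₂ hz hw).trans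
      (mul_le_mul_of_nonneg_right (le_max_right _ _) (Real.rpow_nonneg (norm_nonneg _) _))⟩

variable {U : Set ℂ} {K : Set ℂ}

theorem IsGreenFunctionAt.exists_holderBound (hβ0 : 0 < β) (hβ1 : β < 1) (hθ : IsKahlerForm β θ)
    {Q₀ : X} {G₀ : X → ℝ} (hG₀ : IsGreenFunctionAt θ Q₀ G₀) (he : e ∈ atlas ℂ X) (hU : IsOpen U)
    (hUt : U ⊆ e.target) (hQ₀ : ∀ z ∈ U, e.symm z ≠ Q₀) (hK : IsCompact K) (hKU : K ⊆ U) :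
    ∃ W, IsOpen W ∧ K ⊆ W ∧ ∃ C u, HolderBound β C u ∧ Set.EqOn (fun z => G₀ (e.symm z)) u W := by
  obtain ⟨K', W, hK'c, hK'U, hW, hKW, -, C, -, hb⟩ :=
    exists_holderBound_of_weak_solution (β := β) (by exact_mod_cast hβ0) (by exact_mod_cast hβ1)
      hK hU hKU
  have hK't := hK'U.trans hUt
  have hQ' : ∀ z ∈ K', e.symm z ≠ Q₀ := fun z hz => hQ₀ z (hK'U hz)
  obtain ⟨B, hB0, hB1, hB2⟩ := hθ.exists_bound_coeff he hK'c hK't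
  have hV := hθ.isPosForm.vol_pos
  obtain ⟨u, hu, huv⟩ := hb (fun z => G₀ (e.symm z)) (fun z => -(θ.coeff e z / θ.vol)) (B / θ.vol)
    (div_nonneg hB0 hV.le) (hG₀.continuousOn_symm hK't hQ')
    ((((hθ.isPosForm e he).2.mono hK't).div_const _).neg) (fun z hz => by
      rw [abs_neg, abs_div, abs_of_pos hV]
      exact div_le_div_of_nonneg_right (hB1 z hz) hV.le) (fun z hz w hw => by
      rw [← neg_sub', abs_neg, ← sub_div, abs_div, abs_of_pos hV, div_mul_eq_mul_div]
      exact div_le_div_of_nonneg_right (hB2 z hz w hw) hV.le)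
    (fun ψ h1 h2 h3 => hG₀.integral_mul_laplacian he hK't hQ' h1 h2 h3)
  exact ⟨W, hW, hKW, _, u, hu, huv⟩

/-- Away from the poles, G i - G₀ solves a Poisson equation whose right-hand side tends to zero in
C^β, while its L¹ norm tends to zero by the comparison estimate. The interior Schauder estimate does
the rest, with W chosen before ε. -/
theorem exists_eventually_holderBound_green_sub (hβ0 : 0 < β) (hβ1 : β < 1)
    (hθ : IsKahlerForm β θ) (hη : ∀ i, IsKahlerForm β (η i)) (h : TendstoHolderForm β η θ)
    {Q : ℕ → X} {Q₀ : X} (hQ : Tendsto Q atTop (𝓝 Q₀)) {G : ℕ → X → ℝ} {G₀ : X → ℝ}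
    (hG : ∀ i, IsGreenFunctionAt (η i) (Q i) (G i)) (hG₀ : IsGreenFunctionAt θ Q₀ G₀)
    (he : e ∈ atlas ℂ X) (hU : IsOpen U)
    (hUt : U ⊆ e.target) (hQ₀ : ∀ z ∈ U, e.symm z ≠ Q₀) (hK : IsCompact K) (hKU : K ⊆ U) :
    ∃ W, IsOpen W ∧ K ⊆ W ∧ ∀ ε : ℝ, 0 < ε → ∀ᶠ i in atTop, ∃ u, HolderBound β ε u ∧
      Set.EqOn (fun z => G i (e.symm z) - G₀ (e.symm z)) u W := by
  obtain ⟨K', W, hK'c, hK'U, hW, hKW, -, C, hC, hb⟩ :=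
    exists_holderBound_of_weak_solution (β := β) (by exact_mod_cast hβ0) (by exact_mod_cast hβ1)
      hK hU hKU
  refine ⟨W, hW, hKW, fun ε hε => ?_⟩
  have hK't := hK'U.trans hUt
  have hQ' : ∀ z ∈ K', e.symm z ≠ Q₀ := fun z hz => hQ₀ z (hK'U hz)
  have hθp := hθ.isPosForm
  have hηp := fun i => (hη i).isPosForm
  have hV₀ := hθp.vol_pos
  have hV := fun i => (hηp i).vol_pos
  obtain ⟨B, hB0, hB1, hB2⟩ := hθ.exists_bound_coeff he hK'c hK't
  obtain ⟨C', hC', hint⟩ := hθp.exists_setIntegral_le he hK'c hK't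
  -- Both the right-hand side and the L¹ norm will be at most ε', so the Schauder bound is C (2 ε')
  -- ≤ ε.
  set ε' := ε / (2 * (C + 1)) with hε'
  have hε'0 : 0 < ε' := by positivity
  have hvol := tendsto_vol hθp hηp h
  -- The image of K' on the surface is compact and misses Q₀, hence misses Q i for large i.
  have hout : ∀ᶠ i in atTop, ∀ z ∈ K', e.symm z ≠ Q i := by
    have hcl : IsClosed (e.symm '' K') :=
      (hK'c.image_of_continuousOn (e.continuousOn_symm.mono hK't)).isClosed
    have hmem : (e.symm '' K')ᶜ ∈ 𝓝 Q₀ :=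
      hcl.isOpen_compl.mem_nhds (by rintro ⟨z, hz, hzQ⟩; exact hQ' z hz hzQ)
    filter_upwards [hQ.eventually hmem] with i hi z hz hzQ
    exact hi ⟨z, hz, hzQ⟩
  have hL1 : ∀ᶠ i in atTop, C' * ∫ x, |G i x - G₀ x| ∂θ.measure < ε' := by
    have := (tendsto_integral_abs_green_sub hθp hηp h hQ hG hG₀).const_mul C'
    rw [mul_zero] at this
    exact this.eventually (gt_mem_nhds hε'0)
  have hvb : ∀ᶠ i in atTop, B * |1 / (η i).vol - 1 / θ.vol| < ε' / 2 := by
    have h1 : Tendsto (fun i => 1 / (η i).vol) atTop (𝓝 (1 / θ.vol)) :=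
      tendsto_const_nhds.div hvol hV₀.ne'
    have h2 := ((h1.sub_const (1 / θ.vol)).abs).const_mul B
    rw [sub_self, abs_zero, mul_zero] at h2
    exact h2.eventually (gt_mem_nhds (half_pos hε'0))
  -- Since the volume of η i eventually exceeds half that of θ, this bound on the difference of
  -- coefficients becomes ε' / 2 after division by the volume.
  have hν0 : 0 < ε' * θ.vol / 4 := by positivity
  filter_upwards [hout, hL1, hvb, hvol.eventually (lt_mem_nhds (half_lt_self hV₀)),
    (h e he).2 K' hK'c hK't (ε' * θ.vol / 4).toNNReal (Real.toNNReal_pos.2 hν0)]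
    with i h1 h2 h3 h4 h5
  set ν := ε' * θ.vol / 4 with hν
  set c := (η i).coeff e
  set c₀ := θ.coeff e
  set V := (η i).vol
  have hVi : 0 < V := hV i
  have hνV : ν / V ≤ ε' / 2 := by
    rw [div_le_iff₀ hVi, hν]
    nlinarith
  have hp0 : ∀ z ∈ K', |c z - c₀ z| ≤ ν := fun z hz => by
    have := h5.2.1 0 le_rfl z hz
    rwa [norm_iteratedFDeriv_zero, Real.coe_toNNReal _ hν0.le] at this
  have hp1 : ∀ z ∈ K', ∀ w ∈ K', |(c z - c₀ z) - (c w - c₀ w)| ≤ ν * ‖z - w‖ ^ (β : ℝ) :=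
    fun z hz w hw => by
      have := abs_sub_le_of_holderOnWith_iteratedFDeriv_zero h5.2.2 hz hw
      rwa [Real.coe_toNNReal _ hν0.le] at this
  set κ := 1 / V - 1 / θ.vol with hκ
  have hfeq : ∀ z, -(c z / V) - -(c₀ z / θ.vol) = -((c z - c₀ z) / V + c₀ z * κ) := fun z => by
    rw [hκ]; ring
  -- One inequality for two uses: t = 1 gives the sup bound and t = ‖z - w‖ ^ β the Hölder bound.
  have hcomb : ∀ a a₀ t : ℝ, 0 ≤ t → |a| ≤ ν * t → |a₀| ≤ B * t →
      |-(a / V + a₀ * κ)| ≤ ε' * t := by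
    intro a a₀ t ht ha ha₀
    rw [abs_neg]
    calc |a / V + a₀ * κ| ≤ |a / V| + |a₀ * κ| := abs_add_le _ _
      _ = |a| / V + |a₀| * |κ| := by rw [abs_div, abs_mul, abs_of_pos hVi]
      _ ≤ ν * t / V + B * t * |κ| := add_le_add (div_le_div_of_nonneg_right ha hVi.le)
          (mul_le_mul_of_nonneg_right ha₀ (abs_nonneg _))
      _ = (ν / V + B * |κ|) * t := by ring
      _ ≤ ε' * t := mul_le_mul_of_nonneg_right (by linarith) ht
  have hcc : ContinuousOn c K' := ((hηp i) e he).2.mono hK't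
  have hcc₀ : ContinuousOn c₀ K' := (hθp e he).2.mono hK't
  obtain ⟨u, hu, huv⟩ := hb (fun z => G i (e.symm z) - G₀ (e.symm z))
    (fun z => -(c z / V) - -(c₀ z / θ.vol)) ε' hε'0.le
    (((hG i).continuousOn_symm hK't h1).sub (hG₀.continuousOn_symm hK't hQ'))
    ((hcc.div_const _).neg.sub (hcc₀.div_const _).neg)
    (fun z hz => by
      rw [hfeq]
      have := hcomb (c z - c₀ z) (c₀ z) 1 zero_le_one (by simpa using hp0 z hz)
        (by simpa using hB1 z hz)
      rwa [mul_one] at this)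
    (fun z hz w hw => by
      rw [hfeq, hfeq]
      have := hcomb _ _ _ (Real.rpow_nonneg (norm_nonneg (z - w)) _) (hp1 z hz w hw) (hB2 z hz w hw)
      refine le_trans (le_of_eq ?_) this
      congr 1
      ring)
    (fun ψ k1 k2 k3 => by
      have hcψ := continuous_laplacian (contDiff_infty.1 k1 2)
      have hsub : ∀ f : ℂ → ℝ, ContinuousOn f K' → ∀ φ : ℂ → ℝ, Continuous φ →
          tsupport φ ⊆ K' → Integrable fun z => f z * φ z := by
        intro f hf φ hφ hs
        rw [← integrableOn_iff_integrable_of_support_subset (s := K')]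
        · exact (hf.mul hφ.continuousOn).integrableOn_compact hK'c
        · intro z hz
          by_contra hzK
          exact hz (by simp only [image_eq_zero_of_notMem_tsupport fun h => hzK (hs h), mul_zero])
      have hs' := (laplacian_tsupport_subset ψ).trans k3
      have e1 := (hG i).integral_mul_laplacian he hK't h1 k1 k2 k3
      have e2 := hG₀.integral_mul_laplacian he hK't hQ' k1 k2 k3
      have i1 : Integrable fun z => -(c z / V) * ψ z :=
        hsub _ (hcc.div_const _).neg _ k1.continuous k3
      have i2 : Integrable fun z => -(c₀ z / θ.vol) * ψ z :=
        hsub _ (hcc₀.div_const _).neg _ k1.continuous k3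
      simp only [sub_mul]
      rw [integral_sub (hsub _ ((hG i).continuousOn_symm hK't h1) _ hcψ hs')
        (hsub _ (hG₀.continuousOn_symm hK't hQ') _ hcψ hs'), e1, e2]
      exact (integral_sub i1 i2).symm)
  refine ⟨u, hu.mono ?_, huv⟩
  have hGi := (hηp i).integrable_of_integrable hθp (hG i).integrable
  have h6 := (hint (fun x => G i x - G₀ x) (hGi.sub hG₀.integrable)).2
  calc C * (ε' + ∫ z in K', |G i (e.symm z) - G₀ (e.symm z)|)
      ≤ C * (ε' + ε') := mul_le_mul_of_nonneg_left (by linarith) hC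
    _ ≤ (C + 1) * (ε' + ε') := by nlinarith
    _ = ε := by rw [hε']; field_simp; ring

end surface

/-! ### Green's functions of divisors and of a Kähler class -/

section surface

variable {X : Type*} [TopologicalSpace X] [T2Space X] [ChartedSpace ℂ X]
  [IsManifold (modelWithCornersSelf ℂ ℂ) 1 X] [MeasurableSpace X] [BorelSpace X]
  {θ : RealTwoForm X} {β : ℝ≥0} [SecondCountableTopology X] [CompactSpace X] [ConnectedSpace X]

/-- Positivity comes from the lower bound Λ⁻¹ θ ≤ η, and continuity of the coefficient from u being
C². -/
lemma IsPosForm.of_mem_kahlerFormsBetween {η : RealTwoForm X} (hθ : IsPosForm θ) {Λ : ℝ}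
    (hΛ : 0 < Λ) (h : η ∈ kahlerFormsBetween β θ Λ) : IsPosForm η := by
  obtain ⟨⟨u, hu, hη⟩, hle, -⟩ := h
  refine fun e he => ⟨fun z hz =>
    (mul_pos (inv_pos.2 hΛ) ((hθ e he).1 z hz)).trans_le (hle e he z hz), ?_⟩
  have h1 : ContDiffOn ℝ 2 (u ∘ e.symm) e.target := by simpa using (hu e he).1
  exact ((hθ e he).2.add (continuousOn_laplacian e.open_target h1)).congr (hη e he)

lemma IsPosForm.le_density (hθ : IsPosForm θ) {η : RealTwoForm X} {c : ℝ} (h : FormSMulLE c θ η)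
    (x : X) : c ≤ η.density θ x :=
  (le_div_iff₀ ((hθ _ (chart_mem_atlas ℂ x)).1 _ (mem_chart_target ℂ x))).2
    (h _ (chart_mem_atlas ℂ x) _ (mem_chart_target ℂ x))

lemma IsPosForm.density_le (hθ : IsPosForm θ) {η : RealTwoForm X} {c : ℝ} (h : FormLESMul η c θ)
    (x : X) : η.density θ x ≤ c :=
  (div_le_iff₀ ((hθ _ (chart_mem_atlas ℂ x)).1 _ (mem_chart_target ℂ x))).2
    (h _ (chart_mem_atlas ℂ x) _ (mem_chart_target ℂ x))

lemma IsPosForm.exists_density_bounds {η : RealTwoForm X} (hη : IsPosForm η) (hθ : IsPosForm θ) :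
    ∃ Λ : ℝ, 0 < Λ ∧ ∀ x, Λ⁻¹ ≤ η.density θ x ∧ η.density θ x ≤ Λ := by
  have hc := hη.continuous_density hθ
  have hp := hη.density_pos hθ
  obtain ⟨x₀, -, h₀⟩ := isCompact_univ.exists_isMinOn Set.univ_nonempty hc.continuousOn
  obtain ⟨x₁, -, h₁⟩ := isCompact_univ.exists_isMaxOn Set.univ_nonempty hc.continuousOn
  refine ⟨max (η.density θ x₁) (η.density θ x₀)⁻¹, lt_max_of_lt_left (hp x₁), fun x =>
    ⟨?_, (h₁ (Set.mem_univ x)).trans (le_max_left _ _)⟩⟩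
  exact (inv_le_of_inv_le₀ (hp x₀) (le_max_right _ _)).trans (h₀ (Set.mem_univ x))

/-- For large i the densities are within 1/2 of 1; the finitely many remaining forms are bounded one
by one, and the sum of their constants dominates each of them. -/
lemma exists_uniform_density_bounds {η : ℕ → RealTwoForm X} (hθ : IsPosForm θ)
    (hη : ∀ i, IsPosForm (η i)) (h : TendstoHolderForm β η θ) :
    ∃ Λ : ℝ, 0 < Λ ∧ ∀ i x, Λ⁻¹ ≤ (η i).density θ x ∧ (η i).density θ x ≤ Λ := by
  choose L hL0 hL using fun i => (hη i).exists_density_bounds hθ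
  obtain ⟨N, hN⟩ := eventually_atTop.1 (tendsto_density hθ h (by norm_num : (0 : ℝ) < 1 / 2))
  have hS : ∀ i < N, L i ≤ ∑ i ∈ Finset.range N, L i := fun i hi =>
    Finset.single_le_sum (f := L) (fun i _ => (hL0 i).le) (Finset.mem_range.2 hi)
  have hS0 : 0 ≤ ∑ i ∈ Finset.range N, L i := Finset.sum_nonneg fun i _ => (hL0 i).le
  refine ⟨2 + ∑ i ∈ Finset.range N, L i, by linarith, fun i x => ?_⟩
  rcases lt_or_ge i N with hi | hi
  · exact ⟨(inv_anti₀ (hL0 i) (by linarith [hS i hi])).trans (hL i x).1,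
      (hL i x).2.trans (by linarith [hS i hi])⟩
  · have h1 := abs_le.1 (hN i hi x)
    have h2 : (2 + ∑ i ∈ Finset.range N, L i)⁻¹ ≤ (2 : ℝ)⁻¹ := inv_anti₀ two_pos (by linarith)
    exact ⟨by linarith [h1.1], by linarith [h1.2]⟩

theorem exists_sum_green_le {η : ℕ → RealTwoForm X} (hθ : IsPosForm θ)
    (hη : ∀ i, IsPosForm (η i)) (h : TendstoHolderForm β η θ) {ι : Type*} [Fintype ι] (m : ι → ℕ)
    {p : ℕ → ι → X} {G : ℕ → X → X → ℝ} (hG : ∀ i, IsGreenFunction (η i) (G i)) :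
    ∃ K : ℝ, 0 < K ∧ ∀ i P, (∀ j, P ≠ p i j) → ∑ j, (m j : ℝ) * G i P (p i j) ≤ K := by
  obtain ⟨Λ, hΛ, hb⟩ := exists_uniform_density_bounds hθ hη h
  obtain ⟨K, hK, hGK⟩ := hθ.exists_green_le hΛ
  have h0 : 0 ≤ ∑ j, (m j : ℝ) * K :=
    Finset.sum_nonneg fun j _ => mul_nonneg (Nat.cast_nonneg _) hK.le
  refine ⟨∑ j, (m j : ℝ) * K + 1, by linarith, fun i P hP => ?_⟩
  have h1 : ∑ j, (m j : ℝ) * G i P (p i j) ≤ ∑ j, (m j : ℝ) * K :=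
    Finset.sum_le_sum fun j _ => mul_le_mul_of_nonneg_left
      (hGK (η i) (hη i) (fun x => (hb i x).1) (fun x => (hb i x).2) _ _ (hG i (p i j)) P (hP j))
      (Nat.cast_nonneg _)
  linarith

/-- The Hölder bounds of the individual Green's functions are added over the points of the divisor,
on the intersection of finitely many neighbourhoods of K. Coincident limit points cause no
difficulty, since each term is treated separately. -/
theorem tendstoHolderFun_sum_green (hβ0 : 0 < β) (hβ1 : β < 1) (hθ : IsKahlerForm β θ)
    {η : ℕ → RealTwoForm X} (hη : ∀ i, IsKahlerForm β (η i)) (h : TendstoHolderForm β η θ)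
    {ι : Type*} [Fintype ι] (m : ι → ℕ) {p : ℕ → ι → X} {p₀ : ι → X}
    (hp : ∀ j, Tendsto (fun i => p i j) atTop (𝓝 (p₀ j))) {G : ℕ → X → X → ℝ} {G₀ : X → X → ℝ}
    (hG : ∀ i, IsGreenFunction (η i) (G i)) (hG₀ : IsGreenFunction θ G₀) :
    TendstoHolderFun 2 β (fun i P => ∑ j, (m j : ℝ) * G i P (p i j))
      (fun P => ∑ j, (m j : ℝ) * G₀ P (p₀ j)) (Set.range p₀)ᶜ := by
  intro e he
  set U : Set ℂ := e.target ∩ e.symm ⁻¹' (Set.range p₀)ᶜ with hUdef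
  have hU : IsOpen U :=
    e.isOpen_inter_preimage_symm (Set.finite_range p₀).isClosed.isOpen_compl
  have hUt : U ⊆ e.target := Set.inter_subset_left
  have hUp : ∀ j, ∀ z ∈ U, e.symm z ≠ p₀ j := fun j z hz hzj => hz.2 ⟨j, hzj.symm⟩
  have hlim : ∀ K, IsCompact K → K ⊆ U → ∃ C : ℝ≥0,
      HolderNormLE 2 β C ((fun P => ∑ j, (m j : ℝ) * G₀ P (p₀ j)) ∘ e.symm) K := by
    intro K hK hKU
    choose W hW hKW C u hu huW using fun j =>
      (hG₀ (p₀ j)).exists_holderBound hβ0 hβ1 hθ he hU hUt (hUp j) hK hKU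
    have hs := HolderBound.sum Finset.univ fun j _ => (hu j).nat_mul (m j)
    refine ⟨(∑ j, m j * C j).toNNReal, (hs.mono (Real.le_coe_toNNReal _)).holderNormLE le_rfl
      (isOpen_iInter_of_finite hW) (Set.subset_iInter hKW) fun z hz => ?_⟩
    exact Finset.sum_congr rfl fun j _ => by
      rw [← huW j (Set.mem_iInter.1 hz j)]
  refine ⟨⟨fun z hz => ?_, fun K hK hKU => ?_⟩, fun K hK hKU ε hε => ?_⟩
  · obtain ⟨C, hC⟩ := hlim {z} isCompact_singleton (Set.singleton_subset_iff.2 hz)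
    exact (hC.1 z rfl).contDiffWithinAt
  · obtain ⟨C, hC⟩ := hlim K hK hKU
    exact ⟨C, hC.2.2⟩
  · choose W hW hKW hWε using fun j =>
      exists_eventually_holderBound_green_sub hβ0 hβ1 hθ hη h (hp j) (fun i => hG i (p i j))
        (hG₀ (p₀ j)) he hU hUt (hUp j) hK hKU
    set M : ℝ := ∑ j, (m j : ℝ) with hM
    have hM0 : 0 ≤ M := Finset.sum_nonneg fun j _ => Nat.cast_nonneg _
    -- M + 1 instead of M, because the total multiplicity may be zero.
    have hε' : 0 < (ε : ℝ) / (M + 1) := div_pos hε (by linarith)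
    filter_upwards [eventually_all.2 fun j => hWε j _ hε'] with i hi
    choose u hu huW using hi
    have hs := HolderBound.sum Finset.univ fun j _ => (hu j).nat_mul (m j)
    have hle : ∑ j, (m j : ℝ) * ((ε : ℝ) / (M + 1)) ≤ ε := by
      rw [← Finset.sum_mul, ← mul_div_assoc, div_le_iff₀ (by linarith)]
      nlinarith [ε.2]
    refine (hs.mono hle).holderNormLE le_rfl (isOpen_iInter_of_finite hW)
      (Set.subset_iInter hKW) fun z hz => ?_
    simp only [Function.comp_apply]
    rw [← Finset.sum_sub_distrib]
    refine Finset.sum_congr rfl fun j _ => ?_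
    rw [← mul_sub]
    exact congrArg _ (huW j (Set.mem_iInter.1 hz j))

end surface

end

/-! ### The main theorem -/

theorem mainTheorem12 {X : Type*} [TopologicalSpace X] [T2Space X] [CompactSpace X]
    [ConnectedSpace X] [ChartedSpace ℂ X] [IsManifold (modelWithCornersSelf ℂ ℂ) 1 X]
    [MeasurableSpace X] [BorelSpace X] (β : ℝ≥0) (hβ0 : 0 < β) (hβ1 : β < 1) :
    -- existence and uniqueness of the normalized Green's function
    (∀ η : RealTwoForm X, IsKahlerForm β η →
      (∃ G : X → X → ℝ, IsGreenFunction η G) ∧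
      ∀ G G' : X → X → ℝ, IsGreenFunction η G → IsGreenFunction η G' →
        ∀ P Q, P ≠ Q → G P Q = G' P Q) ∧
    -- the uniform upper bound
    (∀ η₀ : RealTwoForm X, IsKahlerForm β η₀ → ∀ Λ : ℝ, 1 < Λ →
      ∃ K : ℝ, 0 < K ∧ ∀ η ∈ kahlerFormsBetween β η₀ Λ,
        ∀ G : X → X → ℝ, IsGreenFunction η G → ∀ P Q, P ≠ Q → G P Q ≤ K) ∧
    -- convergence in the fixed class
    (∀ η₀ : RealTwoForm X, IsKahlerForm β η₀ →
      ∀ η : ℕ → RealTwoForm X, (∀ i, IsKahlerForm β (η i)) →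
      (∀ i, InKahlerClass β (η i) η₀) → TendstoHolderForm β η η₀ →
      ∀ (Q : ℕ → X) (Q₀ : X), Tendsto Q atTop (𝓝 Q₀) →
      ∀ (G : ℕ → X → X → ℝ) (G₀ : X → X → ℝ),
      (∀ i, IsGreenFunction (η i) (G i)) → IsGreenFunction η₀ G₀ →
        TendstoHolderFun 2 β (fun i P => G i P (Q i)) (fun P => G₀ P Q₀) {Q₀}ᶜ) ∧
    -- Green's functions of divisors with varying Kähler forms, of possibly varying volumes
    (∀ η₀ : RealTwoForm X, IsKahlerForm β η₀ →
      ∀ η : ℕ → RealTwoForm X, (∀ i, IsKahlerForm β (η i)) → TendstoHolderForm β η η₀ →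
      ∀ (d : ℕ) (m : Fin d → ℕ), (∀ j, 0 < m j) →
      ∀ (p : ℕ → Fin d → X) (p₀ : Fin d → X),
      (∀ j, Tendsto (fun i => p i j) atTop (𝓝 (p₀ j))) →
      ∀ (G : ℕ → X → X → ℝ) (G₀ : X → X → ℝ),
      (∀ i, IsGreenFunction (η i) (G i)) → IsGreenFunction η₀ G₀ →
        (∃ K : ℝ, 0 < K ∧ ∀ i P, (∀ j, P ≠ p i j) → ∑ j, (m j : ℝ) * G i P (p i j) ≤ K) ∧
        TendstoHolderFun 2 β (fun i P => ∑ j, (m j : ℝ) * G i P (p i j))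
          (fun P => ∑ j, (m j : ℝ) * G₀ P (p₀ j)) (Set.range p₀)ᶜ) := by
  -- Second countability, used throughout for measurability and countable covers, follows from
  -- compactness.
  have := ChartedSpace.secondCountable_of_sigmaCompact ℂ X
  refine ⟨fun η hη => ⟨?_, fun G G' hG hG' P Q hPQ => ?_⟩, fun η₀ h₀ Λ hΛ => ?_, ?_, ?_⟩
  · choose G hG using hη.isPosForm.exists_isGreenFunctionAt
    exact ⟨fun P Q => G Q P, hG⟩
  · exact (hG Q).eqOn hη.isPosForm (hG' Q) hPQ
  · have hΛ0 := one_pos.trans hΛ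
    obtain ⟨K, hK, hb⟩ := h₀.isPosForm.exists_green_le hΛ0
    exact ⟨K, hK, fun η hη G hG P Q hPQ => hb η (h₀.isPosForm.of_mem_kahlerFormsBetween hΛ0 hη)
      (h₀.isPosForm.le_density hη.2.1) (h₀.isPosForm.density_le hη.2.2) Q _ (hG Q) P hPQ⟩
  · intro η₀ h₀ η hη _ hlim Q Q₀ hQ G G₀ hG hG₀
    -- A single moving pole is a divisor with one point of multiplicity one.
    simpa using tendstoHolderFun_sum_green hβ0 hβ1 h₀ hη hlim (fun _ : Unit => 1)
      (p := fun i _ => Q i) (p₀ := fun _ => Q₀) (fun _ => hQ) hG hG₀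
  · intro η₀ h₀ η hη hlim d m _ p p₀ hp G G₀ hG hG₀
    exact ⟨exists_sum_green_le h₀.isPosForm (fun i => (hη i).isPosForm) hlim m hG,
      tendstoHolderFun_sum_green hβ0 hβ1 h₀ hη hlim m hp hG hG₀⟩
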